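/- **Lemma (Nearest hub search).** *Model.* An MPC (Massively Parallel Computation) algorithm runs on $\mathcal M$ machines, each with a local memory of $\mathcal S$ words; its global space is $\mathcal T=\mathcal S\cdot\mathcal M$. It works in synchronous rounds: in each round every machine applies an arbitrary function to its memory and to $\mathcal S$ fresh, private, independent, uniformly random words, keeps part of the result and sends messages to other machines, which find them in their memory in the next round. A machine may never hold, send in one round, or receive in one round more than $\mathcal S$ words. A word is either a $w$-bit integer or a real number; real words may be read in arbitrary computations, but a machine may only store and send real words that it holds (they can be copied, not computed). A point of $\mathbb R^d$ is stored as its $d$ coordinates. For a point $q$ and a nonempty finite set $H$ let $d(q,H)=\min_{h\in H}d(q,h)$, where $d(\cdot,\cdot)$ is the Euclidean distance. For every $\rho>0$ there is a constant $c_\rho>1$, depending only on $\rho$, such that for every dimension $d$, every $\delta\in(0,1)$ and every $\gamma>0$ there is a constant $C$ (depending only on $\rho,d,\delta,\gamma$) for which the following holds. For every integer $n\ge 2$ and every real $\Delta\ge 2$ there is a randomized MPC algorithm with - at most $C$ rounds (i.e. $\mathcal O(1)$ rounds), - local space $\mathcal S\le C\,n^{\delta}$, - global space $\mathcal T\le C\,n^{1+\rho}\,\log^2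 n\,\log\Delta$, - integer words of $w\le C\log(n\log\Delta)$ bits, - $\mathcal M\cdot\lceil n^\delta\rceil\ge n$ (so that every admissible input can be distributed over the machines), such that the following holds for every set $Q\subset\mathbb R^d$ of at most $n$ points, any two distinct points of which are at distance at least $1$ and at most $\Delta$, for every set of hubs $H\subseteq Q$, and for every initial distribution of the points of $Q$, each with a bit telling whether it is a hub, over the machines with at most $\lceil n^\delta\rceil$ points per machine. The space limits above are respected for all outcomes of the random words, and if $H\neq\emptyset$ then, with probability at least $1-n^{-\gamma}$, at the end the memories of the machines together consist of exactly one pair $(q,\mathrm{close}(q))$ for each $q\in Q\setminus H$, where $$\mathrm{close}(q)\in H\quad\text{and}\quad d(q,\mathrm{close}(q))<2c_\rho\cdot d(q,H).$$ -/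

import Mathlib

/-- A memory word of the Massively Parallel Computation (MPC) model on real inputs.  It holds either
a real number or a `w`-bit integer.  Real words are indivisible: an algorithm may read them in
arbitrary computations, but may only store and send real words that it holds (see `MPCAlgorithm`).
Otherwise one real number could encode the memory of all machines, and no bound on the space would
mean anything. -/
inductive MPCWord (w : ℕ) : Type
  | real : ℝ → MPCWord w
  | int : Fin (2 ^ w) → MPCWord w

/-- A randomized MPC algorithm with `machines` machines, each with `localSpace` words of memory,
running for `rounds` synchronous rounds.  In round `t`, machine `i` applies an arbitrary function
`step t i` to its memory and to `localSpace` fresh random words; the result is the part of its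
memory that it keeps and the message (possibly empty) that it sends to each machine. -/
structure MPCAlgorithm where
  machines : ℕ
  localSpace : ℕ
  wordBits : ℕ
  rounds : ℕ
  step : Fin rounds → Fin machines → List (MPCWord wordBits) →
    (Fin localSpace → Fin (2 ^ wordBits)) →
      List (MPCWord wordBits) × (Fin machines → List (MPCWord wordBits))
  real_kept : ∀ t i mem r x,
    MPCWord.real x ∈ (step t i mem r).1 → MPCWord.real x ∈ mem
  real_sent : ∀ t i mem r j x,
    MPCWord.real x ∈ (step t i mem r).2 j → MPCWord.real x ∈ mem

namespace MPCAlgorithm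

variable (A : MPCAlgorithm)

/-- The contents of the memories of all machines. -/
abbrev Config : Type := Fin A.machines → List (MPCWord A.wordBits)

/-- The random words of all rounds and all machines.  A uniformly random element consists of
independent uniformly random words, each private to one machine and one round. -/
abbrev Coins : Type :=
  Fin A.rounds → Fin A.machines → Fin A.localSpace → Fin (2 ^ A.wordBits)

/-- The message from machine `i` to machine `j` in round `t`. -/
def message (ω : A.Coins) (t : Fin A.rounds) (m : A.Config) (i j : Fin A.machines) :
    List (MPCWord A.wordBits) :=
  (A.step t i (m i) (ω t i)).2 j

/-- One round: every machine holds afterwards what it kept, followed by the messages that it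
received. -/
def next (ω : A.Coins) (t : Fin A.rounds) (m : A.Config) : A.Config := fun j =>
  (A.step t j (m j) (ω t j)).1 ++ (List.ofFn fun i => A.message ω t m i j).flatten

/-- The contents of the memories after `t` rounds (of at most `A.rounds`), from the contents `m`. -/
def configAt (ω : A.Coins) (m : A.Config) : ℕ → A.Config
  | 0 => m
  | t + 1 =>
    if h : t < A.rounds then A.next ω ⟨t, h⟩ (configAt ω m t) else configAt ω m t

/-- Started from `m`, whatever the random words are, no machine ever holds more than `localSpace`
words, and no machine sends or receives more than `localSpace` words in a round. -/
def RespectsSpace (m : A.Config) : Prop :=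
  ∀ ω : A.Coins,
    (∀ t ≤ A.rounds, ∀ i, (A.configAt ω m t i).length ≤ A.localSpace) ∧
    ∀ (t : Fin A.rounds) (i : Fin A.machines),
      ∑ j, (A.message ω t (A.configAt ω m t) i j).length ≤ A.localSpace ∧
      ∑ j, (A.message ω t (A.configAt ω m t) j i).length ≤ A.localSpace

/-- The probability of an event under uniformly random words. -/
noncomputable def prob (p : A.Coins → Prop) : ℝ :=
  (Nat.card {ω : A.Coins // p ω} : ℝ) / (Nat.card A.Coins : ℝ)

/-- The words of a point: its coordinates. -/
def pointWords {w d : ℕ} (q : EuclideanSpace ℝ (Fin d)) : List (MPCWord w) :=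
  List.ofFn fun k => MPCWord.real (q k)

/-- `place i` lists the points of `Q` initially stored on machine `i`: every point of `Q` is on
exactly one machine, in any order, and no machine has more than `cap` of them. -/
def IsPlacement {d : ℕ} (Q : Finset (EuclideanSpace ℝ (Fin d))) (cap : ℕ)
    (place : Fin A.machines → List (EuclideanSpace ℝ (Fin d))) : Prop :=
  (∀ i, (place i).length ≤ cap) ∧
    ∑ i, (place i : Multiset (EuclideanSpace ℝ (Fin d))) = Q.val

open scoped Classical in
/-- The initial memories for the hub set `H`: the coordinates of every point, followed by a word
that says whether the point is a hub. -/
noncomputable def initial {d : ℕ} (H : Finset (EuclideanSpace ℝ (Fin d)))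
    (place : Fin A.machines → List (EuclideanSpace ℝ (Fin d))) : A.Config := fun i =>
  (place i).flatMap fun q => pointWords q ++ [MPCWord.int (if q ∈ H then 1 else 0)]

open scoped Classical in
/-- Together the machines hold exactly the pairs `(q, close q)` with `q ∈ Q \ H`, each of them once,
where `close q ∈ H` is at distance less than `a * d(q, H)` from `q`. -/
def HoldsNearHubs {d : ℕ} (Q H : Finset (EuclideanSpace ℝ (Fin d))) (a : ℝ) (m : A.Config) :
    Prop :=
  ∃ close : EuclideanSpace ℝ (Fin d) → EuclideanSpace ℝ (Fin d),
    (∀ q ∈ Q \ H, close q ∈ H ∧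
      dist q (close q) < a * Metric.infDist q (H : Set (EuclideanSpace ℝ (Fin d)))) ∧
    ∃ out : Fin A.machines → List (EuclideanSpace ℝ (Fin d)),
      (∀ i, m i = (out i).flatMap fun q => pointWords q ++ pointWords (close q)) ∧
      ∑ i, (out i : Multiset (EuclideanSpace ℝ (Fin d))) = (Q \ H).val

end MPCAlgorithm

/-! The algorithm is deterministic, so it succeeds with certainty, and the constant `c = 2` serves
for every `ρ`. Since `d` is fixed, near hubs can be searched on grids. If `2 ^ i ≤ d(q, H) < 2 ^ (i
+ 1)`, then in the grid of side `2 ^ i / (d + 1)` the nearest hub lies in one of a constant number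
of cells around that of `q`, and every hub of that cell is within `2 ^ i` of it, hence within `2
d(q, H)` of `q`. So every point gets one copy for each pair of a scale and an offset. The key of a
hub copy is its cell at that scale, the key of a query copy is its own cell moved by the offset.
Each query copy looks up some hub with its key, and the nearest hub found by the copies of `q` is
good enough (`keysNear_grid`). When `log Δ > n` this could be too many copies for a constant number
of rounds; then `n` copies suffice to compare every query with every hub (`keysNear_rank`). In both
cases the number of copies is `O(min (log Δ) n)`.

A lookup sorts the copies by key, hubs before queries, and finds the last hub before each query
(`exists_lookup`). Sorting is Leighton's columnsort, used recursively (`exists_full_sorter`): with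
`B` about `n ^ (δ / k)` for a constant `k`, each level multiplies the length of the sorted blocks by
`B`, so constantly many levels lead from the memory of one machine to all of the data. Copying,
prefix scans and minima run along `B`-ary trees, again of constant depth.

All communication is oblivious: there is a fixed set of slots, each always holds one record of
constant size, possibly blank, and records travel along routes that do not depend on the data. Hence
the space bounds hold for every input, once and for all (`compile_respectsSpace`). Keys are never
stored but recomputed from the point and the number of the copy, so integer words need only hold
such numbers. The space overhead is three factors `B`: two for rounding up to powers of `B`, one for
padding that leaves each record `B` slots to work in. With `3 / k ≤ ρ` they fit into `n ^ ρ`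
(`exists_parameters`). -/

namespace ObliviousMPC

open MPCAlgorithm

/-! ### Records as blocks of words of fixed length. -/

section Lists

variable {α β : Type*}

theorem flatMap_congr_of_eq {L : ℕ} {f g : α → List β} (hf : ∀ a, (f a).length = L)
    (hg : ∀ a, (g a).length = L) :
    ∀ {l : List α}, l.flatMap f = l.flatMap g → ∀ a ∈ l, f a = g a
  | [], _, a, ha => by simp at ha
  | x :: l, h, a, ha => by
    rw [List.flatMap_cons, List.flatMap_cons] at h
    obtain ⟨h1, h2⟩ := List.append_inj h (by rw [hf, hg])
    rcases List.mem_cons.1 ha with rfl | ha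
    · exact h1
    · exact flatMap_congr_of_eq hf hg h2 a ha

theorem flatMap_injective {L : ℕ} (hL : 0 < L) {f : α → List β} (hf : ∀ a, (f a).length = L)
    (hinj : Function.Injective f) : Function.Injective fun l : List α => l.flatMap f := by
  intro l
  induction l with
  | nil =>
    intro l' h
    cases l' with
    | nil => rfl
    | cons y l' =>
      have := congrArg List.length h
      simp [hf] at this
      omega
  | cons x l ih =>
    intro l' h
    cases l' with
    | nil =>
      have := congrArg List.length h
      simp [hf] at this
      omega
    | cons y l' =>
      simp only [List.flatMap_cons] at h
      obtain ⟨h1, h2⟩ := List.append_inj h (by rw [hf, hf])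
      rw [hinj h1, ih h2]

theorem length_flatMap_const {L : ℕ} {f : α → List β} (hf : ∀ a, (f a).length = L) (l : List α) :
    (l.flatMap f).length = l.length * L := by
  induction l with
  | nil => simp
  | cons a l ih => simp [ih, hf]; ring

end Lists

/-- An optional point as `d + 1` words, the first of which tells whether there is a point. -/
def optionWords {w d : ℕ} : Option (EuclideanSpace ℝ (Fin d)) → List (MPCWord w)
  | none => List.replicate (d + 1) (MPCWord.int 0)
  | some q => MPCWord.int 1 :: pointWords q

theorem length_pointWords {w d : ℕ} (q : EuclideanSpace ℝ (Fin d)) :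
    (pointWords q : List (MPCWord w)).length = d := by
  simp [pointWords]

theorem pointWords_injective {w d : ℕ} :
    Function.Injective (pointWords : EuclideanSpace ℝ (Fin d) → List (MPCWord w)) := by
  intro p q h
  have h' := List.ofFn_injective h
  ext k
  simpa using congrFun h' k

theorem real_mem_pointWords {w d : ℕ} {q : EuclideanSpace ℝ (Fin d)} {x : ℝ} :
    (MPCWord.real x : MPCWord w) ∈ pointWords q ↔ ∃ k, q k = x := by
  simp [pointWords, List.mem_ofFn]

theorem length_optionWords {w d : ℕ} (q : Option (EuclideanSpace ℝ (Fin d))) :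
    (optionWords q : List (MPCWord w)).length = d + 1 := by
  cases q <;> simp [optionWords, length_pointWords]

/-- The integers 0 and 1 serve as flags for the presence of a point and for hubs; without a single
bit they would coincide and memories could not be decoded. -/
theorem fin_two_pow_one_ne_zero {w : ℕ} (hw : 1 ≤ w) : (1 : Fin (2 ^ w)) ≠ 0 := by
  have : 1 < 2 ^ w := Nat.one_lt_two_pow (by omega)
  intro h
  have := congrArg Fin.val h
  simp [Nat.mod_eq_of_lt ‹1 < 2 ^ w›] at this

theorem optionWords_injective {w d : ℕ} (hw : 1 ≤ w) :
    Function.Injective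
      (optionWords : Option (EuclideanSpace ℝ (Fin d)) → List (MPCWord w)) := by
  have h10 := fin_two_pow_one_ne_zero hw
  intro p q h
  cases p <;> cases q
  · rfl
  · simp [optionWords, List.replicate_succ, h10.symm] at h
  · simp [optionWords, List.replicate_succ, h10] at h
  · simp only [optionWords, List.cons.injEq, true_and] at h
    rw [pointWords_injective h]

theorem real_mem_optionWords {w d : ℕ} {q : Option (EuclideanSpace ℝ (Fin d))} {x : ℝ} :
    (MPCWord.real x : MPCWord w) ∈ optionWords q ↔ ∃ e ∈ q, ∃ k, e k = x := by
  cases q <;> simp [optionWords, real_mem_pointWords, List.mem_replicate]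

/-- A record of constant size: an integer, an optional query point and an optional hub. -/
@[ext]
structure Item (w d : ℕ) where
  tag : Fin (2 ^ w)
  pt : Option (EuclideanSpace ℝ (Fin d))
  cand : Option (EuclideanSpace ℝ (Fin d))

namespace Item

variable {w d : ℕ}

/-- The record that holds no point. -/
def blank (t : Fin (2 ^ w)) : Item w d := ⟨t, none, none⟩

/-- A point occurs in a record. -/
def Has (a : Item w d) (e : EuclideanSpace ℝ (Fin d)) : Prop := e ∈ a.pt ∨ e ∈ a.cand

/-- The words of a record. -/
def words (a : Item w d) : List (MPCWord w) :=
  MPCWord.int a.tag :: (optionWords a.pt ++ optionWords a.cand)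

theorem length_words (a : Item w d) : a.words.length = 2 * d + 3 := by
  simp [words, length_optionWords]
  ring

theorem words_injective (hw : 1 ≤ w) :
    Function.Injective (words : Item w d → List (MPCWord w)) := by
  intro a b h
  simp only [words, List.cons.injEq, MPCWord.int.injEq] at h
  obtain ⟨h1, h2⟩ := List.append_inj h.2 (by simp only [length_optionWords])
  exact Item.ext h.1 (optionWords_injective hw h1) (optionWords_injective hw h2)

theorem real_mem_words {a : Item w d} {x : ℝ} :
    MPCWord.real x ∈ a.words ↔ ∃ e, a.Has e ∧ ∃ k, e k = x := by
  simp only [words, List.mem_cons, reduceCtorEq, false_or, List.mem_append, real_mem_optionWords,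
    Has]
  constructor
  · rintro (⟨e, h, h'⟩ | ⟨e, h, h'⟩)
    · exact ⟨e, .inl h, h'⟩
    · exact ⟨e, .inr h, h'⟩
  · rintro ⟨e, h | h, h'⟩
    · exact .inl ⟨e, h, h'⟩
    · exact .inr ⟨e, h, h'⟩

/-- What a record contributes to the output. -/
def outWords (a : Item w d) : List (MPCWord w) :=
  match a.pt, a.cand with
  | some q, some h => pointWords q ++ pointWords h
  | _, _ => []

theorem length_outWords (a : Item w d) : a.outWords.length ≤ 2 * d + 3 := by
  unfold outWords
  split
  · simp [length_pointWords]
    omega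
  · simp

theorem real_mem_outWords {a : Item w d} {x : ℝ} (h : MPCWord.real x ∈ a.outWords) :
    MPCWord.real x ∈ a.words := by
  rw [real_mem_words]
  unfold outWords at h
  split at h
  · rename_i q p hq hp
    rcases List.mem_append.1 h with h | h
    · exact ⟨q, .inl hq, real_mem_pointWords.1 h⟩
    · exact ⟨p, .inr hp, real_mem_pointWords.1 h⟩
  · simp at h

/-- The record of an input point. -/
def ofInput (e : EuclideanSpace ℝ (Fin d) × Bool) : Item w d :=
  if e.2 then ⟨0, none, some e.1⟩ else ⟨0, some e.1, none⟩

/-- The record in the `k`-th slot of a machine with input `l`. -/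
def ofInputList (l : List (EuclideanSpace ℝ (Fin d) × Bool)) (k : ℕ) : Item w d :=
  match l[k]? with
  | some e => ofInput e
  | none => blank 0

theorem has_ofInput {e : EuclideanSpace ℝ (Fin d) × Bool} {p : EuclideanSpace ℝ (Fin d)}
    (h : (ofInput e : Item w d).Has p) : p = e.1 := by
  unfold ofInput Has at h
  split at h <;> simp_all

end Item

/-! ### Oblivious rounds and their compilation into MPC algorithms. -/

/-- A round in which every slot receives one record, computed by the machine that holds the slot
`route x`.  Slots `x < N` are distributed in consecutive blocks of length `b`. -/
structure ObliviousRound (w d N b : ℕ) where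
  fn : (ℕ → Item w d) → ℕ → Item w d
  route : ℕ → ℕ
  route_lt : ∀ x < N, route x < N
  route_inj : ∀ x < N, ∀ y < N, route x = route y → x = y
  fn_congr : ∀ x < N, ∀ s s' : ℕ → Item w d,
    (∀ y, y / b = route x / b → s y = s' y) → fn s x = fn s' x
  fn_has : ∀ x < N, ∀ (s : ℕ → Item w d) (e : EuclideanSpace ℝ (Fin d)), (fn s x).Has e →
    ∃ y, y / b = route x / b ∧ (s y).Has e

section Compile

open Classical in
/-- The machine with memory `mem` in slot order `l` and first slot `base`, as a function on
slots. -/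
noncomputable def decode {w d : ℕ} (base : ℕ) (l : List ℕ) (mem : List (MPCWord w)) :
    Option (ℕ → Item w d) :=
  if h : ∃ s : ℕ → Item w d, mem = l.flatMap fun k => (s (base + k)).words then some h.choose
  else none

theorem eq_of_decode {w d : ℕ} {base : ℕ} {l : List ℕ} {mem : List (MPCWord w)}
    {s : ℕ → Item w d} (h : decode base l mem = some s) :
    mem = l.flatMap fun k => (s (base + k)).words := by
  unfold decode at h
  split at h
  · rename_i h'
    rw [← Option.some.inj h]
    exact h'.choose_spec
  · simp at h

/-- All records have the same length and are determined by their words, so any function of slots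
that explains the memory agrees with the true one on the listed slots. Its values elsewhere are
arbitrary, which `fn_congr` makes harmless. -/
theorem decode_flatMap {w d : ℕ} (hw : 1 ≤ w) (base : ℕ) (l : List ℕ) (s : ℕ → Item w d) :
    ∃ s', decode base l (l.flatMap fun k => (s (base + k)).words) = some s' ∧
      ∀ k ∈ l, s' (base + k) = s (base + k) := by
  have h : ∃ s' : ℕ → Item w d, (l.flatMap fun k => (s (base + k)).words) =
    l.flatMap fun k => (s' (base + k)).words := ⟨s, rfl⟩
  refine ⟨h.choose, by unfold decode; rw [dif_pos h], fun k hk => ?_⟩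
  exact (Item.words_injective hw (flatMap_congr_of_eq (L := 2 * d + 3)
    (fun k => Item.length_words _) (fun k => Item.length_words _) h.choose_spec k hk)).symm

variable {w d M b : ℕ}

/-- The slots of machine `j` whose records come from machine `i`. -/
def arrivals (R : ObliviousRound w d (M * b) b) (i j : ℕ) : List ℕ :=
  (List.range b).filter fun k => R.route (j * b + k) / b = i

/-- The order of the slots in the memory of machine `j` after a round. -/
def arrivalOrder (R : ObliviousRound w d (M * b) b) (j : ℕ) : List ℕ :=
  (List.ofFn fun i : Fin M => arrivals R i j).flatten

theorem slot_lt {j k : ℕ} (hj : j < M) (hk : k < b) : j * b + k < M * b := by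
  have : (j + 1) * b ≤ M * b := Nat.mul_le_mul_right b hj
  rw [Nat.add_mul] at this
  omega

theorem slot_div {j k : ℕ} (hk : k < b) : (j * b + k) / b = j := by
  rw [mul_comm, Nat.mul_add_div (by omega), Nat.div_eq_of_lt hk, add_zero]

theorem mem_arrivalOrder (R : ObliviousRound w d (M * b) b) {j k : ℕ} (hj : j < M) :
    k ∈ arrivalOrder R j ↔ k < b := by
  simp only [arrivalOrder, arrivals, List.mem_flatten, List.mem_ofFn, exists_exists_eq_and,
    List.mem_filter, List.mem_range, decide_eq_true_eq]
  constructor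
  · rintro ⟨i, h, -⟩
    exact h
  · intro h
    have := R.route_lt _ (slot_lt hj h)
    exact ⟨⟨R.route (j * b + k) / b, Nat.div_lt_of_lt_mul (this.trans_eq (mul_comm M b))⟩, h, rfl⟩

theorem sum_length_arrivals_right (R : ObliviousRound w d (M * b) b) {j : ℕ} (hj : j < M) :
    ∑ i : Fin M, (arrivals R i j).length = b := by
  have h : ∀ i : Fin M, (arrivals R i j).length =
      ((Finset.range b).filter fun k => R.route (j * b + k) / b = i).card := by
    intro i
    simp only [arrivals, Finset.card_def, Finset.filter_val, Finset.range_val, Multiset.range,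
      Multiset.filter_coe, Multiset.coe_card]
  simp only [h]
  rw [Fin.sum_univ_eq_sum_range
    (fun i => ((Finset.range b).filter fun k => R.route (j * b + k) / b = i).card) M,
    ← Finset.card_eq_sum_card_fiberwise, Finset.card_range]
  intro k hk
  have := R.route_lt _ (slot_lt hj (Finset.mem_range.1 hk))
  exact Finset.mem_coe.2 (Finset.mem_range.2 (Nat.div_lt_of_lt_mul (this.trans_eq (mul_comm M b))))

theorem length_arrivalOrder (R : ObliviousRound w d (M * b) b) {j : ℕ} (hj : j < M) :
    (arrivalOrder R j).length = b := by
  rw [arrivalOrder, List.length_flatten, List.map_ofFn, List.sum_ofFn]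
  exact sum_length_arrivals_right R hj

/-- A machine sends one record for each slot that is routed into its block, and the route is
injective, so the `b` slots of the block bound the number of records sent. -/
theorem sum_length_arrivals_left (R : ObliviousRound w d (M * b) b) (i : ℕ) :
    ∑ j : Fin M, (arrivals R i j).length ≤ b := by
  have h : ∀ j : Fin M, (arrivals R i j).length =
      ((Finset.range b).filter fun k => R.route (j * b + k) / b = i).card := by
    intro j
    simp only [arrivals, Finset.card_def, Finset.filter_val, Finset.range_val, Multiset.range,
      Multiset.filter_coe, Multiset.coe_card]
  simp only [h]
  rw [← Finset.card_sigma]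
  calc _ ≤ ((Finset.Ico (i * b) (i * b + b))).card := by
        refine Finset.card_le_card_of_injOn (fun x => R.route (x.1 * b + x.2)) ?_ ?_
        · rintro ⟨j, k⟩ h
          simp only [Finset.coe_sigma, Set.mem_sigma_iff, Finset.mem_coe, Finset.mem_univ,
            Finset.mem_filter, Finset.mem_range, true_and] at h
          obtain ⟨hk, rfl⟩ := h
          have hb : 0 < b := by omega
          simp only [Finset.coe_Ico, Set.mem_Ico]
          have h1 := Nat.div_add_mod (R.route (j * b + k)) b
          have h2 := Nat.mod_lt (R.route (j * b + k)) hb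
          rw [mul_comm] at h1
          omega
        · rintro ⟨j, k⟩ h ⟨j', k'⟩ h' e
          simp only [Finset.coe_sigma, Set.mem_sigma_iff, Finset.mem_coe, Finset.mem_univ,
            Finset.mem_filter, Finset.mem_range, true_and] at h h'
          have := R.route_inj _ (slot_lt j.2 h.1) _ (slot_lt j'.2 h'.1) e
          have hj : (j : ℕ) = j' := by
            rw [← slot_div (j := (j : ℕ)) h.1, this, slot_div h'.1]
          obtain rfl : j = j' := Fin.ext hj
          simp at this
          simp [this]
    _ = b := by simp

/-- One step of a round on the memory of machine `i`. -/
noncomputable def roundStep (R : ObliviousRound w d (M * b) b) (order : ℕ → List ℕ) (i : ℕ)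
    (mem : List (MPCWord w)) : List (MPCWord w) × (Fin M → List (MPCWord w)) :=
  match decode (i * b) (order i) mem with
  | some s => ([], fun j => (arrivals R i j).flatMap fun k => (R.fn s (j * b + k)).words)
  | none => ([], fun _ => [])

/-- By `fn_has`, a point in a record that is sent already occurs in the block of the sender, whose
memory lists every slot of that block. This is the indivisibility of real words. -/
theorem real_mem_roundStep (R : ObliviousRound w d (M * b) b) {order : ℕ → List ℕ} {i : ℕ}
    (horder : ∀ k < b, k ∈ order i) {mem : List (MPCWord w)} {x : ℝ} {j : Fin M}
    (h : MPCWord.real x ∈ (roundStep R order i mem).2 j) : MPCWord.real x ∈ mem := by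
  unfold roundStep at h
  split at h
  · rename_i s hs
    rw [eq_of_decode hs]
    simp only [List.mem_flatMap, arrivals, List.mem_filter, List.mem_range,
      decide_eq_true_eq] at h ⊢
    obtain ⟨k, ⟨hk, hr⟩, hx⟩ := h
    obtain ⟨e, he, hex⟩ := Item.real_mem_words.1 hx
    obtain ⟨y, hy, hye⟩ := R.fn_has _ (slot_lt j.2 hk) s e he
    have hb : 0 < b := by omega
    have h1 := Nat.div_add_mod y b
    rw [hy, hr, mul_comm] at h1
    refine ⟨y % b, horder _ (Nat.mod_lt _ hb), ?_⟩
    rw [h1]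
    exact Item.real_mem_words.2 ⟨e, hye, hex⟩
  · simp at h

/-- The words of an input point and its hub bit. -/
def inputWords (e : EuclideanSpace ℝ (Fin d) × Bool) : List (MPCWord w) :=
  pointWords e.1 ++ [MPCWord.int (if e.2 then 1 else 0)]

theorem length_inputWords (e : EuclideanSpace ℝ (Fin d) × Bool) :
    (inputWords e : List (MPCWord w)).length = d + 1 := by
  simp [inputWords, length_pointWords]

theorem inputWords_injective (hw : 1 ≤ w) :
    Function.Injective (inputWords : EuclideanSpace ℝ (Fin d) × Bool → List (MPCWord w)) := by
  have h10 := fin_two_pow_one_ne_zero hw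
  rintro ⟨p, u⟩ ⟨q, v⟩ h
  obtain ⟨h1, h2⟩ := List.append_inj h (by simp [length_pointWords])
  have h1 := pointWords_injective h1
  cases u <;> cases v <;> simp_all [eq_comm]

open Classical in
/-- The local computation that turns the input into records. -/
noncomputable def loadStep (b : ℕ) (mem : List (MPCWord w)) : List (MPCWord w) :=
  if h : ∃ l : List (EuclideanSpace ℝ (Fin d) × Bool), mem = l.flatMap inputWords then
    (List.range b).flatMap fun k => (Item.ofInputList h.choose k).words
  else []

theorem real_mem_loadStep {mem : List (MPCWord w)} {x : ℝ}
    (h : MPCWord.real x ∈ loadStep (d := d) b mem) : MPCWord.real x ∈ mem := by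
  unfold loadStep at h
  split at h
  · rename_i hl
    rw [hl.choose_spec]
    generalize hl.choose = l at h
    simp only [List.mem_flatMap, List.mem_range] at h ⊢
    obtain ⟨k, -, hx⟩ := h
    obtain ⟨e, he, c, hc⟩ := Item.real_mem_words.1 hx
    unfold Item.ofInputList at he
    split at he
    · rename_i p hp
      refine ⟨p, List.mem_of_getElem? hp, ?_⟩
      rw [Item.has_ofInput he] at hc
      simp only [inputWords, List.mem_append]
      exact .inl (real_mem_pointWords.2 ⟨c, hc⟩)
    · simp [Item.blank, Item.Has] at he
  · simp at h

theorem loadStep_flatMap (hw : 1 ≤ w) (l : List (EuclideanSpace ℝ (Fin d) × Bool)) :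
    loadStep (d := d) b (l.flatMap inputWords : List (MPCWord w)) =
      (List.range b).flatMap fun k => (Item.ofInputList l k).words := by
  have h : ∃ l' : List (EuclideanSpace ℝ (Fin d) × Bool),
    (l.flatMap inputWords : List (MPCWord w)) = l'.flatMap inputWords := ⟨l, rfl⟩
  -- The hub bit makes the length `d + 1` positive even in dimension 0, so that the number of points
  -- can be read off the memory.
  have hl : h.choose = l := (flatMap_injective (Nat.succ_pos d) length_inputWords
    (inputWords_injective hw) h.choose_spec).symm
  unfold loadStep
  rw [dif_pos h, hl]

/-- The local computation that turns records into the output. -/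
noncomputable def emitStep (d b : ℕ) (order : ℕ → List ℕ) (i : ℕ) (mem : List (MPCWord w)) :
    List (MPCWord w) :=
  match decode (d := d) (i * b) (order i) mem with
  | some s => (List.range b).flatMap fun k => (s (i * b + k)).outWords
  | none => []

theorem real_mem_emitStep {order : ℕ → List ℕ} {i : ℕ} (horder : ∀ k < b, k ∈ order i)
    {mem : List (MPCWord w)} {x : ℝ} (h : MPCWord.real x ∈ emitStep d b order i mem) :
    MPCWord.real x ∈ mem := by
  unfold emitStep at h
  split at h
  · rename_i s hs
    rw [eq_of_decode hs]
    simp only [List.mem_flatMap, List.mem_range] at h ⊢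
    obtain ⟨k, hk, hx⟩ := h
    exact ⟨k, horder k hk, Item.real_mem_outWords hx⟩
  · simp at h

/-- The order of the slots after `t` rounds of the list. -/
def orderAt (l : List (ObliviousRound w d (M * b) b)) (t j : ℕ) : List ℕ :=
  match t with
  | 0 => List.range b
  | t + 1 => if h : t < l.length then arrivalOrder l[t] j else List.range b

theorem mem_orderAt (l : List (ObliviousRound w d (M * b) b)) (t : ℕ) {j k : ℕ} (hj : j < M) :
    k ∈ orderAt l t j ↔ k < b := by
  unfold orderAt
  split
  · simp
  · split
    · exact mem_arrivalOrder _ hj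
    · simp

theorem length_orderAt (l : List (ObliviousRound w d (M * b) b)) (t : ℕ) {j : ℕ} (hj : j < M) :
    (orderAt l t j).length = b := by
  unfold orderAt
  split
  · simp
  · split
    · exact length_arrivalOrder _ hj
    · simp

/-- The MPC algorithm that loads the input into slots, executes the rounds, and writes the
output. -/
noncomputable def compile (l : List (ObliviousRound w d (M * b) b)) : MPCAlgorithm where
  machines := M
  localSpace := b * (2 * d + 3)
  wordBits := w
  rounds := l.length + 2
  step t i mem _ :=
    if t.1 = 0 then (loadStep (d := d) b mem, fun _ => [])
    else if h : t.1 - 1 < l.length then roundStep l[t.1 - 1] (orderAt l (t.1 - 1)) i mem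
    else (emitStep d b (orderAt l (t.1 - 1)) i mem, fun _ => [])
  real_kept t i mem r x h := by
    split at h
    · exact real_mem_loadStep h
    · split at h
      · unfold roundStep at h
        split at h <;> simp at h
      · exact real_mem_emitStep (fun k hk => (mem_orderAt l _ i.2).2 hk) h
  real_sent t i mem r j x h := by
    split at h
    · simp at h
    · split at h
      · exact real_mem_roundStep _ (fun k hk => (mem_orderAt l _ i.2).2 hk) h
      · simp at h

/-- The slots after the first `t` rounds. -/
def runRounds (l : List (ObliviousRound w d (M * b) b)) (s : ℕ → Item w d) (t : ℕ) :
    ℕ → Item w d :=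
  (l.take t).foldl (fun s R => R.fn s) s

theorem runRounds_succ (l : List (ObliviousRound w d (M * b) b)) (s : ℕ → Item w d) {t : ℕ}
    (ht : t < l.length) : runRounds l s (t + 1) = l[t].fn (runRounds l s t) := by
  unfold runRounds
  rw [List.take_succ_eq_append_getElem ht, List.foldl_append]
  rfl

/-- The memories that represent the slots `s` in the given order. -/
def Represents (order : ℕ → List ℕ) (s : ℕ → Item w d) (m : Fin M → List (MPCWord w))
    (b : ℕ) : Prop :=
  ∀ i : Fin M, m i = (order i).flatMap fun k => (s (i * b + k)).words

theorem roundStep_of_represents (hw : 1 ≤ w) (R : ObliviousRound w d (M * b) b)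
    {order : ℕ → List ℕ} (horder : ∀ i < M, ∀ k, k ∈ order i ↔ k < b) {s : ℕ → Item w d}
    {m : Fin M → List (MPCWord w)} (h : Represents order s m b) (i : Fin M) :
    roundStep R order i (m i) =
      ([], fun j : Fin M => (arrivals R i j).flatMap fun k => (R.fn s (j * b + k)).words) := by
  obtain ⟨s', hs', hss⟩ := decode_flatMap hw (i * b) (order i) s
  unfold roundStep
  rw [h i, hs']
  simp only [Prod.mk.injEq, true_and]
  funext j
  rw [List.flatMap_def, List.flatMap_def]
  congr 1
  refine List.map_congr_left fun k hk => ?_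
  simp only [arrivals, List.mem_filter, List.mem_range, decide_eq_true_eq] at hk
  congr 1
  refine R.fn_congr _ (slot_lt j.2 hk.1) _ _ fun y hy => ?_
  have hb : 0 < b := by omega
  have h1 := Nat.div_add_mod y b
  rw [hy, hk.2, mul_comm] at h1
  rw [← h1]
  exact hss _ ((horder i i.2 _).2 (Nat.mod_lt _ hb))

/-- The slots that hold the input. -/
noncomputable def inputSlots (b : ℕ) (input : ℕ → List (EuclideanSpace ℝ (Fin d) × Bool)) :
    ℕ → Item w d :=
  fun x => Item.ofInputList (input (x / b)) (x % b)

section Run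

variable (l : List (ObliviousRound w d (M * b) b))
  (input : ℕ → List (EuclideanSpace ℝ (Fin d) × Bool))

theorem compile_step_zero (h) (i : Fin M) (mem : List (MPCWord w)) (r) :
    (compile l).step ⟨0, h⟩ i mem r = (loadStep (d := d) b mem, fun _ => []) := rfl

theorem compile_step_succ {t : ℕ} (ht : t < l.length) (h) (i : Fin M) (mem : List (MPCWord w))
    (r) : (compile l).step ⟨t + 1, h⟩ i mem r = roundStep l[t] (orderAt l t) i mem := by
  simp [compile, ht]

theorem compile_step_last (h) (i : Fin M) (mem : List (MPCWord w)) (r) :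
    (compile l).step ⟨l.length + 1, h⟩ i mem r =
      (emitStep d b (orderAt l l.length) i mem, fun _ => []) := by
  simp [compile]

variable {l} in
theorem next_of_silent {ω : (compile l).Coins} {t} {m : (compile l).Config}
    {f : Fin M → List (MPCWord w) → List (MPCWord w)}
    (h : ∀ i : Fin M, (compile l).step t i (m i) (ω t i) = (f i (m i), fun _ => [])) (i : Fin M) :
    (compile l).next ω t m i = f i (m i) := by
  have h2 : (compile l).next ω t m i = ((compile l).step t i (m i) (ω t i)).1 ++
    (List.ofFn fun j : Fin M => ((compile l).step t j (m j) (ω t j)).2 i).flatten := rfl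
  rw [h2, h i]
  simp only [h]
  have : (List.ofFn fun _ : Fin M => ([] : List (MPCWord w))).flatten = [] := by simp
  exact (congrArg (f i (m i) ++ ·) this).trans (List.append_nil _)

theorem compile_next_zero (hw : 1 ≤ w) (ω : (compile l).Coins) (h0)
    (m : (compile l).Config) (hm : ∀ i : Fin M, m i = (input i).flatMap inputWords) :
    Represents (M := M) (orderAt l 0) (inputSlots b input) ((compile l).next ω ⟨0, h0⟩ m) b := by
  intro i
  rw [next_of_silent (f := fun _ => loadStep (d := d) b) (fun i => compile_step_zero l h0 i _ _) i,
    hm i]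
  refine (loadStep_flatMap hw _).trans ?_
  rw [orderAt, List.flatMap_def, List.flatMap_def]
  congr 1
  refine List.map_congr_left fun k hk => ?_
  rw [List.mem_range] at hk
  rw [inputSlots, slot_div hk, mul_comm (i : ℕ), Nat.mul_add_mod, Nat.mod_eq_of_lt hk]
  rfl

variable {l} in
theorem compile_message_succ (hw : 1 ≤ w) {ω : (compile l).Coins} {t : ℕ} (ht : t < l.length) {h}
    {m : (compile l).Config} {s : ℕ → Item w d} (hm : Represents (M := M) (orderAt l t) s m b)
    (i j : Fin M) : (compile l).message ω ⟨t + 1, h⟩ m i j =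
      (arrivals l[t] i j).flatMap fun k => (l[t].fn s (j * b + k)).words := by
  have h1 := (compile_step_succ l ht h i (m i) (ω ⟨t + 1, h⟩ i)).trans
    (roundStep_of_represents hw _ (fun i hi k => mem_orderAt l t hi) hm i)
  exact congrArg (fun z : List (MPCWord w) × (Fin M → List (MPCWord w)) => z.2 j) h1

variable {l} in
theorem compile_next_succ (hw : 1 ≤ w) {ω : (compile l).Coins} {t : ℕ} (ht : t < l.length) {h}
    {m : (compile l).Config} {s : ℕ → Item w d} (hm : Represents (M := M) (orderAt l t) s m b) :
    Represents (M := M) (orderAt l (t + 1)) (l[t].fn s)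
      ((compile l).next ω ⟨t + 1, h⟩ m) b := by
  intro j
  have h2 : (compile l).next ω ⟨t + 1, h⟩ m j =
    ((compile l).step ⟨t + 1, h⟩ j (m j) (ω ⟨t + 1, h⟩ j)).1 ++
    (List.ofFn fun i : Fin M => (compile l).message ω ⟨t + 1, h⟩ m i j).flatten := rfl
  have h3 := fun i => compile_message_succ hw ht (ω := ω) (h := h) hm i j
  have h1 := (compile_step_succ l ht h j (m j) (ω ⟨t + 1, h⟩ j)).trans
    (roundStep_of_represents hw _ (fun i hi k => mem_orderAt l t hi) hm j)
  have h4 := congrArg₂ (fun (u : List (MPCWord w)) (v : List (List (MPCWord w))) => u ++ v.flatten)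
    (congrArg Prod.fst h1) (congrArg List.ofFn (funext h3))
  refine (h2.trans h4).trans ((List.nil_append _).trans ?_)
  simp only [orderAt, ht, dif_pos, arrivalOrder, List.flatMap_def, List.map_flatten,
    List.flatten_flatten, List.map_ofFn, Function.comp_def]

theorem compile_configAt_succ (hw : 1 ≤ w) (ω : (compile l).Coins)
    (m : (compile l).Config) (hm : ∀ i : Fin M, m i = (input i).flatMap inputWords) :
    ∀ t ≤ l.length, Represents (M := M) (orderAt l t) (runRounds l (inputSlots b input) t)
      ((compile l).configAt ω m (t + 1)) b
  | 0, _ => by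
    have h0 : 0 < (compile l).rounds := Nat.succ_pos _
    rw [configAt, dif_pos h0]
    exact compile_next_zero l input hw ω h0 m hm
  | t + 1, ht => by
    have h0 : t + 1 < (compile l).rounds := show t + 1 < l.length + 2 by omega
    rw [configAt, dif_pos h0, runRounds_succ l _ ht]
    exact compile_next_succ hw ht (compile_configAt_succ hw ω m hm t (by omega))

theorem compile_configAt_rounds (hw : 1 ≤ w) (ω : (compile l).Coins)
    (m : (compile l).Config) (hm : ∀ i : Fin M, m i = (input i).flatMap inputWords) (i : Fin M) :
    (compile l).configAt ω m (compile l).rounds i =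
      (List.range b).flatMap fun k =>
        (runRounds l (inputSlots b input) l.length (i * b + k)).outWords := by
  have h0 : l.length + 1 < (compile l).rounds := Nat.lt_succ_self _
  have h1 : (compile l).configAt ω m (compile l).rounds =
      (compile l).next ω ⟨l.length + 1, h0⟩ ((compile l).configAt ω m (l.length + 1)) :=
    dif_pos h0
  have h2 := compile_configAt_succ l input hw ω m hm l.length le_rfl i
  rw [h1, next_of_silent (f := fun i => emitStep d b (orderAt l l.length) i)
    (fun i => compile_step_last l h0 i _ _) i, h2]
  obtain ⟨s', hs', hss⟩ := decode_flatMap hw (i * b) (orderAt l l.length i)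
    (runRounds l (inputSlots b input) l.length)
  unfold emitStep
  rw [hs']
  simp only [List.flatMap_def]
  congr 1
  refine List.map_congr_left fun k hk => ?_
  rw [hss k ((mem_orderAt l _ i.2).2 (List.mem_range.1 hk))]

/-- Between loading and output every machine holds exactly `b` records of `2 * d + 3` words, and the
traffic is given by the routes alone. Only the input and the output have lengths that depend on the
data, and both are shorter than `b` records. -/
theorem compile_respectsSpace (hw : 1 ≤ w) (hin : ∀ i < M, (input i).length ≤ b)
    (m : (compile l).Config) (hm : ∀ i : Fin M, m i = (input i).flatMap inputWords) :
    (compile l).RespectsSpace m := by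
  intro ω
  have hstep : ∀ t, t < l.length + 2 → t = 0 ∨ (∃ t', t = t' + 1 ∧ t' < l.length) ∨
      t = l.length + 1 := by
    intro t ht
    rcases t with _ | t
    · exact .inl rfl
    · by_cases h : t < l.length
      · exact .inr (.inl ⟨t, rfl, h⟩)
      · exact .inr (.inr (by omega))
  refine ⟨fun t ht i => ?_, ?_⟩
  · change Fin M at i
    change t ≤ l.length + 2 at ht
    change _ ≤ b * (2 * d + 3)
    rcases t with _ | t
    · have h1 : (compile l).configAt ω m 0 i = (input i.1).flatMap inputWords := hm i
      rw [h1]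
      refine (length_flatMap_const length_inputWords _).trans_le ?_
      exact Nat.mul_le_mul (hin i.1 i.2) (by omega)
    · by_cases h : t ≤ l.length
      · rw [compile_configAt_succ l input hw ω m hm t h i]
        refine (length_flatMap_const (fun k => Item.length_words _) _).trans_le ?_
        rw [length_orderAt l t i.2]
      · obtain rfl : t = l.length + 1 := by omega
        have := compile_configAt_rounds l input hw ω m hm i
        refine (congrArg List.length this).trans_le ?_
        change List.length (α := MPCWord w) _ ≤ _
        rw [List.flatMap_def, List.length_flatten, List.map_map]
        refine (List.sum_le_card_nsmul _ (2 * d + 3) ?_).trans ?_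
        · intro x hx
          obtain ⟨k, -, rfl⟩ := List.mem_map.1 hx
          exact Item.length_outWords _
        · simp
  · rintro ⟨t, ht⟩ (i : Fin M)
    change (∑ j : Fin M, _ ≤ b * (2 * d + 3)) ∧ (∑ j : Fin M, _ ≤ b * (2 * d + 3))
    have ht' : t < l.length + 2 := ht
    rcases hstep t ht' with rfl | ⟨t, rfl, htl⟩ | rfl
    · have : ∀ m' (i j : Fin M), (compile l).message ω ⟨0, ht⟩ m' i j = [] := fun _ _ _ => rfl
      simp only [this]
      simp
    · have := compile_message_succ hw htl (ω := ω) (h := ht)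
        (compile_configAt_succ l input hw ω m hm t htl.le)
      have h5 := fun i j => (congrArg List.length (this i j)).trans
        (length_flatMap_const (fun k => Item.length_words _) _)
      constructor
      · rw [Finset.sum_congr rfl fun j _ => h5 i j, ← Finset.sum_mul]
        exact Nat.mul_le_mul_right _ (sum_length_arrivals_left _ _)
      · rw [Finset.sum_congr rfl fun j _ => h5 j i, ← Finset.sum_mul]
        exact Nat.mul_le_mul_right _ (sum_length_arrivals_right _ i.2).le
    · have : ∀ m' (i j : Fin M), (compile l).message ω ⟨l.length + 1, ht⟩ m' i j = [] := by
        intro m' i j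
        exact congrArg (fun z : List (MPCWord w) × (Fin M → List (MPCWord w)) => z.2 j)
          (compile_step_last l ht i (m' i) (ω ⟨l.length + 1, ht⟩ i))
      simp only [this]
      simp

end Run

end Compile

end ObliviousMPC

namespace ObliviousMPC

/-! ### Windows of a sequence and counting below a threshold. -/

section Counting

variable {α κ : Type*}

/-- The values of a sequence on `[o, o + r)`. -/
def window (f : ℕ → α) (o r : ℕ) : Multiset α := (Multiset.range r).map fun u => f (o + u)

theorem window_congr {f g : ℕ → α} {o o' r : ℕ} (h : ∀ u < r, f (o + u) = g (o' + u)) :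
    window f o r = window g o' r :=
  Multiset.map_congr rfl fun u hu => h u (Multiset.mem_range.1 hu)

theorem mem_window {f : ℕ → α} {o r : ℕ} {a : α} :
    a ∈ window f o r ↔ ∃ u < r, f (o + u) = a := by
  simp [window]

theorem window_add (f : ℕ → α) (o r r' : ℕ) :
    window f o (r + r') = window f o r + window f (o + r) r' := by
  simp [window, Multiset.range_add, add_assoc]

theorem window_mul (f : ℕ → α) (o r c : ℕ) :
    window f o (c * r) = ∑ i ∈ Finset.range c, window f (o + i * r) r := by
  induction c with
  | zero => simp [window]
  | succ c ih => rw [Nat.add_mul, one_mul, window_add, ih, Finset.sum_range_succ]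

theorem window_comp_perm {f g : ℕ → α} {o r : ℕ} {σ : ℕ → ℕ} (h1 : ∀ u < r, σ u < r)
    (h2 : ∀ u < r, ∀ v < r, σ u = σ v → u = v) (hg : ∀ u < r, g (o + u) = f (o + σ u)) :
    window g o r = window f o r := by
  have h3 : (Finset.range r).image σ = Finset.range r := by
    refine Finset.eq_of_subset_of_card_le ?_ ?_
    · intro x hx
      obtain ⟨u, hu, rfl⟩ := Finset.mem_image.1 hx
      exact Finset.mem_range.2 (h1 u (Finset.mem_range.1 hu))
    · rw [Finset.card_image_of_injOn]
      intro u hu v hv e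
      exact h2 u (Finset.mem_range.1 hu) v (Finset.mem_range.1 hv) e
  have h4 : (Multiset.range r).map σ = Multiset.range r := by
    have := Finset.image_val_of_injOn (s := Finset.range r) (f := σ) (by
      intro u hu v hv e
      exact h2 u (Finset.mem_range.1 hu) v (Finset.mem_range.1 hv) e)
    rw [h3] at this
    exact this.symm
  calc window g o r = ((Multiset.range r).map σ).map fun u => f (o + u) := by
        rw [Multiset.map_map]
        exact Multiset.map_congr rfl fun u hu => hg u (Multiset.mem_range.1 hu)
    _ = window f o r := by rw [h4]; rfl

/-- The sequence is sorted by `key` on `[o, o + r)`. -/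
def SortedOn [LE κ] (key : α → κ) (f : ℕ → α) (o r : ℕ) : Prop :=
  ∀ u v, u ≤ v → v < r → key (f (o + u)) ≤ key (f (o + v))

open Classical in
/-- The number of values in a window that satisfy `P`. -/
noncomputable def countIn (P : α → Prop) (f : ℕ → α) (o r : ℕ) : ℕ := (window f o r).countP P

theorem countIn_eq_card (P : α → Prop) [DecidablePred P] (f : ℕ → α) (o r : ℕ) :
    countIn P f o r = ((Finset.range r).filter fun u => P (f (o + u))).card := by
  rw [countIn, window, Multiset.countP_map, Finset.card_def, Finset.filter_val, Finset.range_val]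
  congr!

theorem le_countIn {P : α → Prop} {f : ℕ → α} {o r k : ℕ} (hk : k ≤ r)
    (h : ∀ u < k, P (f (o + u))) : k ≤ countIn P f o r := by
  classical
  rw [countIn_eq_card]
  calc k = (Finset.range k).card := (Finset.card_range k).symm
    _ ≤ _ := Finset.card_le_card fun u hu => by
      have := Finset.mem_range.1 hu
      exact Finset.mem_filter.2 ⟨Finset.mem_range.2 (by omega), h u this⟩

theorem countIn_le {P : α → Prop} {f : ℕ → α} {o r k : ℕ}
    (h : ∀ u, k ≤ u → u < r → ¬ P (f (o + u))) : countIn P f o r ≤ k := by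
  classical
  rw [countIn_eq_card]
  calc _ ≤ (Finset.range k).card := Finset.card_le_card fun u hu => by
        have := Finset.mem_filter.1 hu
        refine Finset.mem_range.2 (not_le.1 fun h' => ?_)
        exact h u h' (Finset.mem_range.1 this.1) this.2
    _ = k := Finset.card_range k

theorem countIn_mul (P : α → Prop) (f : ℕ → α) (o r c : ℕ) :
    countIn P f o (c * r) = ∑ i ∈ Finset.range c, countIn P f (o + i * r) r := by
  classical
  simp only [countIn, window_mul]
  exact map_sum (Multiset.countPAddMonoidHom P) _ _

/-- In a sorted window the values below a threshold form an initial segment, whose length is their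
number. Reasoning with all thresholds in this way plays the role of the zero-one principle for
sorting networks. -/
theorem SortedOn.lt_iff [LinearOrder κ] {key : α → κ} {f : ℕ → α} {o r : ℕ}
    (h : SortedOn key f o r) (θ : κ) {u : ℕ} (hu : u < r) :
    key (f (o + u)) < θ ↔ u < countIn (fun a => key a < θ) f o r := by
  constructor
  · intro hlt
    exact le_countIn (k := u + 1) hu fun v hv => (h v u (by omega) hu).trans_lt hlt
  · intro hlt
    by_contra hn
    refine absurd hlt (not_lt.2 (countIn_le fun v hv hvr => ?_))
    exact not_lt.2 ((not_lt.1 hn).trans (h u v hv hvr))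

end Counting

/-! ### Correctness of columnsort. -/

section Columnsort

theorem eq_pred_mul_add {s : ℕ} (hs : 0 < s) (r : ℕ) : s * r = (s - 1) * r + r := by
  obtain ⟨s, rfl⟩ := Nat.exists_eq_succ_of_ne_zero hs.ne'
  simp [Nat.succ_mul]

variable {α κ : Type*} [LinearOrder κ]

/-- Each of the first `s` blocks of length `r` of `f'` is a sorted arrangement of that of `f`. -/
def ColumnsSorted (key : α → κ) (r s : ℕ) (f f' : ℕ → α) : Prop :=
  ∀ c < s, SortedOn key f' (c * r) r ∧ window f' (c * r) r = window f (c * r) r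

theorem ColumnsSorted.window_eq {key : α → κ} {r s : ℕ} {f f' : ℕ → α}
    (h : ColumnsSorted key r s f f') : window f' 0 (s * r) = window f 0 (s * r) := by
  simp only [window_mul, zero_add]
  exact Finset.sum_congr rfl fun c hc => (h c (Finset.mem_range.1 hc)).2

theorem ColumnsSorted.lt_iff {key : α → κ} {r s : ℕ} {f f' : ℕ → α}
    (h : ColumnsSorted key r s f f') (θ : κ) {c u : ℕ} (hc : c < s) (hu : u < r) :
    key (f' (c * r + u)) < θ ↔ u < countIn (fun a => key a < θ) f (c * r) r := by
  rw [(h c hc).1.lt_iff θ hu, countIn, (h c hc).2, ← countIn]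

/-- Deal the entries of every column of length `s * t` to the `s` columns in turn. -/
def deal (s t y : ℕ) : ℕ :=
  (y % (s * t) / t) * (s * t) + (y % (s * t) % t) * s + y / (s * t)

/-- Read a matrix with `s` columns of length `r` row by row. -/
def readRows (s r y : ℕ) : ℕ := y % s * r + y / s

/-- Shift the columns by `r - h`, so that the first one consists of the first `h` and of the last
`r - h` entries. -/
def shiftColumns (s r h y : ℕ) : ℕ :=
  if y < h then y else if y < r then y + (s - 1) * r else y - (r - h)

/-- The inverse of `shiftColumns`. -/
def unshiftColumns (s r h y : ℕ) : ℕ :=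
  if y < h then y else if y < (s - 1) * r + h then y + (r - h) else y - (s - 1) * r

/-- When a sorted column with `z` entries below a threshold is dealt to `s` columns in turn, each of
them receives `z / s` of these entries or one more. -/
theorem countIn_residue {s t e z : ℕ} (he : e < s) (hz : z ≤ t * s) :
    z / s ≤ countIn (fun q => q * s + e < z) id 0 t ∧
      countIn (fun q => q * s + e < z) id 0 t ≤ z / s + 1 := by
  have hs : 0 < s := by omega
  constructor
  · refine le_countIn (Nat.div_le_of_le_mul (by rwa [mul_comm])) fun q hq => ?_
    have h1 : (q + 1) * s ≤ z / s * s := Nat.mul_le_mul_right s hq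
    have h2 := Nat.div_mul_le_self z s
    simp only [id, zero_add]
    rw [Nat.add_mul, one_mul] at h1
    omega
  · refine countIn_le fun q hq _ h => ?_
    simp only [id, zero_add] at h
    have h1 : (z / s + 1) * s ≤ q * s := Nat.mul_le_mul_right s hq
    have h2 := Nat.lt_div_mul_add (a := z) hs
    rw [Nat.add_mul, one_mul] at h1
    omega

/-- After two of the four sorting steps of columnsort, the sequence is sorted up to a window of
length `s * s`. -/
theorem exists_dirty_window {key : α → κ} {s t : ℕ} {f₀ f₁ f₂ f₃ f₄ : ℕ → α}
    (h01 : ColumnsSorted key (s * t) s f₀ f₁)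
    (h12 : ∀ y < s * (s * t), f₂ y = f₁ (deal s t y))
    (h23 : ColumnsSorted key (s * t) s f₂ f₃)
    (h34 : ∀ y < s * (s * t), f₄ y = f₃ (readRows s (s * t) y)) (θ : κ) :
    ∃ A, ∀ y < s * (s * t), (y < A → key (f₄ y) < θ) ∧ (A + s * s ≤ y → ¬ key (f₄ y) < θ) := by
  set z : ℕ → ℕ := fun c => countIn (fun a => key a < θ) f₀ (c * (s * t)) (s * t) with hzdef
  have hz : ∀ c, z c ≤ t * s := fun c => by
    rw [mul_comm]
    exact countIn_le fun u h1 h2 => absurd h2 (not_lt.2 h1)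
  set z' : ℕ → ℕ := fun c => countIn (fun a => key a < θ) f₂ (c * (s * t)) (s * t) with hzdef'
  -- Every source column contributes an error of at most one, so the dealt columns have almost the
  -- same number of entries below the threshold: they differ by at most `s`.
  have hz' : ∀ e < s, (∑ c ∈ Finset.range s, z c / s) ≤ z' e ∧
      z' e ≤ (∑ c ∈ Finset.range s, z c / s) + s := by
    intro e he
    have hsplit : z' e = ∑ c ∈ Finset.range s,
        countIn (fun q => q * s + e < z c) id 0 t := by
      change countIn (fun a => key a < θ) f₂ (e * (s * t)) (s * t) = _
      rw [countIn_mul]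
      refine Finset.sum_congr rfl fun c hc => ?_
      have hc := Finset.mem_range.1 hc
      classical
      rw [countIn_eq_card, countIn_eq_card]
      congr 1
      refine Finset.filter_congr fun q hq => ?_
      have hq := Finset.mem_range.1 hq
      have h1 : c * t + q < s * t := by
        have : (c + 1) * t ≤ s * t := Nat.mul_le_mul_right t hc
        rw [Nat.add_mul] at this
        omega
      have h2 : e * (s * t) + (c * t + q) < s * (s * t) := by
        have : (e + 1) * (s * t) ≤ s * (s * t) := Nat.mul_le_mul_right _ he
        rw [Nat.add_mul] at this
        omega
      have h3 : q * s + e < s * t := by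
        have : (q + 1) * s ≤ t * s := Nat.mul_le_mul_right s hq
        rw [Nat.add_mul, mul_comm t] at this
        omega
      have h4 : deal s t (e * (s * t) + (c * t + q)) = c * (s * t) + (q * s + e) := by
        have ha : (e * (s * t) + (c * t + q)) % (s * t) = c * t + q := by
          rw [mul_comm, Nat.mul_add_mod, Nat.mod_eq_of_lt h1]
        have hb : (e * (s * t) + (c * t + q)) / (s * t) = e := slot_div h1
        have hc' : (c * t + q) % t = q := by
          rw [mul_comm, Nat.mul_add_mod, Nat.mod_eq_of_lt hq]
        rw [deal, ha, hb, slot_div hq, hc', add_assoc]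
      rw [add_assoc, h12 _ h2, h4, h01.lt_iff θ hc h3]
      simp [hzdef]
    have hlo : ∑ c ∈ Finset.range s, z c / s ≤ z' e := by
      rw [hsplit]
      exact Finset.sum_le_sum fun c _ => (countIn_residue he (hz c)).1
    refine ⟨hlo, ?_⟩
    rw [hsplit]
    calc _ ≤ ∑ c ∈ Finset.range s, (z c / s + 1) :=
          Finset.sum_le_sum fun c _ => (countIn_residue he (hz c)).2
      _ = _ := by simp [Finset.sum_add_distrib]
  -- Once the columns are sorted, the first `∑ z c / s` rows lie below the threshold entirely, and
  -- after `s` more rows nothing does. Read row by row, the uncertain part is `s` rows of `s`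
  -- entries.
  refine ⟨(∑ c ∈ Finset.range s, z c / s) * s, fun y hy => ?_⟩
  have hs : 0 < s := Nat.pos_of_ne_zero fun h => by simp [h] at hy
  have he : y % s < s := Nat.mod_lt _ hs
  have hi : y / s < s * t := Nat.div_lt_of_lt_mul hy
  rw [h34 y hy, readRows, h23.lt_iff θ he hi]
  change (_ → y / s < z' (y % s)) ∧ (_ → ¬ y / s < z' (y % s))
  have := hz' _ he
  have h5 := Nat.div_add_mod y s
  rw [mul_comm] at h5
  constructor
  · intro h
    have : y / s < ∑ c ∈ Finset.range s, z c / s := Nat.div_lt_of_lt_mul (by rwa [mul_comm])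
    omega
  · intro h
    have : (∑ c ∈ Finset.range s, z c / s) + s ≤ y / s := by
      rw [Nat.le_div_iff_mul_le hs, Nat.add_mul]
      exact h
    omega

/-- Sorting the columns repairs a dirty window that lies in one column, so an inversion forces the
window, for the threshold `key (f' y')`, to meet both the column of `y'` and a later column of `y`.
It is too short to reach the next column from before the cut (`h + D ≤ r`), to reach past the cut
from the preceding column (`D ≤ h`), or to cover a whole column. So no inversion crosses the cut at
distance `h` from the start of a column. -/
theorem le_of_cut {key : α → κ} {r s h D : ℕ} {f f' : ℕ → α} (hf : ColumnsSorted key r s f f')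
    (hD : D ≤ h) (hr : h + D ≤ r)
    (hdirty : ∀ θ, ∃ A, ∀ y < s * r, (y < A → key (f y) < θ) ∧ (A + D ≤ y → ¬ key (f y) < θ))
    {c y y' : ℕ} (hy' : y' < c * r + h) (hy : c * r + h ≤ y) (hys : y < s * r) :
    key (f' y') ≤ key (f' y) := by
  by_contra hcon
  rw [not_le] at hcon
  obtain ⟨A, hA⟩ := hdirty (key (f' y'))
  have hr0 : 0 < r := Nat.pos_of_ne_zero fun h => by simp [h] at hys
  have e1 := Nat.div_add_mod y' r
  have e2 := Nat.div_add_mod y r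
  have l1 := Nat.mod_lt y' hr0
  have l2 := Nat.mod_lt y hr0
  have hc2 : y / r < s := Nat.div_lt_of_lt_mul (by rwa [mul_comm])
  have hc12 : y' / r ≤ y / r := Nat.div_le_div_right (by omega)
  set c1 := y' / r
  set c2 := y / r
  set u1 := y' % r
  set u2 := y % r
  rw [mul_comm] at e1 e2
  have h1 := hf.lt_iff (key (f' y')) (lt_of_le_of_lt hc12 hc2) l1
  have h2 := hf.lt_iff (key (f' y')) hc2 l2
  rw [e1] at h1
  rw [e2] at h2
  have h1' := not_lt.1 (fun hh => lt_irrefl _ (h1.2 hh))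
  have h2' := h2.1 hcon
  have hle : ∀ c u, c < s → u < r → c * r + u < s * r := fun c u hc hu => slot_lt hc hu
  have F1 : ∀ k ≤ r, c1 * r + k ≤ A → k ≤ u1 := fun k hk hkA =>
    (le_countIn hk fun u hu => (hA _ (hle c1 u (by omega) (by omega))).1 (by omega)).trans h1'
  have F2 : c2 * r + u2 < A + D := not_le.1 fun hk => absurd h2' (not_lt.2
    (countIn_le fun u hu hur => (hA _ (hle c2 u hc2 hur)).2 (by omega)))
  have F3 : A < (c1 + 1) * r := by
    by_contra hh
    have := F1 r le_rfl (by rw [Nat.add_mul] at hh; omega)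
    omega
  have F4 : A ≤ c1 * r + u1 := by
    by_contra hh
    have := F1 (A - c1 * r) (by rw [Nat.add_mul] at F3; omega) (by omega)
    omega
  have F5 : c1 ≠ c2 := by
    intro h
    have h3 : c1 * r = c2 * r := by rw [h]
    rw [← h] at h2'
    omega
  have m1 : (c1 + 1) * r ≤ c2 * r := Nat.mul_le_mul_right r (by omega)
  rw [Nat.add_mul, one_mul] at F3 m1
  have F6 : A < c1 * r + u1 + 1 := by omega
  have hcc1 : c1 < c := by
    by_contra hh
    have m2 : c * r ≤ c1 * r := Nat.mul_le_mul_right r (by omega)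
    omega
  have hcc2 : c < c2 := by
    by_contra hh
    have m2 : c2 * r ≤ c * r := Nat.mul_le_mul_right r (by omega)
    omega
  have m3 : (c1 + 2) * r ≤ c2 * r := Nat.mul_le_mul_right r (by omega)
  rw [Nat.add_mul] at m3
  omega

theorem shiftColumns_lt {s r h y : ℕ} (hy : y < s * r) :
    shiftColumns s r h y < s * r := by
  have hs : 0 < s := Nat.pos_of_ne_zero fun h => by simp [h] at hy
  have : s * r = (s - 1) * r + r := eq_pred_mul_add hs r
  unfold shiftColumns
  split_ifs <;> omega

theorem unshiftColumns_lt {s r h y : ℕ} (hy : y < s * r) :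
    unshiftColumns s r h y < s * r := by
  have hs : 0 < s := Nat.pos_of_ne_zero fun h => by simp [h] at hy
  have : s * r = (s - 1) * r + r := eq_pred_mul_add hs r
  unfold unshiftColumns
  split_ifs <;> omega

theorem shiftColumns_inj {s r h y y' : ℕ} (hhr : h ≤ r) (hy : y < s * r) (hy' : y' < s * r)
    (e : shiftColumns s r h y = shiftColumns s r h y') : y = y' := by
  have hs : 0 < s := Nat.pos_of_ne_zero fun h => by simp [h] at hy
  have : s * r = (s - 1) * r + r := eq_pred_mul_add hs r
  unfold shiftColumns at e
  split_ifs at e <;> omega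

theorem unshiftColumns_inj {s r h y y' : ℕ} (hhr : h ≤ r) (hy : y < s * r) (hy' : y' < s * r)
    (e : unshiftColumns s r h y = unshiftColumns s r h y') : y = y' := by
  have hs : 0 < s := Nat.pos_of_ne_zero fun h => by simp [h] at hy
  have : s * r = (s - 1) * r + r := eq_pred_mul_add hs r
  unfold unshiftColumns at e
  split_ifs at e <;> omega

/-- The shift makes the stretch between two consecutive cuts a column, and no inversion crosses a
cut, so sorting these stretches suffices. The stretches at the two ends share the first column; all
entries of the former precede those of the latter in order, so sorting them together does not mix
them up, except for equal keys. -/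
theorem sorted_after_shift {key : α → κ} {r s h : ℕ} {f₅ f₆ f₇ f₈ : ℕ → α}
    (h0 : 0 < h) (hhr : h < r)
    (hcut : ∀ c y y', c < s → y' < c * r + h → c * r + h ≤ y → y < s * r →
      key (f₅ y') ≤ key (f₅ y))
    (h56 : ∀ y < s * r, f₆ y = f₅ (shiftColumns s r h y))
    (h67 : ColumnsSorted key r s f₆ f₇)
    (h78 : ∀ y < s * r, f₈ y = f₇ (unshiftColumns s r h y)) :
    SortedOn key f₈ 0 (s * r) := by
  have adj : ∀ x, x + 1 < s * r → key (f₈ x) ≤ key (f₈ (x + 1)) := by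
    intro x hx
    have hs : 0 < s := Nat.pos_of_ne_zero fun h => by simp [h] at hx
    have hsr : s * r = (s - 1) * r + r := eq_pred_mul_add hs r
    have hcol : ∀ p q, p ≤ q → q < s * r → p / r = q / r → key (f₇ p) ≤ key (f₇ q) := by
      intro p q hpq hq hd
      have e1 := Nat.div_add_mod p r
      have e2 := Nat.div_add_mod q r
      rw [hd] at e1
      have := (h67 (q / r) (Nat.div_lt_of_lt_mul (by rwa [mul_comm]))).1 (p % r) (q % r)
        (by omega) (Nat.mod_lt _ (by omega))
      rw [mul_comm] at e1 e2
      rwa [e1, e2] at this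
    -- Neighbours not separated by a cut are neighbours in a sorted column of `f₇`. At a cut,
    -- counting in the columns of `f₆` shows that a descent from `x` to `x + 1` would give an entry
    -- of `f₅` behind the cut below an entry before it.
    by_cases hb : ∃ c < s, x + 1 = c * r + h
    · obtain ⟨c, hc, hxc⟩ := hb
      by_contra hcon
      rw [not_le] at hcon
      set θ := key (f₈ x) with hθ
      have hup : ∃ y, c * r + h ≤ y ∧ y < s * r ∧ key (f₅ y) < θ := by
        rw [h78 _ hx, unshiftColumns, if_neg (by omega)] at hcon
        by_cases hcs : c + 1 < s
        · have m : (c + 1) * r ≤ (s - 1) * r := Nat.mul_le_mul_right r (by omega)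
          rw [Nat.add_mul, one_mul] at m
          rw [if_pos (by omega)] at hcon
          have e : x + 1 + (r - h) = (c + 1) * r + 0 := by rw [Nat.add_mul]; omega
          rw [e, h67.lt_iff θ hcs (by omega)] at hcon
          by_contra hno
          push Not at hno
          refine absurd hcon (not_lt.2 (countIn_le fun u _ hu => ?_))
          have hlt : (c + 1) * r + u < s * r := slot_lt hcs hu
          rw [h56 _ hlt, not_lt, shiftColumns]
          rw [Nat.add_mul, one_mul] at hlt ⊢
          rw [if_neg (by omega), if_neg (by omega)]
          exact hno _ (by omega) (by omega)
        · obtain rfl : c = s - 1 := by omega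
          rw [if_neg (by omega)] at hcon
          have e : x + 1 - (s - 1) * r = 0 * r + h := by omega
          rw [e, h67.lt_iff θ hs hhr] at hcon
          by_contra hno
          push Not at hno
          refine absurd hcon (not_lt.2 (countIn_le fun u hu hur => ?_))
          rw [h56 _ (by omega), not_lt, shiftColumns, if_neg (by omega), if_pos (by omega)]
          exact hno _ (by omega) (by omega)
      have hlow : ∃ y', y' < c * r + h ∧ ¬ key (f₅ y') < θ := by
        have hxx : ¬ key (f₈ x) < θ := lt_irrefl _
        rw [h78 _ (by omega), unshiftColumns] at hxx
        by_cases hc0 : c = 0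
        · subst hc0
          rw [if_pos (by omega)] at hxx
          have e : x = 0 * r + x := by omega
          rw [e, h67.lt_iff θ hs (by omega)] at hxx
          by_contra hno
          push Not at hno
          refine hxx (le_countIn (k := x + 1) (by omega) fun u hu => ?_)
          rw [h56 _ (by omega), shiftColumns, if_pos (by omega)]
          exact hno _ (by omega)
        · have m : c * r ≤ (s - 1) * r := Nat.mul_le_mul_right r (by omega)
          have m' : 1 * r ≤ c * r := Nat.mul_le_mul_right r (by omega)
          rw [if_neg (by omega), if_pos (by omega)] at hxx
          have e : x + (r - h) = c * r + (r - 1) := by omega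
          rw [e, h67.lt_iff θ hc (by omega)] at hxx
          by_contra hno
          push Not at hno
          refine hxx ?_
          have : r ≤ countIn (fun a => key a < θ) f₆ (c * r) r := by
            refine le_countIn le_rfl fun u hu => ?_
            rw [h56 _ (slot_lt hc hu), shiftColumns, if_neg (by omega), if_neg (by omega)]
            exact hno _ (by omega)
          omega
      obtain ⟨y, hy1, hy2, hy3⟩ := hup
      obtain ⟨y', hy4, hy5⟩ := hlow
      exact hy5 ((hcut c y y' hc hy4 hy1 hy2).trans_lt hy3)
    · push Not at hb
      rw [h78 x (by omega), h78 _ hx]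
      have hl1 : unshiftColumns s r h (x + 1) < s * r := unshiftColumns_lt hx
      have b0 := hb 0 hs
      have b1 := hb (s - 1) (by omega)
      unfold unshiftColumns at hl1 ⊢
      by_cases c1 : x + 1 < h
      · rw [if_pos (by omega), if_pos c1]
        refine hcol _ _ (by omega) (by omega) ?_
        rw [Nat.div_eq_of_lt (by omega), Nat.div_eq_of_lt (by omega)]
      · rw [if_neg c1] at hl1 ⊢
        rw [if_neg (show ¬ x < h by omega)]
        by_cases c2 : x + 1 < (s - 1) * r + h
        · rw [if_pos c2] at hl1 ⊢
          rw [if_pos (by omega)]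
          refine hcol _ _ (by omega) (by omega) ?_
          have hne : ¬ r ∣ x + (r - h) + 1 := by
            rintro ⟨q, hq⟩
            have hq1 : 0 < q := Nat.pos_of_ne_zero fun h => by simp [h] at hq
            have hqs : q < s + 1 := by
              by_contra hh
              have : r * (s + 1) ≤ r * q := Nat.mul_le_mul_left r (by omega)
              rw [mul_comm r (s + 1), Nat.add_mul] at this
              omega
            refine hb (q - 1) (by omega) ?_
            have : r * q = (q - 1) * r + r := (mul_comm r q).trans (eq_pred_mul_add hq1 r)
            omega
          rw [show x + 1 + (r - h) = x + (r - h) + 1 by omega, Nat.succ_div, if_neg hne, add_zero]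
        · rw [if_neg c2] at hl1 ⊢
          rw [if_neg (by omega)]
          refine hcol _ _ (by omega) (by omega) ?_
          rw [Nat.div_eq_of_lt (by omega), Nat.div_eq_of_lt (by omega)]
  intro u v huv
  induction v, huv using Nat.le_induction with
  | base => intro _; exact le_rfl
  | succ v huv ih =>
    intro hv
    have := adj (0 + v) (by omega)
    exact (ih (by omega)).trans this

end Columnsort

end ObliviousMPC

/-! ### Realizable transformations and sorting in a constant number of rounds. -/

namespace ObliviousMPC

variable {w d N b : ℕ}

/-- A transformation of the slots that can be executed in `r` oblivious rounds. -/
def Realizable (N b r : ℕ) (Φ : (ℕ → Item w d) → ℕ → Item w d) : Prop :=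
  ∃ l : List (ObliviousRound w d N b), l.length = r ∧
    ∀ s, l.foldl (fun s R => R.fn s) s = Φ s

theorem realizable_id : Realizable N b 0 (fun s : ℕ → Item w d => s) := ⟨[], rfl, fun _ => rfl⟩

theorem Realizable.comp {r r' : ℕ} {Φ Ψ : (ℕ → Item w d) → ℕ → Item w d}
    (h : Realizable N b r Φ) (h' : Realizable N b r' Ψ) :
    Realizable N b (r + r') fun s => Ψ (Φ s) := by
  obtain ⟨l, rfl, hl⟩ := h
  obtain ⟨l', rfl, hl'⟩ := h'
  exact ⟨l ++ l', List.length_append, fun s => by rw [List.foldl_append, hl, hl']⟩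

theorem realizable_iterate {r : ℕ} {Φ : ℕ → (ℕ → Item w d) → ℕ → Item w d}
    (h : ∀ t, Realizable N b r (Φ t)) (T : ℕ) :
    Realizable N b (T * r) fun s => Nat.rec s (fun t s' => Φ t s') T := by
  induction T with
  | zero => rw [zero_mul]; exact realizable_id
  | succ T ih => rw [Nat.succ_mul]; exact ih.comp (h T)

theorem realizable_of_route {Φ : (ℕ → Item w d) → ℕ → Item w d} (σ : ℕ → ℕ)
    (h1 : ∀ x < N, σ x < N) (h2 : ∀ x < N, ∀ y < N, σ x = σ y → x = y)
    (h3 : ∀ x < N, ∀ s s' : ℕ → Item w d, (∀ y, y / b = σ x / b → s y = s' y) → Φ s x = Φ s' x)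
    (h4 : ∀ x < N, ∀ (s : ℕ → Item w d) (e : EuclideanSpace ℝ (Fin d)), (Φ s x).Has e →
      ∃ y, y / b = σ x / b ∧ (s y).Has e) : Realizable N b 1 Φ :=
  ⟨[⟨Φ, σ, h1, h2, h3, h4⟩], rfl, fun _ => rfl⟩

theorem realizable_perm {σ : ℕ → ℕ} (h1 : ∀ x < N, σ x < N)
    (h2 : ∀ x < N, ∀ y < N, σ x = σ y → x = y) :
    Realizable N b 1 fun (s : ℕ → Item w d) x => s (σ x) :=
  realizable_of_route σ h1 h2 (fun _ _ _ _ h => h _ rfl) fun x _ _ _ h => ⟨σ x, rfl, h⟩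

theorem realizable_local {Φ : (ℕ → Item w d) → ℕ → Item w d}
    (h3 : ∀ x < N, ∀ s s' : ℕ → Item w d, (∀ y, y / b = x / b → s y = s' y) → Φ s x = Φ s' x)
    (h4 : ∀ x < N, ∀ (s : ℕ → Item w d) (e : EuclideanSpace ℝ (Fin d)), (Φ s x).Has e →
      ∃ y, y / b = x / b ∧ (s y).Has e) : Realizable N b 1 Φ :=
  realizable_of_route id (fun _ h => h) (fun _ _ _ _ h => h) h3 h4

theorem realizable_pointwise {g : ℕ → Item w d → Item w d}
    (hg : ∀ x a e, (g x a).Has e → a.Has e) :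
    Realizable N b 1 fun (s : ℕ → Item w d) x => g x (s x) :=
  realizable_local (fun x _ s s' h => by rw [h x rfl]) fun x _ s e h => ⟨x, rfl, hg _ _ _ h⟩

section Sorting

variable {κ : Type*} [LinearOrder κ] (key : Item w d → κ)

/-- The transformation sorts every block of length `r`. -/
def SortsBlocks (N r : ℕ) (Φ : (ℕ → Item w d) → ℕ → Item w d) : Prop :=
  ∀ s c, (c + 1) * r ≤ N →
    SortedOn key (Φ s) (c * r) r ∧ window (Φ s) (c * r) r = window s (c * r) r

/-- Sort every block of length `b` locally. -/
noncomputable def localSort (b : ℕ) (s : ℕ → Item w d) (x : ℕ) : Item w d :=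
  if h : x % b < b then
    s (x / b * b + Tuple.sort (fun k : Fin b => key (s (x / b * b + k))) ⟨x % b, h⟩)
  else s x

theorem realizable_localSort (hb : 0 < b) : Realizable N b 1 (localSort key b) := by
  have hd : ∀ x (k : Fin b), (x / b * b + (k : ℕ)) / b = x / b := fun x k => slot_div k.2
  refine realizable_local (fun x _ s s' h => ?_) fun x _ s e h => ?_
  · have h' : ∀ k : Fin b, s (x / b * b + k) = s' (x / b * b + k) := fun k => h _ (hd x k)
    unfold localSort
    simp only [dif_pos (Nat.mod_lt x hb), h']
  · unfold localSort at h
    rw [dif_pos (Nat.mod_lt x hb)] at h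
    exact ⟨_, hd x _, h⟩

theorem sortsBlocks_localSort (hb : 0 < b) : SortsBlocks key N b (localSort key b) := by
  intro s c _
  have h : ∀ u (hu : u < b), localSort key b s (c * b + u) =
      s (c * b + Tuple.sort (fun k : Fin b => key (s (c * b + k))) ⟨u, hu⟩) := by
    intro u hu
    have h1 : (c * b + u) / b = c := slot_div hu
    have h2 : (c * b + u) % b = u := by rw [mul_comm, Nat.mul_add_mod, Nat.mod_eq_of_lt hu]
    have h3 : (c * b + u) % b < b := Nat.mod_lt _ hb
    unfold localSort
    rw [dif_pos h3]
    simp only [h1, h2]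
  constructor
  · intro u v huv hv
    rw [h u (by omega), h v hv]
    exact Tuple.monotone_sort (fun k : Fin b => key (s (c * b + k)))
      (show (⟨u, by omega⟩ : Fin b) ≤ ⟨v, hv⟩ from huv)
  · set τ := Tuple.sort (fun k : Fin b => key (s (c * b + k))) with hτ
    refine window_comp_perm (σ := fun u => if hu : u < b then (τ ⟨u, hu⟩ : ℕ) else u) ?_ ?_ ?_
    · intro u hu
      simp [hu]
    · intro u hu v hv e
      simp only [hu, hv, dif_pos] at e
      simpa using τ.injective (Fin.ext e)
    · intro u hu
      simp only [hu, dif_pos]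
      exact h u hu

theorem eq_of_slot_eq {m a a' u u' : ℕ} (hu : u < m) (hu' : u' < m)
    (e : a * m + u = a' * m + u') : a = a' ∧ u = u' := by
  have h : a = a' := by
    have := congrArg (· / m) e
    simpa only [slot_div hu, slot_div hu'] using this
  subst h
  exact ⟨rfl, Nat.add_left_cancel e⟩

/-- A permutation of `[0, m)` applied to every block of length `m`. -/
def liftPerm (m : ℕ) (σ : ℕ → ℕ) (x : ℕ) : ℕ := x / m * m + σ (x % m)

theorem realizable_liftPerm {m : ℕ} {σ : ℕ → ℕ} (hm : m ∣ N) (h1 : ∀ x < m, σ x < m)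
    (h2 : ∀ x < m, ∀ y < m, σ x = σ y → x = y) :
    Realizable N b 1 fun (s : ℕ → Item w d) x => s (liftPerm m σ x) := by
  obtain ⟨c, rfl⟩ := hm
  refine realizable_perm (fun x hx => ?_) fun x hx y hy e => ?_
  · have hm : 0 < m := Nat.pos_of_ne_zero fun h => by simp [h] at hx
    have := slot_lt (Nat.div_lt_of_lt_mul hx) (h1 _ (Nat.mod_lt x hm))
    rwa [mul_comm c] at this
  · have hm : 0 < m := Nat.pos_of_ne_zero fun h => by simp [h] at hx
    have hx' := h1 _ (Nat.mod_lt x hm)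
    have hy' := h1 _ (Nat.mod_lt y hm)
    unfold liftPerm at e
    obtain ⟨e1, e⟩ := eq_of_slot_eq hx' hy' e
    have e2 := h2 _ (Nat.mod_lt x hm) _ (Nat.mod_lt y hm) e
    rw [← Nat.div_add_mod x m, ← Nat.div_add_mod y m, e1, e2]

theorem liftPerm_block {m C y : ℕ} (σ : ℕ → ℕ) (hy : y < m) :
    liftPerm m σ (C * m + y) = C * m + σ y := by
  unfold liftPerm
  rw [slot_div hy, mul_comm, Nat.mul_add_mod, Nat.mod_eq_of_lt hy]

theorem deal_spec {s t y : ℕ} (hy : y < s * (s * t)) :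
    y / (s * t) < s ∧ y % (s * t) / t < s ∧ y % (s * t) % t < t ∧
      (y % (s * t) % t) * s + y / (s * t) < s * t := by
  have h0 : 0 < s * t := Nat.pos_of_ne_zero fun h => by simp [h] at hy
  have ht : 0 < t := Nat.pos_of_ne_zero fun h => by simp [h] at h0
  have h1 : y / (s * t) < s := Nat.div_lt_of_lt_mul (by rwa [mul_comm])
  have h3 := Nat.mod_lt (y % (s * t)) ht
  refine ⟨h1, Nat.div_lt_of_lt_mul ?_, h3, ?_⟩
  · rw [mul_comm t s]; exact Nat.mod_lt _ h0
  · exact (slot_lt h3 h1).trans_eq (mul_comm t s)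

theorem deal_lt {s t y : ℕ} (hy : y < s * (s * t)) : deal s t y < s * (s * t) := by
  obtain ⟨-, h2, -, h4⟩ := deal_spec hy
  unfold deal
  rw [add_assoc]
  exact slot_lt h2 h4

theorem deal_inj {s t y y' : ℕ} (hy : y < s * (s * t)) (hy' : y' < s * (s * t))
    (e : deal s t y = deal s t y') : y = y' := by
  obtain ⟨h1, -, h3, h4⟩ := deal_spec hy
  obtain ⟨h1', -, h3', h4'⟩ := deal_spec hy'
  unfold deal at e
  rw [add_assoc, add_assoc] at e
  obtain ⟨e1, e⟩ := eq_of_slot_eq h4 h4' e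
  obtain ⟨e2, e3⟩ := eq_of_slot_eq h1 h1' e
  have e4 : y % (s * t) = y' % (s * t) := by
    rw [← Nat.div_add_mod (y % (s * t)) t, ← Nat.div_add_mod (y' % (s * t)) t, e1, e2]
  rw [← Nat.div_add_mod y (s * t), ← Nat.div_add_mod y' (s * t), e3, e4]

theorem readRows_lt {s r y : ℕ} (hy : y < s * r) : readRows s r y < s * r := by
  have hs : 0 < s := Nat.pos_of_ne_zero fun h => by simp [h] at hy
  exact slot_lt (Nat.mod_lt _ hs) (Nat.div_lt_of_lt_mul hy)

theorem readRows_inj {s r y y' : ℕ} (hy : y < s * r) (hy' : y' < s * r)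
    (e : readRows s r y = readRows s r y') : y = y' := by
  have h1 : y / s < r := Nat.div_lt_of_lt_mul hy
  have h1' : y' / s < r := Nat.div_lt_of_lt_mul hy'
  obtain ⟨e1, e2⟩ := eq_of_slot_eq h1 h1' e
  rw [← Nat.div_add_mod y s, ← Nat.div_add_mod y' s, e1, e2]

variable {key}

theorem SortsBlocks.columnsSorted {r s C : ℕ} {Φ : (ℕ → Item w d) → ℕ → Item w d}
    (h : SortsBlocks key N r Φ) (hC : (C + 1) * (s * r) ≤ N) (f : ℕ → Item w d) :
    ColumnsSorted key r s (fun y => f (C * (s * r) + y)) fun y => Φ f (C * (s * r) + y) := by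
  intro c hc
  have h1 : (C * s + c + 1) * r ≤ N := by
    refine le_trans ?_ hC
    calc (C * s + c + 1) * r ≤ (C * s + s) * r := Nat.mul_le_mul_right r (by omega)
      _ = _ := by ring
  have h2 : ∀ u, C * (s * r) + (c * r + u) = (C * s + c) * r + u := fun u => by ring
  obtain ⟨h3, h4⟩ := h f _ h1
  refine ⟨fun u v huv hv => ?_, ?_⟩
  · simp only [h2]
    exact h3 u v huv hv
  · simp only [window, h2]
    exact h4

/-- Four sorts of the columns alternate with four fixed permutations, which cost one round each; all
blocks of length `s * (s * t)` are treated at the same time. The dirty window has length `s * s`, so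
a cut at `h` needs `s * s` entries of its column on either side. -/
theorem realizable_columnsort {s t h D : ℕ} {Φ : (ℕ → Item w d) → ℕ → Item w d} (hs : 0 < s)
    (hh : s * s ≤ h) (hr : h + s * s ≤ s * t) (hN : s * (s * t) ∣ N)
    (hΦ : Realizable N b D Φ) (hsort : SortsBlocks key N (s * t) Φ) :
    ∃ Ψ, Realizable N b (4 * D + 4) Ψ ∧ SortsBlocks key N (s * (s * t)) Ψ := by
  have hss : 0 < s * s := Nat.mul_pos hs hs
  set m := s * (s * t) with hm
  set σ₁ := liftPerm m (deal s t)
  set σ₂ := liftPerm m (readRows s (s * t))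
  set σ₃ := liftPerm m (shiftColumns s (s * t) h)
  set σ₄ := liftPerm m (unshiftColumns s (s * t) h)
  have hσ₁ : Realizable N b 1 fun (f : ℕ → Item w d) x => f (σ₁ x) :=
    realizable_liftPerm hN (fun _ => deal_lt) fun _ hx _ hy => deal_inj hx hy
  have hσ₂ : Realizable N b 1 fun (f : ℕ → Item w d) x => f (σ₂ x) :=
    realizable_liftPerm hN (fun _ => readRows_lt) fun _ hx _ hy => readRows_inj hx hy
  have hσ₃ : Realizable N b 1 fun (f : ℕ → Item w d) x => f (σ₃ x) :=
    realizable_liftPerm hN (fun _ => shiftColumns_lt)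
      fun _ hx _ hy => shiftColumns_inj (by omega) hx hy
  have hσ₄ : Realizable N b 1 fun (f : ℕ → Item w d) x => f (σ₄ x) :=
    realizable_liftPerm hN (fun _ => unshiftColumns_lt)
      fun _ hx _ hy => unshiftColumns_inj (by omega) hx hy
  refine ⟨fun f => fun x => Φ (fun x => Φ (fun x => Φ (fun x => Φ f (σ₁ x)) (σ₂ x)) (σ₃ x)) (σ₄ x),
    ?_, ?_⟩
  · have := ((((((hΦ.comp hσ₁).comp hΦ).comp hσ₂).comp hΦ).comp hσ₃).comp hΦ).comp hσ₄
    rwa [show D + 1 + D + 1 + D + 1 + D + 1 = 4 * D + 4 by ring] at this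
  · intro f₀ C hC
    have blk : ∀ (f : ℕ → Item w d) (σ : ℕ → ℕ), ∀ y < m,
        f (liftPerm m σ (C * m + y)) = f (C * m + σ y) := fun f σ y hy => by
      rw [liftPerm_block σ hy]
    set f₁ := Φ f₀
    set f₂ := fun x => f₁ (σ₁ x)
    set f₃ := Φ f₂
    set f₄ := fun x => f₃ (σ₂ x)
    set f₅ := Φ f₄
    set f₆ := fun x => f₅ (σ₃ x)
    set f₇ := Φ f₆
    set f₈ := fun x => f₇ (σ₄ x)
    have c01 := hsort.columnsSorted hC f₀
    have c23 := hsort.columnsSorted hC f₂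
    have c45 := hsort.columnsSorted hC f₄
    have c67 := hsort.columnsSorted hC f₆
    have dirty := exists_dirty_window (t := t) c01 (fun y hy => blk f₁ _ y hy) c23
      (fun y hy => blk f₃ _ y hy)
    have srt := sorted_after_shift (r := s * t) (h := h) (by omega) (by omega)
      (fun c y y' _ h1 h2 h3 => le_of_cut c45 hh hr dirty h1 h2 h3)
      (fun y hy => blk f₅ _ y hy) c67 (fun y hy => blk f₇ _ y hy)
    constructor
    · intro u v huv hv
      have := srt u v huv hv
      simpa only [zero_add] using this
    · have e1 : ∀ f : ℕ → Item w d, window f (C * m) m = window (fun y => f (C * m + y)) 0 m :=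
        fun f => by simp [window]
      have p1 : window f₂ (C * m) m = window f₁ (C * m) m :=
        window_comp_perm (fun _ => deal_lt) (fun _ hx _ hy => deal_inj hx hy) (blk f₁ _)
      have p2 : window f₄ (C * m) m = window f₃ (C * m) m :=
        window_comp_perm (fun _ => readRows_lt) (fun _ hx _ hy => readRows_inj hx hy) (blk f₃ _)
      have p3 : window f₆ (C * m) m = window f₅ (C * m) m :=
        window_comp_perm (fun _ => shiftColumns_lt)
          (fun _ hx _ hy => shiftColumns_inj (by omega) hx hy) (blk f₅ _)
      have p4 : window f₈ (C * m) m = window f₇ (C * m) m :=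
        window_comp_perm (fun _ => unshiftColumns_lt)
          (fun _ hx _ hy => unshiftColumns_inj (by omega) hx hy) (blk f₇ _)
      change window f₈ (C * m) m = _
      rw [p4, e1, c67.window_eq, ← e1, p3, e1, c45.window_eq, ← e1, p2, e1, c23.window_eq, ← e1,
        p1, e1, c01.window_eq, ← e1]

/-- The number of rounds that sort `B ^ i` blocks. -/
def sortRounds : ℕ → ℕ
  | 0 => 1
  | i + 1 => 4 * sortRounds i + 4

variable (key)

/-- A block of length `B ^ k` is the memory of one machine and is sorted locally. Columnsort on `B`
columns then gains a factor `B` per level. -/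
theorem exists_sorter {B k K : ℕ} (hB : 2 ≤ B) (hk : 3 ≤ k) (i : ℕ) (hi : k + i ≤ K) :
    ∃ Φ : (ℕ → Item w d) → ℕ → Item w d, Realizable (B ^ K) (B ^ k) (sortRounds i) Φ ∧
      SortsBlocks key (B ^ K) (B ^ (k + i)) Φ := by
  induction i with
  | zero =>
    have hb : 0 < B ^ k := Nat.pow_pos (by omega)
    exact ⟨_, realizable_localSort key hb, sortsBlocks_localSort key hb⟩
  | succ i ih =>
    obtain ⟨Φ, h1, h2⟩ := ih (by omega)
    have e : B ^ (k + i) = B * B ^ (k + i - 1) := by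
      rw [← pow_succ', Nat.sub_add_cancel (by omega)]
    have e' : B ^ (k + (i + 1)) = B * (B * B ^ (k + i - 1)) := by
      rw [← e, ← pow_succ', add_assoc]
    rw [e] at h2
    rw [e']
    -- The cut sits just behind one dirty window; two of them fit into a column because `2 * B ^ 2 ≤
    -- B ^ 3`, which is the reason for `3 ≤ k`.
    refine realizable_columnsort (h := B * B) (by omega) le_rfl ?_ ?_ h1 h2
    · rw [← e]
      calc B * B + B * B = 2 * (B * B) := by ring
        _ ≤ B * (B * B) := Nat.mul_le_mul_right _ hB
        _ = B ^ 3 := by ring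
        _ ≤ B ^ (k + i) := Nat.pow_le_pow_right (by omega) (by omega)
    · rw [← e']
      exact Nat.pow_dvd_pow B hi

theorem exists_full_sorter {B k K : ℕ} (hB : 2 ≤ B) (hk : 3 ≤ k) (hK : k ≤ K) :
    ∃ Φ : (ℕ → Item w d) → ℕ → Item w d, Realizable (B ^ K) (B ^ k) (sortRounds (K - k)) Φ ∧
      ∀ s, SortedOn key (Φ s) 0 (B ^ K) ∧ window (Φ s) 0 (B ^ K) = window s 0 (B ^ K) := by
  obtain ⟨Φ, h1, h2⟩ := exists_sorter (w := w) (d := d) (K := K) key hB hk (K - k) (by omega)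
  refine ⟨Φ, h1, fun s => ?_⟩
  have := h2 s 0 (by rw [zero_add, one_mul, Nat.add_sub_cancel' hK])
  rwa [zero_mul, Nat.add_sub_cancel' hK] at this

end Sorting

/-! ### Padding, copying and `B`-ary scans. -/

section Spread

variable {B n : ℕ}

/-- Move the first `n` of `n * B` slots to the multiples of `B`. -/
def spread (B n x : ℕ) : ℕ := x % B * n + x / B

theorem spread_mul (hB : 0 < B) (y : ℕ) : spread B n (y * B) = y := by
  simp [spread, hB]

theorem realizable_spread : Realizable (n * B) b 1 fun (s : ℕ → Item w d) x => s (spread B n x) := by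
  refine realizable_perm (fun x hx => ?_) fun x hx y hy e => ?_
  · rw [mul_comm] at hx ⊢
    exact readRows_lt hx
  · rw [mul_comm] at hx hy
    exact readRows_inj hx hy e

/-- As `B` divides `b`, the `B` slots from a multiple of `B` to the next one are on the same
machine. -/
theorem realizable_copy (hb : B ∣ b) :
    Realizable N b 1 fun (s : ℕ → Item w d) x => s (x / B * B) := by
  obtain ⟨b', rfl⟩ := hb
  have h : ∀ x, x / B * B / (B * b') = x / (B * b') := by
    intro x
    rcases Nat.eq_zero_or_pos B with rfl | hB
    · simp
    · rw [← Nat.div_div_eq_div_mul, ← Nat.div_div_eq_div_mul, Nat.mul_div_cancel _ hB]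
  exact realizable_local (fun x _ s s' hs => hs _ (h x)) fun x _ s e he => ⟨_, h x, he⟩

/-- Multiply every record at a multiple of `B` by `B`. -/
def replicateStep (B n : ℕ) (s : ℕ → Item w d) (x : ℕ) : Item w d :=
  s (spread B n x / B * B)

theorem realizable_replicateStep (hb : B ∣ b) :
    Realizable (n * B) b 2 (replicateStep (w := w) (d := d) B n) :=
  (realizable_copy hb).comp realizable_spread

theorem realizable_replicate (hb : B ∣ b) (T : ℕ) :
    Realizable (n * B) b (T * 2) fun s : ℕ → Item w d =>
      Nat.rec s (fun _ s' => replicateStep B n s') T :=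
  realizable_iterate (fun _ => realizable_replicateStep hb) T

/-- The copies of record `z` are those numbered `z * B ^ T`, ..., `z * B ^ T + B ^ T - 1`, so a copy
knows from its number which copy it is. The total stays the same: records too far back to have
copies below `n` are lost, so the relevant ones must be in front. -/
theorem replicate_apply (hB : 0 < B) (s : ℕ → Item w d) (T y : ℕ) :
    (Nat.rec s (fun _ s' => replicateStep B n s') T : ℕ → Item w d) (y * B) =
      s (y / B ^ T * B) := by
  induction T generalizing y with
  | zero => simp
  | succ T ih =>
    change replicateStep B n _ (y * B) = _
    rw [replicateStep, spread_mul hB, ih, Nat.div_div_eq_div_mul, ← pow_succ']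

/-- Combine the records at distances `j * c`, for `j < B`. -/
def scanStep (F : ℕ → (ℕ → Item w d) → Item w d) (B n c : ℕ) (s : ℕ → Item w d) (x : ℕ) :
    Item w d :=
  F (x / B) fun j => s ((x / B + j * c) % n * B)

/-- The `B` slots of a record are room to collect its `B` partners in one round; the next round
combines them locally. -/
theorem realizable_scanStep {F : ℕ → (ℕ → Item w d) → Item w d} (hB : 0 < B) (hn : 0 < n)
    (hb : B ∣ b) (hF : ∀ y a a', (∀ j < B, a j = a' j) → F y a = F y a')
    (hF' : ∀ y a e, (F y a).Has e → ∃ j < B, (a j).Has e) (c : ℕ) :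
    Realizable (n * B) b 2 (scanStep F B n c) := by
  obtain ⟨b', rfl⟩ := hb
  have hdiv : ∀ y j, j < B → (y * B + j) / (B * b') = y * B / (B * b') := by
    intro y j hj
    rw [← Nat.div_div_eq_div_mul, slot_div hj, ← Nat.div_div_eq_div_mul, Nat.mul_div_cancel _ hB]
  have h1 : Realizable (n * B) (B * b') 1 fun (s : ℕ → Item w d) x =>
      s ((x / B + x % B * c) % n * B) := by
    -- Each record is requested by `B` slots, so its own position would not be an injective route.
    -- The slot `x % B` places further is on the same machine and is requested once: the residue is
    -- kept and the record number is translated cyclically.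
    refine realizable_of_route (fun x => (x / B + x % B * c) % n * B + x % B) ?_ ?_ ?_ ?_
    · intro x _
      exact slot_lt (Nat.mod_lt _ hn) (Nat.mod_lt _ hB)
    · intro x hx y hy e
      have hx' : x / B < n := Nat.div_lt_of_lt_mul (by rwa [mul_comm])
      have hy' : y / B < n := Nat.div_lt_of_lt_mul (by rwa [mul_comm])
      obtain ⟨e1, e2⟩ := eq_of_slot_eq (Nat.mod_lt x hB) (Nat.mod_lt y hB) e
      rw [e2] at e1
      have e3 : x / B = y / B := by
        have : x / B ≡ y / B [MOD n] := Nat.ModEq.add_right_cancel' _ e1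
        rwa [Nat.ModEq, Nat.mod_eq_of_lt hx', Nat.mod_eq_of_lt hy'] at this
      rw [← Nat.div_add_mod x B, ← Nat.div_add_mod y B, e2, e3]
    · intro x _ s s' h
      exact h _ (hdiv _ _ (Nat.mod_lt x hB)).symm
    · intro x _ s e h
      exact ⟨_, (hdiv _ _ (Nat.mod_lt x hB)).symm, h⟩
  have hx : ∀ x j, j < B → (x / B * B + j) / (B * b') = x / (B * b') := by
    intro x j hj
    rw [hdiv _ _ hj, ← Nat.div_div_eq_div_mul, Nat.mul_div_cancel _ hB,
      Nat.div_div_eq_div_mul]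
  have h2 : Realizable (n * B) (B * b') 1 fun (s : ℕ → Item w d) x =>
      F (x / B) fun j => s (x / B * B + j) := by
    refine realizable_local (fun x _ s s' h => ?_) fun x _ s e h => ?_
    · exact hF _ _ _ fun j hj => h _ (hx x j hj)
    · obtain ⟨j, hj, hje⟩ := hF' _ _ _ h
      exact ⟨_, hx x j hj, hje⟩
  have h3 := h1.comp h2
  have h4 : (fun (s : ℕ → Item w d) x => F (x / B) fun j =>
      s (((x / B * B + j) / B + (x / B * B + j) % B * c) % n * B)) = scanStep F B n c := by
    funext s x
    refine hF _ _ _ fun j hj => ?_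
    rw [slot_div hj, mul_comm (x / B) B, Nat.mul_add_mod, Nat.mod_eq_of_lt hj]
  rw [← h4]
  exact h3

theorem scanStep_apply {F : ℕ → (ℕ → Item w d) → Item w d} (hB : 0 < B) (c : ℕ)
    (s : ℕ → Item w d) (y : ℕ) :
    scanStep F B n c s (y * B) = F y fun j => s ((y + j * c) % n * B) := by
  rw [scanStep, Nat.mul_div_cancel _ hB]

end Spread

end ObliviousMPC

/-! ### Scans for the last hub and for the nearest hub. -/

namespace ObliviousMPC

variable {w d b B n : ℕ}

section LastHub

theorem exists_le_findSome?_range {α : Type*} {f : ℕ → Option α} {B j : ℕ} (hj : j < B)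
    (h : f j ≠ none) : ∃ i ≤ j, f i ≠ none ∧ (List.range B).findSome? f = f i := by
  induction B with
  | zero => omega
  | succ B ih =>
    rw [List.range_succ, List.findSome?_append]
    by_cases hjB : j < B
    · obtain ⟨i, hi, hne, e⟩ := ih hjB
      refine ⟨i, hi, hne, ?_⟩
      rw [e]
      obtain ⟨a, ha⟩ := Option.ne_none_iff_exists'.1 hne
      simp [ha]
    · obtain rfl : j = B := by omega
      cases e : (List.range j).findSome? f with
      | none => exact ⟨j, le_rfl, h, by simp⟩
      | some a =>
        obtain ⟨i, hi, hia⟩ := List.exists_of_findSome?_eq_some e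
        refine ⟨i, (List.mem_range.1 hi).le, by simp [hia], by simp [hia]⟩

/-- The first record, with the hub of the first record in range that has one. -/
def lastHub (B W y : ℕ) (a : ℕ → Item w d) : Item w d :=
  ⟨(a 0).tag, (a 0).pt,
    (List.range B).findSome? fun j => if j * W ≤ y then (a j).cand else none⟩

/-- After `t` scanning steps, every record knows the last hub among the preceding `B ^ t`
records. -/
def lastHubScan (B n : ℕ) (s : ℕ → Item w d) (t : ℕ) : ℕ → Item w d :=
  Nat.rec s (fun t s' => scanStep (lastHub B (B ^ t)) B n (n - B ^ t) s') t

theorem realizable_lastHubScan (hB : 0 < B) (hn : 0 < n) (hb : B ∣ b) (t : ℕ) :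
    Realizable (n * B) b (t * 2) fun s : ℕ → Item w d => lastHubScan B n s t := by
  refine realizable_iterate (fun t => realizable_scanStep hB hn hb ?_ ?_ _) t
  · intro y a a' h
    unfold lastHub
    rw [h 0 hB]
    congr 1
    have : ∀ l : List ℕ, (∀ j ∈ l, j < B) →
        (l.findSome? fun j => if j * B ^ t ≤ y then (a j).cand else none) =
        l.findSome? fun j => if j * B ^ t ≤ y then (a' j).cand else none := by
      intro l
      induction l with
      | nil => simp
      | cons j l ih =>
        intro hl
        rw [List.findSome?_cons, List.findSome?_cons, h j (hl j (by simp)),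
          ih fun i hi => hl i (by simp [hi])]
    exact this _ fun j hj => List.mem_range.1 hj
  · intro y a e h
    rcases h with h | h
    · exact ⟨0, hB, .inl h⟩
    · obtain ⟨j, hj, hje⟩ := List.exists_of_findSome?_eq_some h
      refine ⟨j, List.mem_range.1 hj, .inr ?_⟩
      split_ifs at hje
      exact hje

/-- The window of length `B ^ (t + 1)` that ends at `y` is tiled by `B` windows of length `B ^ t`,
and the first nonempty one, going backwards, decides. That the hub found is not before any given hub
`y'` is all that the sorted order of keys requires later. -/
theorem lastHubScan_spec (hB : 0 < B) (s : ℕ → Item w d) (t : ℕ) (ht : B ^ t ≤ n) :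
    ∀ y < n, (lastHubScan B n s t (y * B)).tag = (s (y * B)).tag ∧
      (lastHubScan B n s t (y * B)).pt = (s (y * B)).pt ∧
      (∀ h, (lastHubScan B n s t (y * B)).cand = some h →
        ∃ y' ≤ y, y < y' + B ^ t ∧ (s (y' * B)).cand = some h) ∧
      (∀ y' ≤ y, y < y' + B ^ t → (s (y' * B)).cand ≠ none →
        ∃ z ≤ y, y' ≤ z ∧ (s (z * B)).cand ≠ none ∧
          (lastHubScan B n s t (y * B)).cand = (s (z * B)).cand) := by
  induction t with
  | zero =>
    intro y _
    refine ⟨rfl, rfl, fun h hh => ⟨y, le_rfl, by simp, hh⟩, fun y' h1 h2 h3 => ?_⟩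
    obtain rfl : y' = y := by simp at h2; omega
    exact ⟨y', le_rfl, le_rfl, h3, rfl⟩
  | succ t ih =>
    intro y hy
    have hW : B ^ t ≤ n := le_trans (Nat.pow_le_pow_right hB (by omega)) ht
    have ih := ih hW
    set W := B ^ t with hWdef
    have hWB : B ^ (t + 1) = B * W := pow_succ' _ _
    set v := lastHubScan B n s t
    -- Modulo `n`, a step forward by `n - W` is a step back by `W`. Positions that would wrap around
    -- are excluded by the test in `lastHub`.
    have hidx : ∀ j, j * W ≤ y → (y + j * (n - W)) % n = y - j * W := by
      intro j hj
      obtain ⟨e, he⟩ := Nat.exists_eq_add_of_le hW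
      have h1 : y + j * (n - W) = (y - j * W) + j * n := by
        have h2 : j * n = j * W + j * e := by rw [he, Nat.mul_add]
        have h3 : n - W = e := by omega
        rw [h3]
        omega
      rw [h1, Nat.add_mul_mod_self_right, Nat.mod_eq_of_lt (by omega)]
    have hstep : lastHubScan B n s (t + 1) (y * B) =
        lastHub B W y fun j => v ((y + j * (n - W)) % n * B) :=
      scanStep_apply (F := lastHub B W) hB (n - W) v y
    have h0 : (y + 0 * (n - W)) % n = y := by simpa using hidx 0 (by simp)
    rw [hstep]
    refine ⟨?_, ?_, ?_, ?_⟩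
    · simp only [lastHub, h0]
      exact (ih y hy).1
    · simp only [lastHub, h0]
      exact (ih y hy).2.1
    · intro h hh
      obtain ⟨j, hj, hje⟩ := List.exists_of_findSome?_eq_some hh
      split_ifs at hje with hjy
      change (v ((y + j * (n - W)) % n * B)).cand = some h at hje
      rw [hWB]
      rw [hidx j hjy] at hje
      obtain ⟨y', h1, h2, h3⟩ := (ih _ (by omega)).2.2.1 h hje
      refine ⟨y', by omega, ?_, h3⟩
      have : (j + 1) * W ≤ B * W := Nat.mul_le_mul_right W (List.mem_range.1 hj)
      rw [Nat.add_mul, one_mul] at this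
      omega
    · intro y' hy' hlt hne
      rw [hWB] at hlt
      have hW0 : 0 < W := Nat.pow_pos hB
      have hd := Nat.div_add_mod (y - y') W
      have hm := Nat.mod_lt (y - y') hW0
      set j := (y - y') / W
      rw [mul_comm] at hd
      have hj : j < B := Nat.div_lt_of_lt_mul (by rw [mul_comm]; omega)
      have hjy : j * W ≤ y := by omega
      obtain ⟨z, hz1, hz2, hz3, hz4⟩ :=
        (ih (y - j * W) (by omega)).2.2.2 y' (by omega) (by omega) hne
      set f : ℕ → Option (EuclideanSpace ℝ (Fin d)) :=
        fun j => if j * W ≤ y then (v ((y + j * (n - W)) % n * B)).cand else none with hf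
      have hfj : f j ≠ none := by
        simp only [hf, hjy, if_true, hidx j hjy]
        rw [hz4]
        exact hz3
      obtain ⟨i, hij, hi, hie⟩ := exists_le_findSome?_range hj hfj
      have hgoal : (lastHub B W y fun j => v ((y + j * (n - W)) % n * B)).cand = f i := hie
      rw [hgoal]
      rcases hij.eq_or_lt with rfl | hij
      · refine ⟨z, by omega, hz2, hz3, ?_⟩
        simp only [hf, hjy, if_true, hidx _ hjy]
        exact hz4
      -- A hub in an earlier tile `i < j` of the search is closer to `y` than the whole tile of
      -- `y'`.
      · have hiy : i * W ≤ y := by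
          by_contra hh
          simp [hf, hh] at hi
        have hij' : (i + 1) * W ≤ j * W := Nat.mul_le_mul_right W hij
        rw [Nat.add_mul, one_mul] at hij'
        have hfi : f i = (v ((y - i * W) * B)).cand := by
          simp only [hf, hiy, if_true, hidx _ hiy]
        obtain ⟨h, hh⟩ := Option.ne_none_iff_exists'.1 hi
        rw [hfi] at hh
        obtain ⟨z', hz1', hz2', hz3'⟩ := (ih (y - i * W) (by omega)).2.2.1 h hh
        exact ⟨z', by omega, by omega, by simp [hz3'], by rw [hfi, hh, hz3']⟩

end LastHub

section Nearest

open Classical in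
/-- The first record, with the hub of the records that is nearest to its query point. -/
noncomputable def nearestHub (B : ℕ) (_y : ℕ) (a : ℕ → Item w d) : Item w d :=
  ⟨(a 0).tag, (a 0).pt, (a 0).pt.bind fun q =>
    ((List.range B).filterMap fun j => (a j).cand).argmin (dist q)⟩

/-- After `t` scanning steps, every record knows the nearest hub among the following `B ^ t`
records. -/
noncomputable def nearestScan (B n : ℕ) (s : ℕ → Item w d) (t : ℕ) : ℕ → Item w d :=
  Nat.rec s (fun t s' => scanStep (nearestHub B) B n (B ^ t) s') t

theorem realizable_nearestScan (hB : 0 < B) (hn : 0 < n) (hb : B ∣ b) (t : ℕ) :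
    Realizable (n * B) b (t * 2) fun s : ℕ → Item w d => nearestScan B n s t := by
  refine realizable_iterate (fun t => realizable_scanStep hB hn hb ?_ ?_ _) t
  · intro y a a' h
    unfold nearestHub
    have : ((List.range B).filterMap fun j => (a j).cand) =
        (List.range B).filterMap fun j => (a' j).cand :=
      List.filterMap_congr fun j hj => by rw [h j (List.mem_range.1 hj)]
    rw [h 0 hB, this]
  · intro y a e h
    rcases h with h | h
    · exact ⟨0, hB, .inl h⟩
    · obtain ⟨q, -, hq⟩ := Option.bind_eq_some_iff.1 h
      obtain ⟨j, hj, hje⟩ := List.mem_filterMap.1 (List.argmin_mem hq)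
      exact ⟨j, List.mem_range.1 hj, .inr hje⟩

/-- Minima of subwindows can be combined only if they refer to the same query, hence the assumption
that the window consists of copies of `q`; `y + B ^ t ≤ n` excludes wrapping around. -/
theorem nearestScan_spec (hB : 0 < B) (s : ℕ → Item w d) (t : ℕ) (q : EuclideanSpace ℝ (Fin d)) :
    ∀ y, y + B ^ t ≤ n → (∀ z, y ≤ z → z < y + B ^ t → (s (z * B)).pt = some q) →
      (nearestScan B n s t (y * B)).pt = some q ∧
      (∀ h, (nearestScan B n s t (y * B)).cand = some h →
        ∃ z, y ≤ z ∧ z < y + B ^ t ∧ (s (z * B)).cand = some h) ∧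
      (∀ z h', y ≤ z → z < y + B ^ t → (s (z * B)).cand = some h' →
        ∃ h, (nearestScan B n s t (y * B)).cand = some h ∧ dist q h ≤ dist q h') := by
  classical
  induction t with
  | zero =>
    intro y _ hq
    refine ⟨hq y le_rfl (by simp), fun h hh => ⟨y, le_rfl, by simp, hh⟩, fun z h' h1 h2 h3 => ?_⟩
    obtain rfl : z = y := by simp at h2; omega
    exact ⟨h', h3, le_rfl⟩
  | succ t ih =>
    intro y hyn hq
    set W := B ^ t with hWdef
    have hWB : B ^ (t + 1) = B * W := pow_succ' _ _
    rw [hWB] at hyn hq ⊢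
    have hW0 : 0 < W := Nat.pow_pos hB
    set v := nearestScan B n s t
    have hjW : ∀ j < B, j * W + W ≤ B * W := fun j hj => by
      have := Nat.mul_le_mul_right W hj
      rwa [Nat.succ_mul] at this
    have hidx : ∀ j < B, (y + j * W) % n = y + j * W := fun j hj =>
      Nat.mod_eq_of_lt (by have := hjW j hj; omega)
    have ihj : ∀ j < B, _ := fun j hj => ih (y + j * W) (by have := hjW j hj; omega)
      fun z h1 h2 => hq z (by omega) (by have := hjW j hj; omega)
    have hstep : nearestScan B n s (t + 1) (y * B) =
        nearestHub B y fun j => v ((y + j * W) % n * B) :=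
      scanStep_apply (F := nearestHub B) hB W v y
    have hpt : (v ((y + 0 * W) % n * B)).pt = some q := by
      rw [hidx 0 hB]
      exact (ihj 0 hB).1
    have hcand : (nearestScan B n s (t + 1) (y * B)).cand =
        ((List.range B).filterMap fun j => (v ((y + j * W) * B)).cand).argmin (dist q) := by
      rw [hstep]
      simp only [nearestHub, hpt, Option.bind_some]
      congr 1
      exact List.filterMap_congr fun j hj => by rw [hidx j (List.mem_range.1 hj)]
    rw [hcand]
    refine ⟨by rw [hstep]; exact hpt, ?_, ?_⟩
    · intro h hh
      obtain ⟨j, hj, hje⟩ := List.mem_filterMap.1 (List.argmin_mem hh)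
      have hj := List.mem_range.1 hj
      obtain ⟨z, h1, h2, h3⟩ := (ihj j hj).2.1 h hje
      exact ⟨z, by omega, by have := hjW j hj; omega, h3⟩
    · intro z h' h1 h2 h3
      have hd := Nat.div_add_mod (z - y) W
      have hm := Nat.mod_lt (z - y) hW0
      set j := (z - y) / W
      rw [mul_comm] at hd
      have hj : j < B := Nat.div_lt_of_lt_mul (by rw [mul_comm]; omega)
      obtain ⟨h, hh, hle⟩ := (ihj j hj).2.2 z h' (by omega) (by omega) h3
      have hmem : h ∈ (List.range B).filterMap fun j => (v ((y + j * W) * B)).cand :=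
        List.mem_filterMap.2 ⟨j, List.mem_range.2 hj, hh⟩
      cases e : ((List.range B).filterMap fun j => (v ((y + j * W) * B)).cand).argmin (dist q) with
      | none =>
        rw [List.argmin_eq_none.1 e] at hmem
        simp at hmem
      | some m => exact ⟨m, rfl, (List.le_of_mem_argmin hmem e).trans hle⟩

end Nearest

section Lookup

/-- Give the records at multiples of `B` consecutive tags. -/
def label (B n x : ℕ) (a : Item w d) : Item w d :=
  if B ∣ x then ⟨Fin.ofNat (2 ^ w) (x / B), a.pt, a.cand⟩ else Item.blank (Fin.ofNat (2 ^ w) n)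

/-- Keep the records at multiples of `m`. -/
def mask (m t x : ℕ) (a : Item w d) : Item w d :=
  if m ∣ x then a else Item.blank (Fin.ofNat (2 ^ w) t)

theorem realizable_label {N : ℕ} :
    Realizable N b 1 fun (s : ℕ → Item w d) x => label B n x (s x) := by
  refine realizable_pointwise fun x a e h => ?_
  unfold label at h
  split_ifs at h
  · exact h
  · simp [Item.blank, Item.Has] at h

theorem realizable_mask {N m t : ℕ} :
    Realizable N b 1 fun (s : ℕ → Item w d) x => mask m t x (s x) := by
  refine realizable_pointwise fun x a e h => ?_
  unfold mask at h
  split_ifs at h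
  · exact h
  · simp [Item.blank, Item.Has] at h

/-- Hubs come before the queries with the same key, and unused records come last. -/
noncomputable def lookupKey (n : ℕ) (kh kq : ℕ → EuclideanSpace ℝ (Fin d) → ℕ) (a : Item w d) :
    WithTop ℕ :=
  if n ≤ (a.tag : ℕ) then ⊤
  else match a.cand, a.pt with
    | some h, _ => ((2 * kh a.tag h : ℕ) : WithTop ℕ)
    | none, some q => ((2 * kq a.tag q + 1 : ℕ) : WithTop ℕ)
    | none, none => 0

theorem lookupKey_lt_top {kh kq : ℕ → EuclideanSpace ℝ (Fin d) → ℕ} {a : Item w d} :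
    lookupKey n kh kq a < ⊤ ↔ (a.tag : ℕ) < n := by
  unfold lookupKey
  split_ifs with h
  · simp [h]
  · simp only [not_le.1 h, iff_true]
    split <;> exact WithTop.coe_lt_top _

/-- `spread n B` is the inverse of `spread B n` and enumerates the slots with the multiples of `B`
first. Counting over marked slots thereby becomes counting over an initial segment. -/
theorem spread_le {z : ℕ} (hz : z < n * B) : (z < n ∧ spread n B z = z * B) ∨
    (n ≤ z ∧ ¬ B ∣ spread n B z) := by
  have hn : 0 < n := Nat.pos_of_ne_zero fun h => by simp [h] at hz
  have hB : 0 < B := Nat.pos_of_ne_zero fun h => by simp [h] at hz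
  unfold spread
  rcases lt_or_ge z n with h | h
  · exact .inl ⟨h, by rw [Nat.mod_eq_of_lt h, Nat.div_eq_of_lt h, add_zero]⟩
  · refine .inr ⟨h, fun hd => ?_⟩
    have h1 := (Nat.dvd_add_right (Dvd.intro_left (z % n) rfl)).1 hd
    have h2 : z / n < B := Nat.div_lt_of_lt_mul hz
    have h3 : 0 < z / n := Nat.div_pos h hn
    exact absurd (Nat.le_of_dvd h3 h1) (by omega)

theorem window_spread {α : Type*} (f : ℕ → α) :
    window (fun z => f (spread n B z)) 0 (n * B) = window f 0 (n * B) := by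
  refine window_comp_perm (σ := spread n B) (fun u hu => ?_) (fun u hu v hv e => ?_)
    fun u _ => by simp
  · have := readRows_lt hu
    rwa [mul_comm] at this ⊢
  · exact readRows_inj hu hv e

end Lookup

end ObliviousMPC

/-! ### Looking up a hub with a given key. -/

namespace ObliviousMPC

variable {w d b B n D U : ℕ}

/-- All records can be sorted in `D` rounds. -/
def HasSorter (w d N b D : ℕ) : Prop :=
  ∀ key : Item w d → WithTop ℕ, ∃ Φ : (ℕ → Item w d) → ℕ → Item w d, Realizable N b D Φ ∧
    ∀ s, SortedOn key (Φ s) 0 N ∧ window (Φ s) 0 N = window s 0 N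

theorem countIn_congr {α β : Type*} {P : α → Prop} {P' : β → Prop} {f : ℕ → α} {g : ℕ → β} {r : ℕ}
    (h : ∀ u < r, P (f u) ↔ P' (g u)) : countIn P f 0 r = countIn P' g 0 r := by
  classical
  rw [countIn_eq_card, countIn_eq_card]
  congr 1
  refine Finset.filter_congr fun u hu => ?_
  rw [zero_add]
  exact h u (Finset.mem_range.1 hu)

theorem countIn_spread {α : Type*} {P : α → Prop} (f : ℕ → α) :
    countIn P f 0 (n * B) = countIn P (fun z => f (spread n B z)) 0 (n * B) := by
  rw [countIn, countIn, window_spread]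

theorem countIn_eq {α : Type*} {P : α → Prop} {f : ℕ → α} {r k : ℕ} (hk : k ≤ r)
    (h : ∀ u < r, P (f u) ↔ u < k) : countIn P f 0 r = k :=
  le_antisymm (countIn_le fun u hu hur => by
      rw [zero_add, h u hur]
      omega)
    (le_countIn hk fun u hu => by
      rw [zero_add, h u (by omega)]
      exact hu)

/-- Every query learns, if there is one, about a hub with the same key. -/
theorem exists_lookup (hS : HasSorter w d (n * B) b D) (hB : 0 < B) (hn : n = B ^ U) (hb : B ∣ b)
    (hw : n < 2 ^ w) (kh kq : ℕ → EuclideanSpace ℝ (Fin d) → ℕ) :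
    ∃ Φ : (ℕ → Item w d) → ℕ → Item w d,
      Realizable (n * B) b (1 + D + 1 + U * 2 + 1 + D + 1) Φ ∧
      ∀ s, ∀ y < n, (Φ s (y * B)).pt = (s (y * B)).pt ∧
        (∀ h, (Φ s (y * B)).cand = some h → ∃ y' < n, (s (y' * B)).cand = some h) ∧
        (∀ q y' h', (s (y * B)).pt = some q → (s (y * B)).cand = none → y' < n →
          (s (y' * B)).cand = some h' → kh y' h' = kq y q →
          ∃ y'' < n, ∃ h'', (s (y'' * B)).cand = some h'' ∧ kh y'' h'' = kq y q ∧
            (Φ s (y * B)).cand = some h'') := by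
  have hn0 : 0 < n := hn ▸ Nat.pow_pos hB
  obtain ⟨S₁, hS₁, hS₁'⟩ := hS (lookupKey n kh kq)
  obtain ⟨S₂, hS₂, hS₂'⟩ := hS fun a => ((a.tag : ℕ) : WithTop ℕ)
  -- The tag remembers where a record started, so the second sort brings it back. The mask in
  -- between is needed because `scanStep` leaves a copy of the result in all `B` slots of a record.
  refine ⟨_, ((((((realizable_label (n := n) (B := B)).comp hS₁).comp realizable_spread).comp
    (realizable_lastHubScan hB hn0 hb U)).comp (realizable_mask (m := B) (t := n))).comp hS₂).comp
    realizable_spread, ?_⟩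
  intro s
  set t : ℕ → Item w d := fun x => label B n x (s x) with ht
  set u := S₁ t with hu
  set v : ℕ → Item w d := fun x => u (spread B n x) with hv
  set l := lastHubScan B n v U with hl
  set m : ℕ → Item w d := fun x => mask B n x (l x) with hm
  set z := S₂ m with hz
  set e : ℕ → Item w d := fun y => ⟨Fin.ofNat (2 ^ w) y, (s (y * B)).pt, (s (y * B)).cand⟩ with he
  -- By `n < 2 ^ w` the tag `n` is available as a mark for unused slots.
  have htag : ∀ y ≤ n, ((Fin.ofNat (2 ^ w) y : Fin (2 ^ w)) : ℕ) = y := fun y hy =>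
    Nat.mod_eq_of_lt (by omega)
  have t1 : ∀ y, t (y * B) = e y := fun y => by
    simp only [ht, label, Nat.dvd_mul_left, if_true, Nat.mul_div_cancel _ hB, he]
  have t2 : ∀ x, ¬ B ∣ x → (t x).tag = Fin.ofNat (2 ^ w) n := fun x hx => by
    simp only [ht, label, hx, if_false, Item.blank]
  have m1 : ∀ y, m (y * B) = l (y * B) := fun y => by
    simp only [hm, mask, Nat.dvd_mul_left, if_true]
  have m2 : ∀ x, ¬ B ∣ x → (m x).tag = Fin.ofNat (2 ^ w) n := fun x hx => by
    simp only [hm, mask, hx, if_false, Item.blank]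
  have v1 : ∀ y, v (y * B) = u y := fun y => by simp only [hv, spread_mul hB]
  have hnN : n ≤ n * B := Nat.le_mul_of_pos_right n hB
  have ht_tag : ∀ x < n * B, ∀ θ ≤ n, ((t (spread n B x)).tag : ℕ) < θ ↔ x < θ := by
    intro x hx θ hθ
    rcases spread_le hx with ⟨h1, h2⟩ | ⟨h1, h2⟩
    · rw [h2, t1]
      simp only [he, htag x h1.le]
    · rw [t2 _ h2, htag n le_rfl]
      omega
  have ht_count : ∀ θ ≤ n, countIn (fun a : Item w d => (a.tag : ℕ) < θ) t 0 (n * B) = θ :=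
    fun θ hθ => by
      rw [countIn_spread]
      exact countIn_eq (hθ.trans hnN) fun x hx => ht_tag x hx θ hθ
  -- Exactly `n` records have a key below `⊤`, so sorting puts the genuine records in the first `n`
  -- places.
  have hu_tag : ∀ x < n * B, ((u x).tag : ℕ) < n ↔ x < n := by
    intro x hx
    have h1 := (hS₁' t).1.lt_iff ⊤ hx
    rw [zero_add, lookupKey_lt_top, countIn, (hS₁' t).2, ← countIn] at h1
    simp only [lookupKey_lt_top] at h1
    rwa [ht_count n le_rfl] at h1
  have huG : ∀ p < n, ∃ y < n, u p = e y := by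
    intro p hp
    have h1 : u p ∈ window t 0 (n * B) := by
      rw [← (hS₁' t).2, mem_window]
      exact ⟨p, by omega, by rw [zero_add]⟩
    obtain ⟨x, hx, hxp⟩ := mem_window.1 h1
    rw [zero_add] at hxp
    have h2 := (hu_tag p (by omega)).2 hp
    by_cases hd : B ∣ x
    · obtain ⟨y, rfl⟩ := hd
      rw [mul_comm] at hxp hx
      rw [t1] at hxp
      exact ⟨y, lt_of_mul_lt_mul_right hx (Nat.zero_le B), hxp.symm⟩
    · rw [← hxp, t2 x hd, htag n le_rfl] at h2
      omega
  have hGu : ∀ y < n, ∃ p < n, u p = e y := by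
    intro y hy
    have h1 : e y ∈ window u 0 (n * B) := by
      rw [(hS₁' t).2, mem_window]
      exact ⟨y * B, Nat.mul_lt_mul_of_pos_right hy hB, by rw [zero_add, t1]⟩
    obtain ⟨p, hp, hpe⟩ := mem_window.1 h1
    rw [zero_add] at hpe
    refine ⟨p, (hu_tag p hp).1 ?_, hpe⟩
    rw [hpe]
    simp only [he, htag y hy.le]
    exact hy
  have hscan := lastHubScan_spec (n := n) hB v U hn.ge
  rw [← hl] at hscan
  have hm_tag : ∀ x < n * B, ∀ θ ≤ n, ((m (spread n B x)).tag : ℕ) < θ ↔ ((u x).tag : ℕ) < θ := by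
    intro x hx θ hθ
    rcases spread_le hx with ⟨h1, h2⟩ | ⟨h1, h2⟩
    · rw [h2, m1, (hscan x h1).1, v1]
    · have h3 := hu_tag x hx
      rw [m2 _ h2, htag n le_rfl]
      omega
  have hm_count : ∀ θ ≤ n, countIn (fun a : Item w d => (a.tag : ℕ) < θ) m 0 (n * B) = θ := by
    intro θ hθ
    rw [countIn_spread, countIn_congr (P' := fun a : Item w d => (a.tag : ℕ) < θ) (g := u)
      (fun x hx => hm_tag x hx θ hθ), countIn, (hS₁' t).2, ← countIn]
    exact ht_count θ hθ
  have hz_tag : ∀ x < n * B, ∀ θ ≤ n, ((z x).tag : ℕ) < θ ↔ x < θ := by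
    intro x hx θ hθ
    have h1 := (hS₂' m).1.lt_iff (θ : WithTop ℕ) hx
    rw [zero_add, countIn, (hS₂' m).2, ← countIn] at h1
    simp only [Nat.cast_lt] at h1
    rwa [hm_count θ hθ] at h1
  -- For every `θ ≤ n` exactly `θ` tags are below `θ`; after sorting by tag, place `y` therefore
  -- holds tag `y`.
  have hzl : ∀ y < n, ∃ p < n, u p = e y ∧ z y = l (p * B) := by
    intro y hy
    have hyN : y < n * B := by omega
    have h1 : ((z y).tag : ℕ) = y := by
      have h2 := (hz_tag y hyN (y + 1) hy).2 (by omega)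
      have h3 := hz_tag y hyN y hy.le
      omega
    have h2 : z y ∈ window m 0 (n * B) := by
      rw [← (hS₂' m).2, mem_window]
      exact ⟨y, hyN, by rw [zero_add]⟩
    obtain ⟨x, hx, hxz⟩ := mem_window.1 h2
    rw [zero_add] at hxz
    by_cases hd : B ∣ x
    · obtain ⟨p, rfl⟩ := hd
      rw [mul_comm] at hxz hx
      have hp : p < n := lt_of_mul_lt_mul_right hx (Nat.zero_le B)
      rw [m1] at hxz
      obtain ⟨y', hy', hpe⟩ := huG p hp
      have h3 := (hscan p hp).1
      rw [hxz, v1, hpe] at h3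
      rw [h3] at h1
      simp only [he, htag y' hy'.le] at h1
      rw [h1] at hpe
      exact ⟨p, hp, hpe, hxz.symm⟩
    · rw [← hxz, m2 x hd, htag n le_rfl] at h1
      omega
  have hsorted := (hS₁' t).1
  have hmono : ∀ p p', p ≤ p' → p' < n → lookupKey n kh kq (u p) ≤ lookupKey n kh kq (u p') := by
    intro p p' h h'
    have := hsorted p p' h (by omega)
    simpa only [zero_add] using this
  have hkey_hub : ∀ y < n, ∀ h, (e y).cand = some h →
      lookupKey n kh kq (e y) = ((2 * kh y h : ℕ) : WithTop ℕ) := by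
    intro y hy h hh
    unfold lookupKey
    rw [hh]
    have : ((e y).tag : ℕ) = y := htag y hy.le
    rw [this, if_neg (by omega)]
  have hkey_query : ∀ y < n, ∀ q, (e y).cand = none → (e y).pt = some q →
      lookupKey n kh kq (e y) = ((2 * kq y q + 1 : ℕ) : WithTop ℕ) := by
    intro y hy q hh hq
    unfold lookupKey
    rw [hh, hq]
    have : ((e y).tag : ℕ) = y := htag y hy.le
    rw [this, if_neg (by omega)]
  intro y hy
  obtain ⟨p, hp, hpe, hzp⟩ := hzl y hy
  obtain ⟨-, hs2, hs3, hs4⟩ := hscan p hp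
  have hr : z (spread B n (y * B)) = l (p * B) := by rw [spread_mul hB, hzp]
  change (z (spread B n (y * B))).pt = _ ∧ (∀ h, (z (spread B n (y * B))).cand = _ → _) ∧
    ∀ q y' h', _ → _ → _ → _ → _ → ∃ y'' < n, ∃ h'', _ ∧ _ ∧ (z (spread B n (y * B))).cand = _
  rw [hr]
  refine ⟨?_, fun h hh => ?_, fun q y' h' hq hc hy' hh' hkey => ?_⟩
  · rw [hs2, v1, hpe]
  · obtain ⟨p', hp', -, hph⟩ := hs3 h hh
    obtain ⟨y', hy', hpe'⟩ := huG p' (by omega)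
    rw [v1, hpe'] at hph
    exact ⟨y', hy', hph⟩
  · obtain ⟨p', hp', hpe'⟩ := hGu y' hy'
    have k1 := hkey_hub y' hy' h' hh'
    have k2 := hkey_query y hy q hc hq
    rw [← hpe'] at k1
    rw [← hpe] at k2
    have hle : p' ≤ p := by
      by_contra hlt
      have := hmono p p' (by omega) hp'
      rw [k1, k2, Nat.cast_le] at this
      omega
    have hne : (v (p' * B)).cand ≠ none := by
      rw [v1, hpe']
      simp only [he, hh']
      simp
    obtain ⟨p'', hp1, hp2, hp3, hp4⟩ := hs4 p' hle (by omega) hne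
    obtain ⟨y'', hy'', hpe''⟩ := huG p'' (by omega)
    rw [v1, hpe''] at hp3 hp4
    obtain ⟨h'', hh''⟩ := Option.ne_none_iff_exists'.1 hp3
    have k3 := hkey_hub y'' hy'' h'' hh''
    rw [← hpe''] at k3
    -- The hub found stands between a hub with the key `κ` of the query and the query itself, so its
    -- even sort key lies between `2 * κ` and `2 * κ + 1`.
    have i1 := hmono p' p'' hp2 (by omega)
    have i2 := hmono p'' p hp1 hp
    rw [k1, k3, Nat.cast_le] at i1
    rw [k2, k3, Nat.cast_le] at i2
    refine ⟨y'', hy'', h'', hh'', by omega, ?_⟩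
    rw [hp4, hh'']

end ObliviousMPC

/-! ### The whole search on slots. -/

namespace ObliviousMPC

variable {w d b B n D U : ℕ}

theorem eq_of_nodup_filterMap {α : Type*} {N : ℕ} {f : ℕ → Option α}
    (h : ((Multiset.range N).filterMap f).Nodup) {x y : ℕ} (hx : x < N) (hy : y < N) {a : α}
    (hxa : f x = some a) (hya : f y = some a) : x = y := by
  by_contra hne
  obtain ⟨r, hr⟩ := Multiset.exists_cons_of_mem (Multiset.mem_range.2 hx)
  have hyr : y ∈ r := by
    have := Multiset.mem_range.2 hy
    rw [hr] at this
    exact (Multiset.mem_cons.1 this).resolve_left (Ne.symm hne)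
  rw [hr, Multiset.filterMap_cons_some f x r hxa, Multiset.nodup_cons] at h
  exact h.1 ((Multiset.mem_filterMap f r).2 ⟨y, hyr, hya⟩)

theorem nearestScan_pt (hB : 0 < B) (s : ℕ → Item w d) (t : ℕ) {y : ℕ} (hy : y < n) :
    (nearestScan B n s t (y * B)).pt = (s (y * B)).pt := by
  induction t with
  | zero => rfl
  | succ t ih =>
    have hstep : nearestScan B n s (t + 1) (y * B) =
        nearestHub B y fun j => nearestScan B n s t ((y + j * B ^ t) % n * B) :=
      scanStep_apply (F := nearestHub B) hB (B ^ t) (nearestScan B n s t) y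
    have hidx : (y + 0 * B ^ t) % n = y := by rw [zero_mul, add_zero, Nat.mod_eq_of_lt hy]
    rw [hstep, ← ih]
    simp only [nearestHub, hidx]

/-- For some copy of the query `q` there is a hub with the same key, and all such hubs are near. -/
def KeysNear (n₀ R : ℕ) (kh kq : ℕ → EuclideanSpace ℝ (Fin d) → ℕ)
    (H : Finset (EuclideanSpace ℝ (Fin d))) (α : ℝ) (q : EuclideanSpace ℝ (Fin d)) : Prop :=
  ∀ hub : ℕ → Option (EuclideanSpace ℝ (Fin d)),
    (∀ x h, hub x = some h → h ∈ H ∧ x < n₀) → (∀ h ∈ H, ∃ x, hub x = some h) →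
    ∀ z, ∃ c < R,
      (∃ y h, hub (y / R) = some h ∧ kh y h = kq (z * R + c) q) ∧
      ∀ y h, hub (y / R) = some h → kh y h = kq (z * R + c) q →
        dist q h < α * Metric.infDist q (H : Set (EuclideanSpace ℝ (Fin d)))

open Classical in
/-- The records of the input. -/
noncomputable def inputItem (w : ℕ) (H : Finset (EuclideanSpace ℝ (Fin d)))
    (q : EuclideanSpace ℝ (Fin d)) : Item w d :=
  Item.ofInput (q, decide (q ∈ H))

theorem inputItem_of_mem {H : Finset (EuclideanSpace ℝ (Fin d))} {q : EuclideanSpace ℝ (Fin d)}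
    (h : q ∈ H) : inputItem w H q = ⟨0, none, some q⟩ := by
  simp [inputItem, Item.ofInput, h]

theorem inputItem_of_notMem {H : Finset (EuclideanSpace ℝ (Fin d))} {q : EuclideanSpace ℝ (Fin d)}
    (h : q ∉ H) : inputItem w H q = ⟨0, some q, none⟩ := by
  simp [inputItem, Item.ofInput, h]

open Classical in
/-- Blank records come last. -/
noncomputable def blankKey (a : Item w d) : WithTop ℕ := if a.pt = none ∧ a.cand = none then 1 else 0

theorem blankKey_lt_one {a : Item w d} : blankKey a < 1 ↔ ¬ (a.pt = none ∧ a.cand = none) := by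
  unfold blankKey
  split_ifs with h <;> simp [h]

theorem countIn_le_card {α : Type*} {P : α → Prop} {f : ℕ → α} {o r : ℕ} {s t : Multiset α}
    (h : window f o r = s + t) (ht : ∀ a ∈ t, ¬ P a) : countIn P f o r ≤ s.card := by
  classical
  rw [countIn, h, Multiset.countP_add, Multiset.countP_eq_zero.2 ht]
  exact Multiset.countP_le_card _ _

section Sorted

variable {Q H : Finset (EuclideanSpace ℝ (Fin d))} {N m : ℕ} {s : ℕ → Item w d}

theorem eq_blank_or_inputItem
    (hs : window s 0 N = Q.val.map (inputItem w H) + Multiset.replicate m (Item.blank 0))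
    {x : ℕ} (hx : x < N) : s x = Item.blank 0 ∨ ∃ q ∈ Q, s x = inputItem w H q := by
  have h : s x ∈ window s 0 N := mem_window.2 ⟨x, hx, by rw [zero_add]⟩
  rw [hs, Multiset.mem_add, Multiset.mem_map] at h
  rcases h with ⟨q, hq, h⟩ | h
  · exact .inr ⟨q, hq, h.symm⟩
  · exact .inl (Multiset.eq_of_mem_replicate h)

/-- At most `Q.card` records are not blank, and sorting by `blankKey` moves them to the front. -/
theorem eq_blank_of_card_le
    (hs : window s 0 N = Q.val.map (inputItem w H) + Multiset.replicate m (Item.blank 0))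
    (hsort : SortedOn blankKey s 0 N) {x : ℕ} (hx : x < N) (hQ : Q.card ≤ x) :
    s x = Item.blank 0 := by
  have h1 := hsort.lt_iff 1 hx
  have h2 : countIn (fun a => blankKey a < 1) s 0 N ≤ Q.card := by
    refine (countIn_le_card hs fun a ha => ?_).trans_eq (Multiset.card_map _ _)
    rw [Multiset.eq_of_mem_replicate ha, blankKey_lt_one]
    simp [Item.blank]
  rw [zero_add, blankKey_lt_one] at h1
  have h3 : (s x).pt = none ∧ (s x).cand = none := by
    by_contra hcon
    exact absurd (h1.1 hcon) (by omega)
  rcases eq_blank_or_inputItem hs hx with h | ⟨q, -, h⟩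
  · exact h
  · exfalso
    by_cases hq : q ∈ H
    · rw [h, inputItem_of_mem hq] at h3
      simp at h3
    · rw [h, inputItem_of_notMem hq] at h3
      simp at h3

theorem filterMap_pt_eq
    (hs : window s 0 N = Q.val.map (inputItem w H) + Multiset.replicate m (Item.blank 0)) :
    (Multiset.range N).filterMap (fun x => (s x).pt) =
      (Q.filter fun q => q ∉ H).val := by
  classical
  have h1 : (Multiset.range N).filterMap (fun x => (s x).pt) =
      (window s 0 N).filterMap Item.pt := by
    rw [window, Multiset.filterMap_map]
    simp [Function.comp_def]
  rw [h1, hs, Multiset.filterMap_add, Multiset.filterMap_map, Finset.filter_val]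
  have h2 : (Multiset.replicate m (Item.blank 0 : Item w d)).filterMap Item.pt = 0 := by
    refine Multiset.eq_zero_of_forall_notMem fun a ha => ?_
    obtain ⟨x, hx, hxa⟩ := (Multiset.mem_filterMap _ _).1 ha
    rw [Multiset.eq_of_mem_replicate hx] at hxa
    simp [Item.blank] at hxa
  rw [h2, add_zero, ← Multiset.filterMap_eq_filter]
  congr 1
  funext q
  by_cases hq : q ∈ H
  · simp [inputItem_of_mem hq, hq, Option.guard]
  · simp [inputItem_of_notMem hq, hq, Option.guard]

end Sorted

/-- Every query learns about a near hub. -/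
theorem exists_pipeline (hS : HasSorter w d (n * B) b D) (hB : 0 < B) (hn : n = B ^ U)
    (hb : B ∣ b) (hw : n < 2 ^ w) {T n₀ : ℕ} (hTU : T ≤ U) (hn₀ : n₀ * B ^ T ≤ n)
    (kh kq : ℕ → EuclideanSpace ℝ (Fin d) → ℕ) :
    ∃ Φ : (ℕ → Item w d) → ℕ → Item w d,
      Realizable (n * B) b (3 * D + 4 * T + 2 * U + 6) Φ ∧
      ∀ (Q H : Finset (EuclideanSpace ℝ (Fin d))) (α : ℝ) (s : ℕ → Item w d) (m : ℕ),
        H ⊆ Q → Q.card ≤ n₀ →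
        window s 0 (n * B) = Q.val.map (inputItem w H) + Multiset.replicate m (Item.blank 0) →
        (∀ q ∈ Q, q ∉ H → KeysNear n₀ (B ^ T) kh kq H α q) →
        ∃ close : EuclideanSpace ℝ (Fin d) → EuclideanSpace ℝ (Fin d),
          (∀ q ∈ Q, q ∉ H → close q ∈ H ∧
            dist q (close q) < α * Metric.infDist q (H : Set (EuclideanSpace ℝ (Fin d)))) ∧
          (∀ x < n * B, ∀ q, (Φ s x).pt = some q → (Φ s x).cand = some (close q)) ∧
          (Multiset.range (n * B)).filterMap (fun x => (Φ s x).pt) =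
            (Q.filter fun q => q ∉ H).val := by
  classical
  have hn0 : 0 < n := hn ▸ Nat.pow_pos hB
  obtain ⟨S, hS₁, hS₁'⟩ := hS blankKey
  obtain ⟨L, hL, hL'⟩ := exists_lookup hS hB hn hb hw kh kq
  set R := B ^ T with hR
  have hR0 : 0 < R := Nat.pow_pos hB
  -- The first sort compacts the points, since copying keeps only records in front. The final mask
  -- keeps the first copy of each point, where the minimum over all its copies is collected.
  refine ⟨fun s x => mask (R * B) 0 x (nearestScan B n (L (Nat.rec (fun x => S s (spread B n x))
    (fun _ s' => replicateStep B n s') T)) T x), ?_, ?_⟩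
  · have := (((((hS₁.comp realizable_spread).comp (realizable_replicate hb T)).comp hL).comp
      (realizable_nearestScan hB hn0 hb T)).comp (realizable_mask (m := R * B) (t := 0)))
    rwa [show D + 1 + T * 2 + (1 + D + 1 + U * 2 + 1 + D + 1) + T * 2 + 1 =
      3 * D + 4 * T + 2 * U + 6 by ring] at this
  intro Q H α s₀ m hHQ hQ hs₀ hkeys
  set s₁ := S s₀ with hs₁
  set s₃ : ℕ → Item w d := Nat.rec (fun x => s₁ (spread B n x))
    (fun _ s' => replicateStep B n s') T with hs₃
  set s₄ := L s₃ with hs₄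
  set s₅ := nearestScan B n s₄ T with hs₅
  have hw₁ : window s₁ 0 (n * B) =
      Q.val.map (inputItem w H) + Multiset.replicate m (Item.blank 0) :=
    (hS₁' s₀).2.trans hs₀
  have hsort := (hS₁' s₀).1
  have hnN : n ≤ n * B := Nat.le_mul_of_pos_right n hB
  have hn₀n : n₀ ≤ n := (Nat.le_mul_of_pos_right n₀ hR0).trans hn₀
  have h3 : ∀ y, s₃ (y * B) = s₁ (y / R) := fun y => by
    have := replicate_apply (n := n) hB (fun x => s₁ (spread B n x)) T y
    simp only [spread_mul hB] at this
    exact this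
  have hblank : ∀ x < n * B, n₀ ≤ x → s₁ x = Item.blank 0 := fun x hx hx' =>
    eq_blank_of_card_le hw₁ hsort hx (hQ.trans hx')
  have hcand : ∀ x < n * B, ∀ h, (s₁ x).cand = some h → h ∈ H ∧ x < n₀ := by
    intro x hx h hh
    have hlt : x < n₀ := by
      by_contra hge
      rw [hblank x hx (not_lt.1 hge)] at hh
      simp [Item.blank] at hh
    refine ⟨?_, hlt⟩
    rcases eq_blank_or_inputItem hw₁ hx with e | ⟨q, -, e⟩
    · rw [e] at hh
      simp [Item.blank] at hh
    · by_cases hq : q ∈ H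
      · rw [e, inputItem_of_mem hq] at hh
        simp only [Option.some.injEq] at hh
        exact hh ▸ hq
      · rw [e, inputItem_of_notMem hq] at hh
        simp at hh
  have hpt : ∀ x < n * B, ∀ q, (s₁ x).pt = some q → q ∈ Q ∧ q ∉ H ∧ (s₁ x).cand = none ∧
      x < n₀ := by
    intro x hx q hq
    have hlt : x < n₀ := by
      by_contra hge
      rw [hblank x hx (not_lt.1 hge)] at hq
      simp [Item.blank] at hq
    rcases eq_blank_or_inputItem hw₁ hx with e | ⟨q', hq', e⟩
    · rw [e] at hq
      simp [Item.blank] at hq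
    · by_cases hqH : q' ∈ H
      · rw [e, inputItem_of_mem hqH] at hq
        simp at hq
      · rw [e, inputItem_of_notMem hqH] at hq ⊢
        simp only [Option.some.injEq] at hq
        subst hq
        exact ⟨hq', hqH, rfl, hlt⟩
  have hex : ∀ h ∈ H, ∃ x < n * B, (s₁ x).cand = some h := by
    intro h hh
    have : inputItem w H h ∈ window s₁ 0 (n * B) := by
      rw [hw₁]
      exact Multiset.mem_add.2 (.inl (Multiset.mem_map_of_mem _ (hHQ hh)))
    obtain ⟨x, hx, e⟩ := mem_window.1 this
    rw [zero_add, inputItem_of_mem hh] at e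
    exact ⟨x, hx, by rw [e]⟩
  have hdiv : ∀ y < n, y / R < n := fun y hy => lt_of_le_of_lt (Nat.div_le_self y R) hy
  have h4pt : ∀ y < n, (s₄ (y * B)).pt = (s₁ (y / R)).pt := fun y hy => by
    rw [(hL' s₃ y hy).1, h3]
  have hmain : ∀ z < n₀, ∀ q, (s₁ z).pt = some q → ∃ h ∈ H,
      (s₅ (z * R * B)).cand = some h ∧
        dist q h < α * Metric.infDist q (H : Set (EuclideanSpace ℝ (Fin d))) := by
    intro z hz q hq
    obtain ⟨hqQ, hqH, hqc, -⟩ := hpt z (by omega) q hq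
    have hzR : z * R + R ≤ n := by
      have : (z + 1) * R ≤ n₀ * R := Nat.mul_le_mul_right R hz
      rw [Nat.add_mul, one_mul] at this
      omega
    have hzdiv : ∀ y, z * R ≤ y → y < z * R + R → y / R = z := fun y h1 h2 => by
      obtain ⟨c, rfl⟩ := Nat.exists_eq_add_of_le h1
      exact slot_div (by omega)
    obtain ⟨-, hN1, hN2⟩ := nearestScan_spec (n := n) hB s₄ T q (z * R) hzR fun y h1 h2 => by
      rw [h4pt y (by omega), hzdiv y h1 h2, hq]
    -- The numbers of the records depend on the initial placement; this is why `KeysNear` quantifies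
    -- over all numberings `hub` and all `z`.
    obtain ⟨c, hc, ⟨y', h', hy', hk'⟩, hnear⟩ := hkeys q hqQ hqH
      (fun x => if x < n₀ then (s₁ x).cand else none)
      (fun x h hx => by
        split_ifs at hx with hxn
        exact ⟨(hcand x (by omega) h hx).1, hxn⟩)
      (fun h hh => by
        obtain ⟨x, hx, hxh⟩ := hex h hh
        exact ⟨x, by rw [if_pos (hcand x hx h hxh).2, hxh]⟩) z
    split_ifs at hy' with hyn
    have hy'n : y' < n := by
      have := (Nat.div_lt_iff_lt_mul hR0).1 hyn
      omega
    have hzc : (z * R + c) / R = z := slot_div hc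
    obtain ⟨y'', hy'', h'', hh'', hk'', hc''⟩ := (hL' s₃ (z * R + c) (by omega)).2.2 q y' h'
      (by rw [h3, hzc, hq]) (by rw [h3, hzc, hqc]) hy'n (by rw [h3, hy']) hk'
    rw [h3] at hh''
    have hy''R := hcand _ (by have := hdiv y'' hy''; omega) _ hh''
    have hd := hnear y'' h'' (by rw [if_pos hy''R.2, hh'']) hk''
    -- The other copies may have found remote hubs, but the minimum is at least as good as what copy
    -- `c` has found.
    obtain ⟨h, hh, hle⟩ := hN2 (z * R + c) h'' (by omega) (by omega) hc''
    obtain ⟨v, hv1, hv2, hv3⟩ := hN1 h hh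
    obtain ⟨u, hu, huh⟩ := (hL' s₃ v (by omega)).2.1 h hv3
    rw [h3] at huh
    exact ⟨h, (hcand _ (by have := hdiv u hu; omega) _ huh).1, hh, hle.trans_lt hd⟩
  set s₆ : ℕ → Item w d := fun x => mask (R * B) 0 x (s₅ x) with hs₆
  change ∃ close : EuclideanSpace ℝ (Fin d) → EuclideanSpace ℝ (Fin d), _ ∧
    (∀ x < n * B, ∀ q, (s₆ x).pt = some q → (s₆ x).cand = some (close q)) ∧
    (Multiset.range (n * B)).filterMap (fun x => (s₆ x).pt) = _
  have h6 : ∀ z, s₆ (z * (R * B)) = s₅ (z * R * B) := fun z => by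
    simp only [hs₆, mask, Nat.dvd_mul_left, if_true, mul_assoc]
  have h6' : ∀ x, ¬ R * B ∣ x → (s₆ x).pt = none := fun x hx => by
    simp only [hs₆, mask, hx, if_false, Item.blank]
  obtain ⟨n', hn'⟩ : R ∣ n := hn ▸ Nat.pow_dvd_pow B hTU
  rw [mul_comm] at hn'
  have hN : n * B = n' * (R * B) := by rw [hn', mul_assoc]
  have hn₀n' : n₀ ≤ n' := le_of_mul_le_mul_right (hn₀.trans_eq hn') hR0
  have hzn : ∀ z < n', z * R < n := fun z hz => by
    rw [hn']
    exact Nat.mul_lt_mul_of_pos_right hz hR0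
  have h6pt : ∀ z < n', (s₆ (z * (R * B))).pt = (s₁ z).pt := fun z hz => by
    rw [h6, hs₅, nearestScan_pt hB s₄ T (hzn z hz), h4pt _ (hzn z hz), Nat.mul_div_cancel _ hR0]
  have hfm : (Multiset.range (n * B)).filterMap (fun x => (s₆ x).pt) =
      (Q.filter fun q => q ∉ H).val := by
    rw [← filterMap_pt_eq hw₁]
    have e : ∀ f : ℕ → Option (EuclideanSpace ℝ (Fin d)),
        (Multiset.range (n * B)).filterMap f = (window f 0 (n * B)).filterMap id := fun f => by
      rw [window, Multiset.filterMap_map]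
      simp
    -- With the multiples of `R * B` listed first, the surviving query points are, place by place,
    -- those of the compacted input.
    rw [e, e, hN, ← window_spread]
    congr 1
    refine window_congr fun z hz => ?_
    rw [zero_add]
    rcases spread_le hz with ⟨h1, h2⟩ | ⟨h1, h2⟩
    · rw [h2, h6pt z h1]
    · rw [h6' _ h2, hblank z (by omega) (by omega)]
      rfl
  have hnodup : ((Multiset.range (n * B)).filterMap fun x => (s₆ x).pt).Nodup := by
    rw [hfm]
    exact Finset.nodup _
  have hx6 : ∀ x < n * B, ∀ q, (s₆ x).pt = some q → ∃ h ∈ H, (s₆ x).cand = some h ∧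
      dist q h < α * Metric.infDist q (H : Set (EuclideanSpace ℝ (Fin d))) := by
    intro x hx q hq
    by_cases hd : R * B ∣ x
    · obtain ⟨z, rfl⟩ := hd
      rw [mul_comm] at hx hq ⊢
      have hz : z < n' := by
        rw [hN] at hx
        exact lt_of_mul_lt_mul_right hx (Nat.zero_le _)
      rw [h6pt z hz] at hq
      rw [h6]
      have := hzn z hz
      have hzle : z ≤ z * R := Nat.le_mul_of_pos_right z hR0
      exact hmain z (hpt z (by omega) q hq).2.2.2 q hq
    · rw [h6' x hd] at hq
      simp at hq
  choose! g hgH hgc hgd using hx6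
  -- The hub must be a function of the point rather than of the slot. Since no query survives in two
  -- slots, the slot is determined by the point.
  set idx : EuclideanSpace ℝ (Fin d) → ℕ := fun q =>
    if h : ∃ x < n * B, (s₆ x).pt = some q then h.choose else 0 with hidx
  have hidx' : ∀ x < n * B, ∀ q, (s₆ x).pt = some q → idx q = x := by
    intro x hx q hq
    have h : ∃ x < n * B, (s₆ x).pt = some q := ⟨x, hx, hq⟩
    have h1 : idx q = h.choose := dif_pos h
    rw [h1]
    exact eq_of_nodup_filterMap hnodup h.choose_spec.1 hx h.choose_spec.2 hq
  refine ⟨fun q => g (idx q) q, fun q hqQ hqH => ?_, fun x hx q hq => ?_, hfm⟩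
  · have : q ∈ (Multiset.range (n * B)).filterMap fun x => (s₆ x).pt := by
      rw [hfm]
      exact Finset.mem_filter.2 ⟨hqQ, hqH⟩
    obtain ⟨x, hx, hxq⟩ := (Multiset.mem_filterMap _ _).1 this
    have hx := Multiset.mem_range.1 hx
    simp only [hidx' x hx q hxq]
    exact ⟨hgH x hx q hxq, hgd x hx q hxq⟩
  · simp only [hidx' x hx q hq]
    exact hgc x hx q hq

end ObliviousMPC

/-! ### From the search on slots to an MPC algorithm. -/

namespace ObliviousMPC

open MPCAlgorithm

/-- The compiled algorithms ignore their random words, so this is the only fact about probability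
that is needed. -/
theorem prob_eq_one (A : MPCAlgorithm) {p : A.Coins → Prop} (h : ∀ ω, p ω) : A.prob p = 1 := by
  have h1 : Nat.card {ω : A.Coins // p ω} = Nat.card A.Coins :=
    Nat.card_congr (Equiv.subtypeUnivEquiv h)
  have h2 : Nat.card A.Coins ≠ 0 := Nat.card_ne_zero.2 ⟨⟨fun _ _ _ => 0⟩, inferInstance⟩
  rw [prob, h1, div_self (by exact_mod_cast h2)]

theorem filterMap_range_mul {α : Type*} (f : ℕ → Option α) (b M : ℕ) :
    (Multiset.range (M * b)).filterMap f =
      ∑ i : Fin M, (((List.range b).filterMap fun k => f (i * b + k) : List α) : Multiset α) := by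
  rw [← Finset.sum_range fun i => (((List.range b).filterMap fun k => f (i * b + k) : List α) :
    Multiset α)]
  induction M with
  | zero => simp
  | succ M ih =>
    rw [Nat.succ_mul, Multiset.range_add, Multiset.filterMap_add, ih, Finset.sum_range_succ,
      Multiset.filterMap_map]
    congr 1

variable {w d b M : ℕ}

theorem map_ofInputList {l : List (EuclideanSpace ℝ (Fin d) × Bool)} (hl : l.length ≤ b) :
    (Multiset.range b).map (Item.ofInputList l : ℕ → Item w d) =
      ((l.map Item.ofInput : List (Item w d)) : Multiset (Item w d)) +
        Multiset.replicate (b - l.length) (Item.blank 0) := by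
  obtain ⟨e, rfl⟩ := Nat.exists_eq_add_of_le hl
  rw [Multiset.range_add, Multiset.map_add, Nat.add_sub_cancel_left]
  congr 1
  · rw [Multiset.range, Multiset.map_coe]
    congr 1
    refine List.ext_getElem (by simp) fun i h1 h2 => ?_
    simp only [List.length_map] at h2
    simp [Item.ofInputList, h2]
  · rw [Multiset.map_map, Multiset.eq_replicate]
    refine ⟨by simp, fun a ha => ?_⟩
    obtain ⟨x, -, rfl⟩ := Multiset.mem_map.1 ha
    simp [Item.ofInputList]

open Classical in
/-- The input of a machine. -/
noncomputable def placeInput (H : Finset (EuclideanSpace ℝ (Fin d)))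
    (place : Fin M → List (EuclideanSpace ℝ (Fin d))) (i : ℕ) :
    List (EuclideanSpace ℝ (Fin d) × Bool) :=
  if h : i < M then (place ⟨i, h⟩).map fun q => (q, decide (q ∈ H)) else []

theorem length_placeInput {H : Finset (EuclideanSpace ℝ (Fin d))}
    {place : Fin M → List (EuclideanSpace ℝ (Fin d))} (h : ∀ i, (place i).length ≤ b) (i : ℕ) :
    (placeInput H place i).length ≤ b := by
  unfold placeInput
  split_ifs
  · simpa using h _
  · simp

theorem window_inputSlots {Q H : Finset (EuclideanSpace ℝ (Fin d))}
    {place : Fin M → List (EuclideanSpace ℝ (Fin d))} (h : ∀ i, (place i).length ≤ b)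
    (hQ : ∑ i, (place i : Multiset (EuclideanSpace ℝ (Fin d))) = Q.val) :
    ∃ m, window (inputSlots b (placeInput H place)) 0 (M * b) =
      Q.val.map (inputItem w H) + Multiset.replicate m (Item.blank 0) := by
  refine ⟨∑ i : Fin M, (b - (placeInput H place i).length), ?_⟩
  have h1 : ∀ i : Fin M, window (inputSlots b (placeInput H place) : ℕ → Item w d) (0 + i * b) b =
      (place i : Multiset (EuclideanSpace ℝ (Fin d))).map (inputItem w H) +
        Multiset.replicate (b - (placeInput H place i).length) (Item.blank 0) := by
    intro i
    have h2 : window (inputSlots b (placeInput H place) : ℕ → Item w d) (0 + i * b) b =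
        (Multiset.range b).map (Item.ofInputList (placeInput H place i)) := by
      refine Multiset.map_congr rfl fun u hu => ?_
      have hu := Multiset.mem_range.1 hu
      rw [zero_add, inputSlots, slot_div hu, mul_comm (i : ℕ), Nat.mul_add_mod,
        Nat.mod_eq_of_lt hu]
    rw [h2, map_ofInputList (length_placeInput h i)]
    congr 1
    simp only [placeInput, i.2, dif_pos, List.map_map, Multiset.map_coe]
    rfl
  rw [window_mul, Finset.sum_range, Finset.sum_congr rfl fun i _ => h1 i, Finset.sum_add_distrib]
  congr 1
  · rw [← hQ]
    exact (map_sum (Multiset.mapAddMonoidHom (inputItem w H))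
      (fun i => (place i : Multiset (EuclideanSpace ℝ (Fin d)))) _).symm
  · exact (map_sum (Multiset.replicateAddMonoidHom (Item.blank 0 : Item w d)) _ _).symm

theorem flatMap_outWords {l : List ℕ} {s : ℕ → Item w d}
    {close : EuclideanSpace ℝ (Fin d) → EuclideanSpace ℝ (Fin d)}
    (h : ∀ k ∈ l, ∀ q, (s k).pt = some q → (s k).cand = some (close q)) :
    (l.flatMap fun k => (s k).outWords) =
      (l.filterMap fun k => (s k).pt).flatMap fun q => pointWords q ++ pointWords (close q) := by
  induction l with
  | nil => rfl
  | cons k l ih =>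
    have ih := ih fun k' hk' => h k' (List.mem_cons_of_mem _ hk')
    have hk := h k List.mem_cons_self
    rw [List.flatMap_cons, ih]
    cases e : (s k).pt with
    | none => simp [Item.outWords, e]
    | some q => simp [Item.outWords, e, hk q e]

/-- An oblivious algorithm as an MPC algorithm. -/
theorem exists_compiled {r : ℕ} (hw : 1 ≤ w) {Φ : (ℕ → Item w d) → ℕ → Item w d}
    (hΦ : Realizable (M * b) b r Φ) :
    ∃ A : MPCAlgorithm, A.machines = M ∧ A.localSpace = b * (2 * d + 3) ∧ A.wordBits = w ∧
      A.rounds = r + 2 ∧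
      ∀ (Q H : Finset (EuclideanSpace ℝ (Fin d))) (cap : ℕ)
        (place : Fin A.machines → List (EuclideanSpace ℝ (Fin d))), cap ≤ b →
        A.IsPlacement Q cap place →
        A.RespectsSpace (A.initial H place) ∧
        ∃ (s : ℕ → Item w d) (m : ℕ),
          window s 0 (M * b) =
            Q.val.map (inputItem w H) + Multiset.replicate m (Item.blank 0) ∧
          ∀ (a : ℝ) (close : EuclideanSpace ℝ (Fin d) → EuclideanSpace ℝ (Fin d)),
            (∀ q ∈ Q, q ∉ H → close q ∈ H ∧
              dist q (close q) < a * Metric.infDist q (H : Set (EuclideanSpace ℝ (Fin d)))) →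
            (∀ x < M * b, ∀ q, (Φ s x).pt = some q → (Φ s x).cand = some (close q)) →
            (Multiset.range (M * b)).filterMap (fun x => (Φ s x).pt) =
              (Q.filter fun q => q ∉ H).val →
            ∀ ω, A.HoldsNearHubs Q H a (A.configAt ω (A.initial H place) A.rounds) := by
  obtain ⟨l, rfl, hl⟩ := hΦ
  refine ⟨compile l, rfl, rfl, rfl, rfl, fun Q H cap place hcap hplace => ?_⟩
  change Fin M → List (EuclideanSpace ℝ (Fin d)) at place
  have hlen : ∀ i, (place i).length ≤ b := fun i => (hplace.1 i).trans hcap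
  have hm : ∀ i : Fin M, (compile l).initial H place i =
      (placeInput H place i).flatMap inputWords := by
    intro i
    simp only [initial, placeInput, i.2, dif_pos, List.flatMap_map, inputWords, decide_eq_true_eq]
  refine ⟨compile_respectsSpace l (placeInput H place) hw (fun i _ => length_placeInput hlen i) _ hm,
    inputSlots b (placeInput H place), ?_⟩
  obtain ⟨m, hwin⟩ := window_inputSlots (w := w) (H := H) hlen hplace.2
  refine ⟨m, hwin, fun a close hclose hcand hpt ω => ?_⟩
  have hrun : runRounds l (inputSlots b (placeInput H place)) l.length =
      Φ (inputSlots b (placeInput H place)) := by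
    rw [runRounds, List.take_length, hl]
  set s := Φ (inputSlots b (placeInput H place)) with hs
  refine ⟨close, fun q hq => ?_, fun i : Fin M => (List.range b).filterMap fun k => (s (i * b + k)).pt,
    fun i : Fin M => ?_, ?_⟩
  · rw [Finset.mem_sdiff] at hq
    exact hclose q hq.1 hq.2
  · refine (compile_configAt_rounds l (placeInput H place) hw ω _ hm i).trans ?_
    rw [hrun]
    refine flatMap_outWords (s := fun k => s (i * b + k)) fun k hk q hq => ?_
    exact hcand _ (slot_lt i.2 (List.mem_range.1 hk)) q hq
  · refine (filterMap_range_mul (fun x => (s x).pt) b M).symm.trans ?_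
    rw [hpt, Finset.sdiff_eq_filter]

/-- The nearest hub search with given key functions and parameters. -/
theorem exists_algorithm {B k U T n₀ : ℕ} (hB : 2 ≤ B) (hk : 3 ≤ k) (hkU : k ≤ U)
    (hTU : T ≤ U) (hn₀ : n₀ * B ^ T ≤ B ^ U) (hwU : B ^ U < 2 ^ w)
    (kh kq : ℕ → EuclideanSpace ℝ (Fin d) → ℕ) :
    ∃ A : MPCAlgorithm, A.machines = B ^ (U + 1 - k) ∧ A.localSpace = B ^ k * (2 * d + 3) ∧
      A.wordBits = w ∧ A.rounds = 3 * sortRounds (U + 1 - k) + 4 * T + 2 * U + 8 ∧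
      ∀ (Q H : Finset (EuclideanSpace ℝ (Fin d))) (cap : ℕ) (a : ℝ)
        (place : Fin A.machines → List (EuclideanSpace ℝ (Fin d))), H ⊆ Q → Q.card ≤ n₀ →
        cap ≤ B ^ k → A.IsPlacement Q cap place →
        A.RespectsSpace (A.initial H place) ∧
        ((∀ q ∈ Q, q ∉ H → KeysNear n₀ (B ^ T) kh kq H a q) →
          ∀ ω, A.HoldsNearHubs Q H a (A.configAt ω (A.initial H place) A.rounds)) := by
  have hw : 1 ≤ w := by
    rcases Nat.eq_zero_or_pos w with rfl | h
    · have : 0 < B ^ U := Nat.pow_pos (by omega)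
      omega
    · exact h
  -- There are `B ^ U` records with `B` slots each, cut into memories of `B ^ k` slots.
  have hN : B ^ U * B = B ^ (U + 1 - k) * B ^ k := by
    rw [← pow_succ, ← pow_add, Nat.sub_add_cancel (by omega)]
  have hS : HasSorter w d (B ^ U * B) (B ^ k) (sortRounds (U + 1 - k)) := fun key => by
    rw [← pow_succ]
    exact exists_full_sorter key hB hk (by omega)
  obtain ⟨Φ, hΦ, hspec⟩ := exists_pipeline hS (by omega) rfl (dvd_pow_self B (by omega)) hwU hTU hn₀
    kh kq
  rw [hN] at hΦ hspec
  obtain ⟨A, h1, h2, h3, h4, h5⟩ := exists_compiled hw hΦ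
  refine ⟨A, h1, h2, h3, by rw [h4], fun Q H cap a place hHQ hQ hcap hplace => ?_⟩
  obtain ⟨h6, s, m, h7, h8⟩ := h5 Q H cap place hcap hplace
  refine ⟨h6, fun hkeys => ?_⟩
  obtain ⟨close, h9, h10, h11⟩ := hspec Q H a s m hHQ hQ h7 hkeys
  exact h8 a close h9 h10 h11

end ObliviousMPC

/-! ### Keys from ranks and from grids. -/

namespace ObliviousMPC

variable {d : ℕ}

theorem exists_infDist_eq {H : Finset (EuclideanSpace ℝ (Fin d))} (hH : H.Nonempty)
    (q : EuclideanSpace ℝ (Fin d)) :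
    ∃ h ∈ H, Metric.infDist q (H : Set (EuclideanSpace ℝ (Fin d))) = dist q h := by
  obtain ⟨h, hh, e⟩ := H.finite_toSet.isCompact.exists_infDist_eq_dist hH q
  exact ⟨h, hh, e⟩

/-- With the ranks of the hubs as keys, every copy of a query finds another hub. -/
theorem keysNear_rank {n R : ℕ} (hnR : n ≤ R) {H : Finset (EuclideanSpace ℝ (Fin d))}
    (hH : H.Nonempty) {q : EuclideanSpace ℝ (Fin d)} (hq : ∀ h ∈ H, 1 ≤ dist q h) :
    KeysNear n R (fun y _ => y / R) (fun y _ => y % R) H 4 q := by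
  intro hub hub1 hub2 z
  obtain ⟨h, hh, e⟩ := exists_infDist_eq hH q
  obtain ⟨x, hx⟩ := hub2 h hh
  have hxR : x < R := (hub1 x h hx).2.trans_le hnR
  have hmod : (z * R + x) % R = x := by
    rw [mul_comm, Nat.mul_add_mod, Nat.mod_eq_of_lt hxR]
  have hR : 0 < R := by omega
  refine ⟨x, hxR, ⟨x * R, h, ?_, ?_⟩, fun y h' hy hk => ?_⟩
  · rwa [Nat.mul_div_cancel _ hR]
  · simp only [hmod, Nat.mul_div_cancel _ hR]
  · simp only [hmod] at hk
    rw [hk, hx] at hy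
    obtain rfl : h = h' := Option.some.inj hy
    have := hq h hh
    rw [e]
    linarith

/-- The grid cell of side `2 ^ i / (d + 1)` that contains a point. -/
noncomputable def cell (i : ℕ) (x : EuclideanSpace ℝ (Fin d)) (k : Fin d) : ℤ :=
  ⌊x k * (d + 1) / 2 ^ i⌋

theorem abs_sub_apply_le_dist (x y : EuclideanSpace ℝ (Fin d)) (k : Fin d) :
    |x k - y k| ≤ dist x y := by
  rw [dist_eq_norm]
  exact PiLp.norm_apply_le (x - y) k

/-- A cube of side `2 ^ i / (d + 1)` has diameter `√d * 2 ^ i / (d + 1) ≤ 2 ^ i`. Dividing by `d +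
1` instead of `√d` avoids roots and the case `d = 0`. -/
theorem dist_le_of_cell_eq {i : ℕ} {x y : EuclideanSpace ℝ (Fin d)} (h : cell i x = cell i y) :
    dist x y ≤ 2 ^ i := by
  have hp : (0 : ℝ) < 2 ^ i := by positivity
  have hd : (0 : ℝ) < d + 1 := by positivity
  have hk : ∀ k, (x k - y k) ^ 2 ≤ (2 ^ i / (d + 1)) ^ 2 := by
    intro k
    have h1 := Int.abs_sub_lt_one_of_floor_eq_floor (congrFun h k)
    rw [← sub_div, ← sub_mul, abs_div, abs_mul, abs_of_pos hp, abs_of_pos hd,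
      div_lt_one hp, ← lt_div_iff₀ hd] at h1
    exact sq_le_sq' (by linarith [neg_abs_le (x k - y k)]) ((le_abs_self _).trans h1.le)
  rw [EuclideanSpace.dist_eq, Real.sqrt_le_left hp.le]
  calc ∑ k, dist (x k) (y k) ^ 2 ≤ ∑ _k : Fin d, ((2 : ℝ) ^ i / (d + 1)) ^ 2 :=
        Finset.sum_le_sum fun k _ => by rw [Real.dist_eq, sq_abs]; exact hk k
    _ = d * ((2 : ℝ) ^ i / (d + 1)) ^ 2 := by simp
    _ ≤ (d + 1) ^ 2 * ((2 : ℝ) ^ i / (d + 1)) ^ 2 := by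
        refine mul_le_mul_of_nonneg_right ?_ (by positivity)
        nlinarith [Nat.cast_nonneg (α := ℝ) d]
    _ = (2 ^ i) ^ 2 := by field_simp

/-- The rescaled coordinates differ by less than `2 * d + 2`, so their floors differ by less than `2
* d + 3`. -/
theorem abs_cell_sub_le {i : ℕ} {x y : EuclideanSpace ℝ (Fin d)} (h : dist x y < 2 ^ (i + 1))
    (k : Fin d) : |cell i x k - cell i y k| ≤ 2 * d + 2 := by
  have hp : (0 : ℝ) < 2 ^ i := by positivity
  have h1 : |x k * (d + 1) / 2 ^ i - y k * (d + 1) / 2 ^ i| < 2 * d + 2 := by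
    rw [← sub_div, ← sub_mul, abs_div, abs_mul, abs_of_pos hp,
      abs_of_pos (by positivity : (0 : ℝ) < d + 1), div_lt_iff₀ hp]
    calc |x k - y k| * (d + 1) < 2 ^ (i + 1) * (d + 1) :=
          mul_lt_mul_of_pos_right ((abs_sub_apply_le_dist x y k).trans_lt h) (by positivity)
      _ = _ := by ring
  unfold cell
  set u := x k * (d + 1) / 2 ^ i
  set v := y k * (d + 1) / 2 ^ i
  have hu := Int.floor_le u
  have hu' := Int.lt_floor_add_one u
  have hv := Int.floor_le v
  have hv' := Int.lt_floor_add_one v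
  rw [abs_lt] at h1
  have h2 : ((⌊u⌋ - ⌊v⌋ : ℤ) : ℝ) < ((2 * d + 2 + 1 : ℤ) : ℝ) := by push_cast; linarith
  have h3 : (((-(2 * d + 2 + 1)) : ℤ) : ℝ) < ((⌊u⌋ - ⌊v⌋ : ℤ) : ℝ) := by push_cast; linarith
  have h2 := Int.cast_lt.1 h2
  have h3 := Int.cast_lt.1 h3
  rw [abs_le]
  constructor <;> omega

/-- The differences between neighbouring cells. -/
noncomputable def offsets (d : ℕ) : Finset (Fin d → ℤ) :=
  Fintype.piFinset fun _ => Finset.Icc (-(2 * d + 2 : ℤ)) (2 * d + 2)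

/-- An enumeration of the differences between neighbouring cells. -/
noncomputable def offset (d j : ℕ) : Fin d → ℤ :=
  if h : j < (offsets d).card then ((offsets d).equivFin.symm ⟨j, h⟩ : Fin d → ℤ) else 0

theorem exists_offset_eq {v : Fin d → ℤ} (h : ∀ k, |v k| ≤ 2 * d + 2) :
    ∃ j < (offsets d).card, offset d j = v := by
  have hv : v ∈ offsets d :=
    Fintype.mem_piFinset.2 fun k => Finset.mem_Icc.2 (abs_le.1 (h k))
  refine ⟨(offsets d).equivFin ⟨v, hv⟩, Fin.is_lt _, ?_⟩
  unfold offset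
  rw [dif_pos (Fin.is_lt _)]
  simp

/-- The cell of a hub at the scale of its copy. -/
noncomputable def gridHubKey (d R y : ℕ) (h : EuclideanSpace ℝ (Fin d)) : ℕ :=
  Encodable.encode (y % R / (offsets d).card, cell (y % R / (offsets d).card) h)

/-- A cell next to that of a query at the scale of its copy. -/
noncomputable def gridQueryKey (d R y : ℕ) (q : EuclideanSpace ℝ (Fin d)) : ℕ :=
  Encodable.encode (y % R / (offsets d).card,
    cell (y % R / (offsets d).card) q + offset d (y % R % (offsets d).card))

/-- The copy number `i * K + j` stands for scale `i` and offset `j`. The successful copy has the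
scale of `d(q, H)` and the offset that leads from the cell of `q` to that of its nearest hub. -/
theorem keysNear_grid {n R : ℕ} {Δ : ℝ} (hR : (⌊Real.logb 2 Δ⌋₊ + 1) * (offsets d).card ≤ R)
    {H : Finset (EuclideanSpace ℝ (Fin d))} (hH : H.Nonempty) {q : EuclideanSpace ℝ (Fin d)}
    (hq : ∀ h ∈ H, 1 ≤ dist q h ∧ dist q h ≤ Δ) :
    KeysNear n R (gridHubKey d R) (gridQueryKey d R) H 4 q := by
  intro hub hub1 hub2 z
  obtain ⟨h, hh, e⟩ := exists_infDist_eq hH q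
  obtain ⟨x, hx⟩ := hub2 h hh
  obtain ⟨h1, hΔ⟩ := hq h hh
  obtain ⟨i, hi1, hi2⟩ := exists_nat_pow_near h1 one_lt_two
  have hi : i ≤ ⌊Real.logb 2 Δ⌋₊ := by
    refine Nat.le_floor ?_
    rw [Real.le_logb_iff_rpow_le one_lt_two (by linarith), Real.rpow_natCast]
    exact hi1.trans hΔ
  obtain ⟨j, hj, hje⟩ := exists_offset_eq (v := cell i h - cell i q)
    fun k => abs_cell_sub_le (by rwa [dist_comm]) k
  set K := (offsets d).card with hK
  have hc : i * K + j < R := by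
    refine lt_of_lt_of_le ?_ hR
    calc i * K + j < (i + 1) * K := by rw [Nat.add_mul]; omega
      _ ≤ _ := Nat.mul_le_mul_right K (by omega)
  have hmod : ∀ y, (y * R + (i * K + j)) % R = i * K + j := fun y => by
    rw [mul_comm y, Nat.mul_add_mod, Nat.mod_eq_of_lt hc]
  have hKdiv : (i * K + j) / K = i := slot_div hj
  have hKmod : (i * K + j) % K = j := by
    rw [mul_comm, Nat.mul_add_mod, Nat.mod_eq_of_lt hj]
  have hkq : gridQueryKey d R (z * R + (i * K + j)) q = Encodable.encode (i, cell i h) := by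
    rw [gridQueryKey, hmod, hKdiv, hKmod, hje, add_sub_cancel]
  refine ⟨i * K + j, hc, ⟨x * R + (i * K + j), h, ?_, ?_⟩, fun y h' hy hk => ?_⟩
  · rwa [slot_div hc]
  · rw [hkq, gridHubKey, hmod, hKdiv]
  · rw [hkq, gridHubKey] at hk
    -- The key contains the scale, so cells of different grids are not confused. A hub in the cell
    -- of the nearest one is then at distance at most `dist q h + 2 ^ i ≤ 2 * dist q h`, which is
    -- less than `4 * dist q h` as `1 ≤ dist q h`.
    have hk := Encodable.encode_injective hk
    simp only [Prod.mk.injEq] at hk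
    obtain ⟨hk1, hk2⟩ := hk
    rw [hk1] at hk2
    have h2 := dist_le_of_cell_eq hk2
    have h3 := dist_triangle q h h'
    rw [dist_comm h h'] at h3
    rw [e]
    linarith

end ObliviousMPC

/-! ### Choice of the parameters. -/

namespace ObliviousMPC

theorem sortRounds_mono : Monotone sortRounds :=
  monotone_nat_of_le_succ fun i => by rw [sortRounds]; omega

theorem exists_pow_between {B X : ℕ} (hB : 2 ≤ B) (hX : 1 ≤ X) :
    ∃ T, X ≤ B ^ T ∧ B ^ T ≤ B * X := by
  refine ⟨Nat.log B X + 1, (Nat.lt_pow_succ_log_self (by omega) X).le, ?_⟩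
  rw [pow_succ']
  exact Nat.mul_le_mul_left B (Nat.pow_log_le_self B (by omega))

/-- The binary logarithm of a number that is polynomial in `n` and `log Δ`. -/
theorem natLog_succ_le {n Δ : ℝ} {E V : ℕ} (hn : 2 ≤ n) (hΔ : 2 ≤ Δ) (hV : 0 < V)
    (h : (V : ℝ) ≤ 2 ^ E * (n ^ 2 * (n * Real.log Δ))) :
    ((Nat.log 2 V + 1 : ℕ) : ℝ) ≤
      ((1 + E) / Real.log (2 * Real.log 2) + 7 / Real.log 2) * Real.log (n * Real.log Δ) := by
  have hlog2 : (0.69 : ℝ) < Real.log 2 := by linarith [Real.log_two_gt_d9]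
  have hlz : 0 < Real.log (2 * Real.log 2) := Real.log_pos (by linarith)
  have hlogΔ : Real.log 2 ≤ Real.log Δ := Real.log_le_log (by norm_num) hΔ
  have hn0 : 0 < n := by linarith
  generalize hZ : n * Real.log Δ = Z at h ⊢
  have hZ1 : 2 * Real.log 2 ≤ Z := by
    rw [← hZ]
    exact mul_le_mul hn hlogΔ (by linarith) hn0.le
  have hZn : 0.69 * n ≤ Z := by
    rw [← hZ, mul_comm]
    exact mul_le_mul_of_nonneg_left (by linarith) hn0.le
  have hZ0 : 0 < Z := by linarith
  -- Since `log 2 < 1`, `Z = n * log Δ` may be smaller than `n`; the cube makes up for this because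
  -- `0.69 ^ 3 * 4 > 1`.
  have hn3 : n ≤ Z ^ 3 := by
    have h1 : 4 ≤ n ^ 2 := by
      calc (4 : ℝ) = 2 ^ 2 := by norm_num
        _ ≤ n ^ 2 := pow_le_pow_left₀ (by norm_num) hn 2
    calc n = n * 1 := (mul_one n).symm
      _ ≤ n * (0.69 ^ 3 * n ^ 2) := mul_le_mul_of_nonneg_left (by linarith) hn0.le
      _ = (0.69 * n) ^ 3 := by ring
      _ ≤ Z ^ 3 := pow_le_pow_left₀ (by linarith) hZn 3
  have h3 : (2 : ℝ) ^ Nat.log 2 V ≤ 2 ^ E * Z ^ 7 := by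
    have h4 : ((2 ^ Nat.log 2 V : ℕ) : ℝ) ≤ V := Nat.cast_le.2 (Nat.pow_log_le_self 2 hV.ne')
    rw [Nat.cast_pow, Nat.cast_ofNat] at h4
    calc (2 : ℝ) ^ Nat.log 2 V ≤ 2 ^ E * (n ^ 2 * Z) := h4.trans h
      _ ≤ 2 ^ E * ((Z ^ 3) ^ 2 * Z) := by gcongr
      _ = _ := by ring
  have h5 := Real.log_le_log (by positivity) h3
  rw [Real.log_mul (by positivity) (by positivity), Real.log_pow, Real.log_pow,
    Real.log_pow] at h5
  have hlogZ : Real.log (2 * Real.log 2) ≤ Real.log Z := Real.log_le_log (by linarith) hZ1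
  have hl2 : 0 < Real.log 2 := by linarith
  have h6 : (Nat.log 2 V : ℝ) ≤ E + 7 / Real.log 2 * Real.log Z := by
    rw [← mul_le_mul_iff_left₀ hl2]
    refine h5.trans_eq ?_
    rw [add_mul, mul_right_comm, div_mul_cancel₀ _ hl2.ne', Nat.cast_ofNat]
  -- Additive constants are absorbed because `2 * log 2 > 1` keeps `log Z` away from 0.
  have h7 : (1 + (E : ℝ)) ≤ (1 + E) / Real.log (2 * Real.log 2) * Real.log Z := by
    rw [div_mul_eq_mul_div, le_div_iff₀ hlz]
    gcongr
  rw [add_mul, Nat.cast_succ]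
  linarith

/-- The parameters of the algorithm for `X` copies of every point. -/
theorem exists_parameters {ρ δ C₁ : ℝ} {k d : ℕ} (hδ : 0 < δ) (hδ1 : δ < 1)
    (hC₁ : 0 < C₁) (hk : 3 ≤ k) (hkρ : 3 / (k : ℝ) ≤ ρ) :
    ∃ C : ℝ, ∀ n : ℕ, 2 ≤ n → ∀ Δ : ℝ, 2 ≤ Δ → ∀ X : ℕ, 1 ≤ X → (X : ℝ) ≤ C₁ * Real.log Δ →
      (X : ℝ) ≤ C₁ * n → ∃ B U T w : ℕ, 2 ≤ B ∧ k ≤ U ∧ T ≤ U ∧ X ≤ B ^ T ∧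
        n * B ^ T ≤ B ^ U ∧ B ^ U < 2 ^ w ∧ ⌈(n : ℝ) ^ δ⌉₊ ≤ B ^ k ∧
        ((3 * sortRounds (U + 1 - k) + 4 * T + 2 * U + 8 : ℕ) : ℝ) ≤ C ∧
        ((B ^ k * (2 * d + 3) : ℕ) : ℝ) ≤ C * (n : ℝ) ^ δ ∧
        ((B ^ k * (2 * d + 3) : ℕ) : ℝ) * ((B ^ (U + 1 - k) : ℕ) : ℝ) ≤
          C * ((n : ℝ) ^ (1 + ρ) * Real.log n ^ 2 * Real.log Δ) ∧
        (w : ℝ) ≤ C * Real.log (n * Real.log Δ) ∧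
        n ≤ B ^ (U + 1 - k) * ⌈(n : ℝ) ^ δ⌉₊ := by
  -- As `2 ≤ n`, the constant factor `2 ^ (k + 2) * C₁` is at most `n ^ E`.
  obtain ⟨E, hE⟩ := pow_unbounded_of_one_lt (2 ^ (k + 2) * C₁) (one_lt_two : (1 : ℝ) < 2)
  set U₀ := ⌈(E + 4) * k / δ⌉₊ with hU₀
  have hlog2 : (0.69 : ℝ) < Real.log 2 := by linarith [Real.log_two_gt_d9]
  have hlz : 0 < Real.log (2 * Real.log 2) := Real.log_pos (by linarith)
  set Cr : ℝ := ((3 * sortRounds U₀ + 4 * U₀ + 2 * U₀ + 8 : ℕ) : ℝ) with hCr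
  set Cs : ℝ := (2 * d + 3) * 2 ^ k with hCs
  set Cg : ℝ := (2 * d + 3) * 2 ^ (k + 3) * C₁ / Real.log 2 ^ 2 with hCg
  set Cw : ℝ := (1 + E) / Real.log (2 * Real.log 2) + 7 / Real.log 2 with hCw
  have hCr0 : 0 ≤ Cr := Nat.cast_nonneg _
  have hCs0 : 0 ≤ Cs := by positivity
  have hCg0 : 0 ≤ Cg := by positivity
  have hCw0 : 0 ≤ Cw := by positivity
  refine ⟨Cr + Cs + Cg + Cw, fun n hn Δ hΔ X hX hX1 hX2 => ?_⟩
  have hn2 : (2 : ℝ) ≤ n := by exact_mod_cast hn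
  have hn0 : (0 : ℝ) < n := by linarith
  have hk0 : (0 : ℝ) < k := by exact_mod_cast (by omega : 0 < k)
  have hk3 : (3 : ℝ) ≤ k := by exact_mod_cast hk
  have hlogΔ : Real.log 2 ≤ Real.log Δ := Real.log_le_log (by norm_num) hΔ
  have hlogn : Real.log 2 ≤ Real.log n := Real.log_le_log (by norm_num) hn2
  set β : ℝ := (n : ℝ) ^ (δ / k) with hβ
  have hδk : 0 < δ / k := div_pos hδ hk0
  have hβ1 : 1 < β := Real.one_lt_rpow (by linarith) hδk
  have hβ0 : 0 < β := by linarith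
  have hβpow : ∀ j : ℕ, β ^ j = (n : ℝ) ^ (δ / k * j) := fun j => by
    rw [hβ, Real.rpow_mul hn0.le, Real.rpow_natCast]
  have hβk : β ^ k = (n : ℝ) ^ δ := by
    rw [hβpow, div_mul_cancel₀ _ hk0.ne']
  have hβ3 : β ^ 3 ≤ (n : ℝ) ^ ρ := by
    rw [hβpow]
    refine Real.rpow_le_rpow_of_exponent_le (by linarith) (le_trans ?_ hkρ)
    rw [div_mul_eq_mul_div]
    exact div_le_div_of_nonneg_right (by push_cast; linarith) hk0.le
  have hβn : β ≤ n := by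
    conv_rhs => rw [← Real.rpow_one (n : ℝ)]
    refine Real.rpow_le_rpow_of_exponent_le (by linarith) ?_
    rw [div_le_one hk0]
    linarith
  set B := ⌈β⌉₊ with hBdef
  have hBβ : β ≤ B := Nat.le_ceil β
  have hB2β : (B : ℝ) ≤ 2 * β := by linarith [Nat.ceil_lt_add_one hβ0.le]
  have hB : 2 ≤ B := by
    have : (1 : ℝ) < B := by linarith
    exact_mod_cast this
  have hB0 : (0 : ℝ) < B := by linarith
  have hBk : (B : ℝ) ^ k ≤ 2 ^ k * (n : ℝ) ^ δ := by
    rw [← hβk, ← mul_pow]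
    exact pow_le_pow_left₀ hB0.le hB2β k
  have hnδB : (n : ℝ) ^ δ ≤ (B : ℝ) ^ k := by
    rw [← hβk]
    exact pow_le_pow_left₀ hβ0.le hBβ k
  obtain ⟨T, hT1, hT2⟩ := exists_pow_between hB hX
  -- Rounding `B` up may enlarge the memory `B ^ k` to `2 ^ k * n ^ δ`. The same factor in the
  -- number of records leaves enough machines for every admissible input, and ensures `k ≤ U`.
  have hY1 : 1 ≤ 2 ^ k * n * B ^ T :=
    Nat.mul_pos (Nat.mul_pos (Nat.pow_pos two_pos) (by omega)) (Nat.pow_pos (by omega))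
  obtain ⟨U, hU1, hU2⟩ := exists_pow_between hB hY1
  have hUr : (B : ℝ) ^ U ≤ 2 ^ k * n * B ^ 2 * X := by
    have h1 : B ^ U ≤ 2 ^ k * n * B ^ 2 * X := by
      calc B ^ U ≤ B * (2 ^ k * n * B ^ T) := hU2
        _ ≤ B * (2 ^ k * n * (B * X)) := by gcongr
        _ = _ := by ring
    exact_mod_cast h1
  have hX0 : (0 : ℝ) < X := by exact_mod_cast hX
  have hB2 : (B : ℝ) ^ 2 ≤ 4 * n ^ 2 := by
    calc (B : ℝ) ^ 2 ≤ (2 * n) ^ 2 := pow_le_pow_left₀ hB0.le (by linarith) 2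
      _ = _ := by ring
  have hnδ1 : (n : ℝ) ^ δ ≤ n := by
    conv_rhs => rw [← Real.rpow_one (n : ℝ)]
    exact Real.rpow_le_rpow_of_exponent_le (by linarith) hδ1.le
  have hnU : 2 ^ k * n ≤ B ^ U := by
    refine le_trans ?_ hU1
    exact Nat.le_mul_of_pos_right _ (Nat.pow_pos (by omega))
  have hkU : k ≤ U := by
    have h1 : (B : ℝ) ^ k ≤ (B : ℝ) ^ U := by
      calc (B : ℝ) ^ k ≤ 2 ^ k * n := hBk.trans (by gcongr)
        _ ≤ (B : ℝ) ^ U := by exact_mod_cast hnU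
    exact (Nat.pow_le_pow_iff_right (by omega : 1 < B)).1 (by exact_mod_cast h1)
  have hnT : n * B ^ T ≤ B ^ U := by
    refine le_trans ?_ hU1
    rw [mul_assoc]
    exact Nat.le_mul_of_pos_left _ (Nat.pow_pos two_pos)
  have hTU : T ≤ U := by
    refine (Nat.pow_le_pow_iff_right (by omega : 1 < B)).1 (le_trans ?_ hnT)
    exact Nat.le_mul_of_pos_left _ (by omega)
  -- The number of records is polynomial in `n`, thanks to `X ≤ C₁ * n`, while `B ≥ n ^ (δ / k)`; so
  -- the depth `U` is bounded by a constant.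
  have hUU₀ : U ≤ U₀ := by
    have h1 : (n : ℝ) ^ (δ / k * U) ≤ (n : ℝ) ^ ((E : ℝ) + 4) := by
      rw [← hβpow]
      calc β ^ U ≤ (B : ℝ) ^ U := pow_le_pow_left₀ hβ0.le hBβ U
        _ ≤ 2 ^ k * n * B ^ 2 * X := hUr
        _ ≤ 2 ^ k * n * (4 * n ^ 2) * (C₁ * n) := by gcongr
        _ = (2 ^ (k + 2) * C₁) * n ^ 4 := by ring
        _ ≤ 2 ^ E * n ^ 4 := by gcongr
        _ ≤ (n : ℝ) ^ E * n ^ 4 := by gcongr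
        _ = (n : ℝ) ^ ((E : ℝ) + 4) := by
          rw [Real.rpow_add hn0, Real.rpow_natCast]
          congr 1
          rw [← Real.rpow_natCast]
          norm_num
    have h2 := (Real.rpow_le_rpow_left_iff (by linarith : (1 : ℝ) < n)).1 h1
    have h3 : (U : ℝ) ≤ (E + 4) * k / δ := by
      rw [le_div_iff₀ hδ]
      rw [div_mul_eq_mul_div, div_le_iff₀ hk0] at h2
      linarith
    exact Nat.cast_le (α := ℝ).1 (h3.trans (Nat.le_ceil _))
  have hMk : B ^ (U + 1 - k) * B ^ k = B ^ (U + 1) := by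
    rw [← pow_add, Nat.sub_add_cancel (by omega)]
  set Z : ℝ := n * Real.log Δ with hZ
  have hZ1 : 2 * Real.log 2 ≤ Z :=
    mul_le_mul hn2 hlogΔ (by linarith) hn0.le
  have hZ0 : 0 < Z := by linarith
  have hlogZ : Real.log (2 * Real.log 2) ≤ Real.log Z := Real.log_le_log (by linarith) hZ1
  refine ⟨B, U, T, Nat.log 2 (B ^ U) + 1, hB, hkU, hTU, hT1, hnT,
    Nat.lt_pow_succ_log_self one_lt_two _, ?_, ?_, ?_, ?_, ?_, ?_⟩
  · exact Nat.ceil_le.2 (by exact_mod_cast hnδB)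
  · have h1 : 3 * sortRounds (U + 1 - k) + 4 * T + 2 * U + 8 ≤
        3 * sortRounds U₀ + 4 * U₀ + 2 * U₀ + 8 := by
      have := sortRounds_mono (show U + 1 - k ≤ U₀ by omega)
      omega
    have h2 : ((3 * sortRounds (U + 1 - k) + 4 * T + 2 * U + 8 : ℕ) : ℝ) ≤ Cr := by
      rw [hCr]
      exact Nat.cast_le.2 h1
    linarith
  · have h1 : ((B ^ k * (2 * d + 3) : ℕ) : ℝ) ≤ Cs * (n : ℝ) ^ δ := by
      push_cast
      calc (B : ℝ) ^ k * (2 * d + 3) ≤ (2 ^ k * (n : ℝ) ^ δ) * (2 * d + 3) := by gcongr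
        _ = _ := by rw [hCs]; ring
    refine h1.trans ?_
    gcongr
    linarith
  · have h1 : ((B ^ k * (2 * d + 3) : ℕ) : ℝ) * ((B ^ (U + 1 - k) : ℕ) : ℝ) =
        (2 * d + 3) * (B : ℝ) ^ (U + 1) := by
      have : B ^ k * (2 * d + 3) * B ^ (U + 1 - k) = (2 * d + 3) * B ^ (U + 1) := by
        rw [← hMk]
        ring
      exact_mod_cast this
    have hB3 : (B : ℝ) ^ 3 ≤ 8 * (n : ℝ) ^ ρ := by
      calc (B : ℝ) ^ 3 ≤ (2 * β) ^ 3 := pow_le_pow_left₀ hB0.le hB2β 3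
        _ = 8 * β ^ 3 := by ring
        _ ≤ _ := by gcongr
    have hlog0 : 0 ≤ Real.log Δ := by linarith
    have h2 : (2 * d + 3) * (B : ℝ) ^ (U + 1) ≤
        Cg * ((n : ℝ) ^ (1 + ρ) * Real.log n ^ 2 * Real.log Δ) := by
      calc (2 * d + 3) * (B : ℝ) ^ (U + 1) = (2 * d + 3) * ((B : ℝ) ^ U * B) := by rw [pow_succ]
        _ ≤ (2 * d + 3) * ((2 ^ k * n * B ^ 2 * X) * B) := by gcongr
        _ = (2 * d + 3) * 2 ^ k * n * B ^ 3 * X := by ring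
        _ ≤ (2 * d + 3) * 2 ^ k * n * (8 * (n : ℝ) ^ ρ) * (C₁ * Real.log Δ) := by gcongr
        _ = (2 * d + 3) * 2 ^ (k + 3) * C₁ * ((n : ℝ) ^ (1 + ρ) * 1 * Real.log Δ) := by
          rw [Real.rpow_add hn0, Real.rpow_one]
          ring
        -- The factor `log n ^ 2` of the space bound is not needed; it enters only through `log 2 ≤
        -- log n`.
        _ = Cg * ((n : ℝ) ^ (1 + ρ) * Real.log 2 ^ 2 * Real.log Δ) := by
          rw [hCg]
          field_simp
        _ ≤ _ := by gcongr
    rw [h1]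
    refine h2.trans ?_
    gcongr
    linarith
  · have h8 : ((Nat.log 2 (B ^ U) + 1 : ℕ) : ℝ) ≤ Cw * Real.log Z := by
      refine natLog_succ_le hn2 hΔ (Nat.pow_pos (by omega)) ?_
      rw [Nat.cast_pow]
      calc (B : ℝ) ^ U ≤ 2 ^ k * n * B ^ 2 * X := hUr
        _ ≤ 2 ^ k * n * (4 * n ^ 2) * (C₁ * Real.log Δ) := by gcongr
        _ = (2 ^ (k + 2) * C₁) * (n ^ 2 * Z) := by rw [hZ]; ring
        _ ≤ 2 ^ E * (n ^ 2 * Z) := by gcongr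
    exact h8.trans (mul_le_mul_of_nonneg_right (by linarith) (by linarith))
  · have h1 : 2 ^ k * n ≤ 2 ^ k * (B ^ (U + 1 - k) * ⌈(n : ℝ) ^ δ⌉₊) := by
      have h2 : B ^ k ≤ 2 ^ k * ⌈(n : ℝ) ^ δ⌉₊ := by
        have : (B : ℝ) ^ k ≤ 2 ^ k * (⌈(n : ℝ) ^ δ⌉₊ : ℝ) :=
          hBk.trans (by gcongr; exact Nat.le_ceil _)
        exact_mod_cast this
      calc 2 ^ k * n ≤ B ^ U := hnU
        _ ≤ B ^ (U + 1) := Nat.pow_le_pow_right (by omega) (by omega)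
        _ = B ^ (U + 1 - k) * B ^ k := hMk.symm
        _ ≤ B ^ (U + 1 - k) * (2 ^ k * ⌈(n : ℝ) ^ δ⌉₊) := Nat.mul_le_mul_left _ h2
        _ = _ := by ring
    exact Nat.le_of_mul_le_mul_left h1 (Nat.pow_pos two_pos)

end ObliviousMPC

/-! ### The theorem. -/

theorem mainTheorem5 (ρ : ℝ) (hρ : 0 < ρ) :
    ∃ c : ℝ, 1 < c ∧
      ∀ (d : ℕ) (δ : ℝ), 0 < δ → δ < 1 → ∀ γ : ℝ, 0 < γ → ∃ C : ℝ,
        ∀ n : ℕ, 2 ≤ n → ∀ Δ : ℝ, 2 ≤ Δ → ∃ A : MPCAlgorithm,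
          (A.rounds : ℝ) ≤ C ∧
          (A.localSpace : ℝ) ≤ C * (n : ℝ) ^ δ ∧
          (A.localSpace : ℝ) * (A.machines : ℝ) ≤
            C * ((n : ℝ) ^ (1 + ρ) * Real.log n ^ 2 * Real.log Δ) ∧
          (A.wordBits : ℝ) ≤ C * Real.log (n * Real.log Δ) ∧
          n ≤ A.machines * ⌈(n : ℝ) ^ δ⌉₊ ∧
          ∀ Q H : Finset (EuclideanSpace ℝ (Fin d)),
            Q.card ≤ n → H ⊆ Q →
            (∀ x ∈ Q, ∀ y ∈ Q, x ≠ y → 1 ≤ dist x y ∧ dist x y ≤ Δ) →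
            ∀ place : Fin A.machines → List (EuclideanSpace ℝ (Fin d)),
              A.IsPlacement Q ⌈(n : ℝ) ^ δ⌉₊ place →
              A.RespectsSpace (A.initial H place) ∧
              (H.Nonempty →
                1 - (n : ℝ) ^ (-γ) ≤ A.prob fun ω =>
                  A.HoldsNearHubs Q H (2 * c)
                    (A.configAt ω (A.initial H place) A.rounds)) := by
  refine ⟨2, one_lt_two, fun d δ hδ hδ1 γ _ => ?_⟩
  set K := (ObliviousMPC.offsets d).card with hK
  have hK1 : 1 ≤ K := by
    obtain ⟨j, hj, -⟩ := ObliviousMPC.exists_offset_eq (d := d) (v := 0) fun k => by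
      simp only [Pi.zero_apply, abs_zero]
      positivity
    omega
  have hlog2 : (0.69 : ℝ) < Real.log 2 := by linarith [Real.log_two_gt_d9]
  have hlog2' : Real.log 2 < 1 := by linarith [Real.log_two_lt_d9]
  -- There are at most `log Δ / log 2 + 1 ≤ 2 * log Δ / log 2` scales, with `K` offsets each.
  set C₁ : ℝ := 2 * K / Real.log 2 with hC₁
  have hK1' : (1 : ℝ) ≤ K := by exact_mod_cast hK1
  have hC₁1 : 1 ≤ C₁ := by
    rw [hC₁, le_div_iff₀ (by linarith)]
    linarith
  obtain ⟨k, hk⟩ := exists_nat_ge (max 3 (3 / ρ))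
  have hk3 : 3 ≤ k := by exact_mod_cast (le_max_left 3 (3 / ρ)).trans hk
  have hkρ : 3 / (k : ℝ) ≤ ρ := by
    have hk0 : (0 : ℝ) < k := by exact_mod_cast (by omega : 0 < k)
    rw [div_le_iff₀ hk0, ← div_le_iff₀' hρ]
    exact (le_max_right 3 (3 / ρ)).trans hk
  obtain ⟨C, hC⟩ := ObliviousMPC.exists_parameters (d := d) hδ hδ1
    (by linarith : 0 < C₁) hk3 hkρ
  refine ⟨C, fun n hn Δ hΔ => ?_⟩
  have hn0 : (0 : ℝ) ≤ n := Nat.cast_nonneg n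
  have hlogΔ : Real.log 2 ≤ Real.log Δ := Real.log_le_log (by norm_num) hΔ
  have key : ∃ X : ℕ, 1 ≤ X ∧ (X : ℝ) ≤ C₁ * Real.log Δ ∧ (X : ℝ) ≤ C₁ * n ∧
      ∀ R, X ≤ R → ∃ kh kq : ℕ → EuclideanSpace ℝ (Fin d) → ℕ,
        ∀ (H : Finset (EuclideanSpace ℝ (Fin d))) (q : EuclideanSpace ℝ (Fin d)), H.Nonempty →
          (∀ h ∈ H, 1 ≤ dist q h ∧ dist q h ≤ Δ) → ObliviousMPC.KeysNear n R kh kq H 4 q := by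
    -- The copies must number `O(log Δ)` for the space and `O(n)` for the rounds; the smaller of the
    -- two decides between grid keys and ranks.
    rcases le_total (Real.log Δ) n with h | h
    · have hX : (((⌊Real.logb 2 Δ⌋₊ + 1) * K : ℕ) : ℝ) ≤ C₁ * Real.log Δ := by
        have h1 : (⌊Real.logb 2 Δ⌋₊ : ℝ) ≤ Real.log Δ / Real.log 2 :=
          Nat.floor_le (Real.logb_nonneg one_lt_two (by linarith))
        have h2 : 1 ≤ Real.log Δ / Real.log 2 := by
          rwa [le_div_iff₀ (by linarith), one_mul]
        push_cast
        calc ((⌊Real.logb 2 Δ⌋₊ : ℝ) + 1) * K ≤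
              (Real.log Δ / Real.log 2 + Real.log Δ / Real.log 2) * K := by gcongr
          _ = _ := by rw [hC₁]; ring
      refine ⟨(⌊Real.logb 2 Δ⌋₊ + 1) * K, Nat.mul_pos (Nat.succ_pos _) hK1, hX,
        hX.trans (by gcongr), fun R hR => ⟨ObliviousMPC.gridHubKey d R,
          ObliviousMPC.gridQueryKey d R, fun H q hH hq => ?_⟩⟩
      exact ObliviousMPC.keysNear_grid hR hH hq
    · refine ⟨n, by omega, ?_, ?_, fun R hR => ⟨_, _, fun H q hH hq =>
        ObliviousMPC.keysNear_rank hR hH fun h hh => (hq h hh).1⟩⟩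
      · exact h.trans (le_mul_of_one_le_left (by linarith) hC₁1)
      · exact le_mul_of_one_le_left hn0 hC₁1
  obtain ⟨X, hX, hX1, hX2, hXk⟩ := key
  obtain ⟨B, U, T, w, hB, hkU, hTU, hXT, hnT, hwU, hcap, h1, h2, h3, h4, h5⟩ :=
    hC n hn Δ hΔ X hX hX1 hX2
  obtain ⟨kh, kq, hkeys⟩ := hXk _ hXT
  obtain ⟨A, e1, e2, e3, e4, hA⟩ :=
    ObliviousMPC.exists_algorithm hB hk3 hkU hTU hnT hwU kh kq
  refine ⟨A, ?_, ?_, ?_, ?_, ?_, fun Q H hQ hHQ hdist place hplace => ?_⟩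
  · rwa [e4]
  · rwa [e2]
  · rwa [e1, e2]
  · rwa [e3]
  · rwa [e1]
  · obtain ⟨h6, h7⟩ := hA Q H _ (2 * 2) place hHQ hQ hcap hplace
    refine ⟨h6, fun hH => ?_⟩
    rw [ObliviousMPC.prob_eq_one A (h7 fun q hq hqH => ?_)]
    · linarith [Real.rpow_nonneg hn0 (-γ)]
    · rw [show (2 * 2 : ℝ) = 4 by norm_num]
      exact hkeys H q hH fun h hh => hdist q hq h (hHQ hh) fun e => hqH (e ▸ hh)
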